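/- All graphs are finite, simple, undirected and connected; an input $(G,\boldsymbol x,\mathrm{Id})$ is a graph with node labels $\boldsymbol x(v)$ and distinct identifiers $\mathrm{Id}(v)\in\mathbb N$, and $n=|V(G)|$. A (computable) randomised local algorithm with horizon $t$ gives each node an unbounded string of independent fair random bits; the output (yes/no) at $v$ is computed by a Turing machine from an encoding of $v$ and of the restriction of $(G,\boldsymbol x,\mathrm{Id})$, together with the random strings, to the nodes within distance $t$ of $v$, independently of the chosen encoding. It is Id-oblivious if the outputs do not change when the identifiers are reassigned. It is a $(p,q)$-decider for a labelled graph property $\mathcal P$ if, on every input, almost surely every node halts; if $(G,\boldsymbol x)\in\mathcal P$ then with probability at least $p$ all nodes output yes; and if $(G,\boldsymbol x)\notin\mathcal P$ then with probability at least $q$ some node outputs no ($q$ may depend on $n$). The property $\mathcal P$ is defined as follows. Let $M$ be a deterministic one-tape Turing machine (one-way infinite tape) that, started on the blank tape with its head on the leftmost cell, halts after $s$ steps, where $s+1=2^h$ for some $h\ge 0$, and let $r\in\mathbb N$. The output of $M$ is the symbol scanned when it halts; the blank is the symbol $0$. * The execution table $T$ of $M$ is the $(s+1)\times(s+1)$ grid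 whose $i$-th row is the configuration before the $i$-th step; each node is labelled with its column and row modulo $3$, its tape symbol and, if the head is there, the state and the direction ($\leftarrow$, $\rightarrow$, none) from which the head arrived. Its top left node is the pivot. * A fragment is a labelling of the $2^{3r}\times 2^{3r}$ grid with labels of this kind (with states and symbols of $M$) whose mod-$3$ coordinates give a consistent orientation and all of whose $2\times2$ sub-tables are consistent with the transition function of $M$ (in particular, the head is in a halting state only in the last row). Its top border is never natural; its left (right) border is natural if on it the head never arrives from, or moves to, the left (right); its bottom border is natural if it contains no head in a non-halting state. If precisely the top and the bottom border are non-natural, the fragment is replaced by two copies, in which the left, respectively the right, border is counted as non-natural as well. * The pyramid over a grid $[2^k]\times[2^k]$ has layers $z=0,\dots,k$, layer $z$ being the grid $[2^{k-z}]\times[2^{k-z}]$, and each node $(x,y,z)$ with $z<k$ is also adjacent to $(\lceil x/2\rceil,\lceil y/2\rceil,z+1)$. Layer $0$ is the given labelled grid. * $G(M,r)$ is the disjoint union of the pyramid over $T$ and of the pyramids over all fragments, with additional edges from the pivot to every layer-$0$ node on a non-natural border of a fragment. In addition to the labels above, every node has the label $(M,r)$; nodes of layers $z\ge1$ have no other label.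 Let $\mathcal P$ be the class of all labelled graphs isomorphic to $G(M,r)$ for some such $M$ and $r$, where $M$ outputs $0$. **Corollary.** There is a computable Id-oblivious randomised local algorithm that is a $(1,1-o(1))$-decider for $\mathcal P$: on yes-instances, with probability $1$ all nodes output yes, and on no-instances with $n$ nodes some node outputs no with probability at least $1-(1-1/\sqrt n)^n$, which tends to $1$ as $n\to\infty$. -/

import Mathlib

/-! ## Randomised local algorithms and local decision -/

namespace LocalDecision

open MeasureTheory

/-- A labelled graph property: a class of labelled graphs that is invariant under isomorphism. -/
structure LabelledGraphProperty (L : Type) where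
  holds : ∀ {V : Type}, SimpleGraph V → (V → L) → Prop
  iso_invariant : ∀ {V W : Type} (G : SimpleGraph V) (H : SimpleGraph W) (x : V → L) (y : W → L)
    (φ : G ≃g H), (∀ v, x v = y (φ v)) → holds G x → holds H y

/-- The set `B(v, t)` of nodes within distance `t` of `v`. -/
def ball {V : Type} (G : SimpleGraph V) (v : V) (t : ℕ) : Set V :=
  {u | ∃ w : G.Walk v u, w.length ≤ t}

/-- The list `l` enumerates the set `S` without repetitions. -/
def Enumerates {V : Type} (l : List V) (S : Set V) : Prop :=
  l.Nodup ∧ ∀ u, u ∈ l ↔ u ∈ S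

/-- Finite data encoding a node and its local neighbourhood: the index of the node, the adjacency
matrix of the neighbourhood, and for each of its nodes the local input, the identifier and the
initial part of its random bit string. -/
abbrev View (L : Type) : Type := ℕ × List (List Bool) × List (L × ℕ × List Bool)

open Classical in
/-- The encoding of the node `v` and of the restriction of `(G, x, Id)` to the nodes listed in `l`,
together with the first `m` random bits of each of these nodes. Bit number `k` of the random string
of the node `u` is `ω (u, k)`. -/
noncomputable def view {V L : Type} (G : SimpleGraph V) (x : V → L) (ident : V → ℕ)
    (ω : V × ℕ → Bool) (m : ℕ) (l : List V) (v : V) : View L :=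
  (l.idxOf v,
   l.map (fun u => l.map (fun w => decide (G.Adj u w))),
   l.map (fun u => (x u, ident u, (List.range m).map (fun k => ω (u, k)))))

/-- A computable randomised local algorithm (assumption (C)). Each node has an unbounded string of
random bits. `run` is what the machine at a node does in `m` steps on an encoded
radius-`horizon` neighbourhood, in which time it can read at most the first `m` bits of each random
string: `some b` if it has halted with output `b` (`true` is yes, `false` is no), and `none` if it is
still running. The output must not depend on the chosen encoding of the neighbourhood. -/
structure RandomisedLocalAlgorithm (L : Type) [Primcodable L] where
  horizon : ℕ
  run : View L → Option Bool
  computable_run : Computable run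
  run_succ : ∀ {V : Type} [Finite V] (G : SimpleGraph V) (x : V → L) (ident : V → ℕ)
    (ω : V × ℕ → Bool) (m : ℕ) (l : List V) (v : V) (b : Bool),
    G.Connected → Function.Injective ident → Enumerates l (ball G v horizon) →
    run (view G x ident ω m l v) = some b → run (view G x ident ω (m + 1) l v) = some b
  encoding_independent : ∀ {V : Type} [Finite V] (G : SimpleGraph V) (x : V → L) (ident : V → ℕ)
    (ω : V × ℕ → Bool) (l l' : List V) (v : V) (b : Bool),
    G.Connected → Function.Injective ident →
    Enumerates l (ball G v horizon) → Enumerates l' (ball G v horizon) →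
    (∃ m, run (view G x ident ω m l v) = some b) → ∃ m, run (view G x ident ω m l' v) = some b

/-- On the input `(G, x, Id)` with random bits `ω`, the node `v` halts with output `b`. -/
def RandomisedLocalAlgorithm.Outputs {L : Type} [Primcodable L] (A : RandomisedLocalAlgorithm L)
    {V : Type} (G : SimpleGraph V) (x : V → L) (ident : V → ℕ) (ω : V × ℕ → Bool) (v : V)
    (b : Bool) : Prop :=
  ∃ (l : List V) (m : ℕ), Enumerates l (ball G v A.horizon) ∧
    A.run (view G x ident ω m l v) = some b

/-- Renumbering the identifiers never changes an output. -/
def RandomisedLocalAlgorithm.IdOblivious {L : Type} [Primcodable L]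
    (A : RandomisedLocalAlgorithm L) : Prop :=
  ∀ {V : Type} [Finite V] (G : SimpleGraph V) (x : V → L) (ident ident' : V → ℕ)
    (ω : V × ℕ → Bool) (v : V) (b : Bool),
    G.Connected → Function.Injective ident → Function.Injective ident' →
    (A.Outputs G x ident ω v b ↔ A.Outputs G x ident' ω v b)

/-- The law of a fair coin. -/
noncomputable def fairCoin : Measure Bool := (PMF.uniformOfFintype Bool).toMeasure

instance : IsProbabilityMeasure fairCoin :=
  inferInstanceAs (IsProbabilityMeasure (PMF.uniformOfFintype Bool).toMeasure)

/-- All bits of all random strings are independent and fair. -/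
noncomputable def coinMeasure (V : Type) : Measure (V × ℕ → Bool) :=
  Measure.infinitePi (fun _ => fairCoin)

/-- `A` is a `(p, q)`-decider for `P` on connected inputs, where `q` may depend on the number of
nodes. Almost surely all nodes halt. -/
structure RandomisedLocalAlgorithm.IsDecider {L : Type} [Primcodable L]
    (A : RandomisedLocalAlgorithm L) (P : LabelledGraphProperty L) (p : ℝ) (q : ℕ → ℝ) :
    Prop where
  halts : ∀ {V : Type} [Fintype V] (G : SimpleGraph V) (x : V → L) (ident : V → ℕ),
    G.Connected → Function.Injective ident →
    ∀ᵐ ω ∂(coinMeasure V), ∀ v, ∃ b, A.Outputs G x ident ω v b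
  accepts : ∀ {V : Type} [Fintype V] (G : SimpleGraph V) (x : V → L) (ident : V → ℕ),
    G.Connected → Function.Injective ident → P.holds G x →
    p ≤ (coinMeasure V).real {ω | ∀ v, A.Outputs G x ident ω v true}
  rejects : ∀ {V : Type} [Fintype V] (G : SimpleGraph V) (x : V → L) (ident : V → ℕ),
    G.Connected → Function.Injective ident → ¬ P.holds G x →
    q (Fintype.card V) ≤ (coinMeasure V).real {ω | ∃ v, A.Outputs G x ident ω v false}

/-! ## Turing machines with a one-way infinite tape -/

/-- Head movements. -/
inductive Move
  | left
  | stay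
  | right
  deriving DecidableEq

def Move.equivFin : Move ≃ Fin 3 where
  toFun m := match m with
    | .left => 0
    | .stay => 1
    | .right => 2
  invFun i := match i with
    | 0 => .left
    | 1 => .stay
    | 2 => .right
  left_inv m := by cases m <;> rfl
  right_inv i := by fin_cases i <;> rfl

instance : Primcodable Move := Primcodable.ofEquiv (Fin 3) Move.equivFin

/-- A deterministic Turing machine, given by its finite list of instructions
`((q, a), (q', b, m))`: in state `q` scanning the symbol `a`, write `b`, move by `m` and go to
state `q'`. The first instruction that matches is the one that counts. State `0` is the initial
state and symbol `0` is the blank. The machine halts when no instruction matches. -/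
abbrev Machine : Type := List ((ℕ × ℕ) × (ℕ × ℕ × Move))

/-- The (partial) transition function. -/
def transition (M : Machine) (q a : ℕ) : Option (ℕ × ℕ × Move) := M.lookup (q, a)

/-- The finitely many states of `M`. -/
def states (M : Machine) : List ℕ := 0 :: M.flatMap (fun i => [i.1.1, i.2.1])

/-- The finitely many tape symbols of `M`. -/
def symbols (M : Machine) : List ℕ := 0 :: M.flatMap (fun i => [i.1.2, i.2.2.1])

/-- A configuration; `arrived` is the last movement of the head (`stay` at the start). -/
structure Config where
  state : ℕ
  pos : ℕ
  tape : ℕ → ℕ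
  arrived : Move

/-- The initial configuration on a blank tape, with the head on the leftmost cell. -/
def Config.init : Config := ⟨0, 0, fun _ => 0, .stay⟩

/-- One step. There is no next configuration if the machine has halted, nor if it tries to move to
the left of the leftmost cell; in the latter case the computation is stuck without having halted. -/
def Config.step (M : Machine) (c : Config) : Option Config :=
  match transition M c.state (c.tape c.pos) with
  | none => none
  | some (q, b, .left) =>
      if c.pos = 0 then none else some ⟨q, c.pos - 1, Function.update c.tape c.pos b, .left⟩
  | some (q, b, .stay) => some ⟨q, c.pos, Function.update c.tape c.pos b, .stay⟩
  | some (q, b, .right) => some ⟨q, c.pos + 1, Function.update c.tape c.pos b, .right⟩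

/-- The configuration after `i` steps. -/
def configAt (M : Machine) : ℕ → Option Config
  | 0 => some Config.init
  | i + 1 => (configAt M i).bind (Config.step M)

/-- Started on a blank tape, `M` halts after exactly `s` steps, with output `o`; the output is the
symbol that is scanned when the machine halts. -/
def HaltsWithOutput (M : Machine) (s o : ℕ) : Prop :=
  ∃ c, configAt M s = some c ∧ transition M c.state (c.tape c.pos) = none ∧ c.tape c.pos = o

/-! ## Execution tables and their local consistency rules -/

/-- Contents of a table cell: the tape symbol and, if the head is there, the state of the machine
and the movement by which the head arrived. -/
abbrev Content : Type := ℕ × Option (ℕ × Move)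

/-- Label of a table cell: the coordinates modulo 3 and the contents. -/
abbrev Cell : Type := (Fin 3 × Fin 3) × Content

/-- Node labels: the universal label `(M, r)` and, for the nodes of a table, a cell label. -/
abbrev Label : Type := (Machine × ℕ) × Option Cell

def mod3 (x y : ℕ) : Fin 3 × Fin 3 := (Fin.ofNat 3 x, Fin.ofNat 3 y)

/-- The cell in column `x` and row `y` of the execution table of `M` on the blank tape: row `y` is
the configuration after `y` steps. -/
def tableCell (M : Machine) (x y : ℕ) : Cell :=
  let c := (configAt M y).getD Config.init
  (mod3 x y, c.tape x, if c.pos = x then some (c.state, c.arrived) else none)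

/-- The instruction that is carried out at a cell with the given contents, if any. -/
def action (M : Machine) (c : Content) : Option (ℕ × ℕ × Move) :=
  c.2.bind (fun h => transition M h.1 c.1)

/-- The cell contains the head in a halting state. -/
def IsHalted (M : Machine) (c : Content) : Prop := c.2.isSome ∧ action M c = none

/-- The head is at this cell, and the next step moves it by `m` and leads to the state `q`. -/
def Emits (M : Machine) (c : Content) (m : Move) (q : ℕ) : Prop :=
  ∃ b, action M c = some (q, b, m)

/-- The symbol in the cell after the next step. -/
def written (M : Machine) (c : Content) : ℕ :=
  match action M c with
  | none => c.1
  | some (_, b, _) => b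

/-- `C'` can be below `C` in the table if the left and right neighbours of `C` are `L` and `R`. -/
def Follows (M : Machine) (L C R C' : Content) : Prop :=
  ¬ IsHalted M C ∧ C'.1 = written M C ∧
    ∀ q m, C'.2 = some (q, m) ↔
      (m = .right ∧ Emits M L .right q) ∨ (m = .stay ∧ Emits M C .stay q) ∨
      (m = .left ∧ Emits M R .left q)

/-- The `2 × 2` sub-table with upper row `A B` and lower row `C D` is consistent with the transition
function: some contents of the cells to its left and right explain the lower row. -/
def WindowConsistent (M : Machine) (A B C D : Content) : Prop :=
  ∃ L R : Content, Follows M L A B C ∧ Follows M A B R D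

/-! ## Table fragments -/

/-- Labellings of the `n × n` grid; `F x y` is the label in column `x` and row `y`. -/
abbrev Labelling (n : ℕ) : Type := Fin n → Fin n → Cell

/-- The labelling uses the states and symbols of `M` and satisfies the local consistency rules. -/
structure Labelling.Consistent (M : Machine) {n : ℕ} (F : Labelling n) : Prop where
  symbols_mem : ∀ x y, (F x y).2.1 ∈ symbols M
  states_mem : ∀ x y q m, (F x y).2.2 = some (q, m) → q ∈ states M
  orientation : ∃ a b : ℕ, ∀ x y, (F x y).1 = mod3 (a + x) (b + y)
  windows : ∀ x y x' y' : Fin n, (x' : ℕ) = x + 1 → (y' : ℕ) = y + 1 →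
    WindowConsistent M (F x y).2 (F x' y).2 (F x y').2 (F x' y').2

inductive Border
  | top
  | left
  | right
  | bottom

/-- The node in column `x` and row `y` of an `n × n` grid lies on the given border. -/
def Border.Contains (n x y : ℕ) : Border → Prop
  | .top => y = 0
  | .left => x = 0
  | .right => x + 1 = n
  | .bottom => y + 1 = n

/-- Natural borders. Left (right): the head never moves to, or appears from, the left (right) of the
column. Bottom: the row does not contain the head in a non-halting state. The top row is never
natural. -/
def Labelling.Natural (M : Machine) {n : ℕ} (F : Labelling n) : Border → Prop
  | .top => False
  | .left => ∀ x y : Fin n, Border.Contains n x y .left →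
      (∀ q, (F x y).2.2 ≠ some (q, .right)) ∧ ∀ q, ¬ Emits M (F x y).2 .left q
  | .right => ∀ x y : Fin n, Border.Contains n x y .right →
      (∀ q, (F x y).2.2 ≠ some (q, .left)) ∧ ∀ q, ¬ Emits M (F x y).2 .right q
  | .bottom => ∀ x y : Fin n, Border.Contains n x y .bottom →
      (F x y).2.2.isSome → IsHalted M (F x y).2

/-- `S` is a set of borders that are interpreted as the non-natural ones: it is the set of all
non-natural borders, except that if precisely the top and the bottom row are non-natural, then the
left or the right border is added to make the non-natural borders connected. -/
def Labelling.BorderChoice (M : Machine) {n : ℕ} (F : Labelling n) (S : Set Border) : Prop :=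
  let N : Set Border := {b | ¬ F.Natural M b}
  (N ≠ {.top, .bottom} ∧ S = N) ∨
  (N = {.top, .bottom} ∧ (S = {.top, .bottom, .left} ∨ S = {.top, .bottom, .right}))

/-- The fragment collection: all consistent labellings of the grid of side `2 ^ (3 r)`, each with
its interpretation of the borders (two copies of a labelling with two interpretations). -/
@[ext]
structure Fragment (M : Machine) (r : ℕ) where
  labelling : Labelling (2 ^ (3 * r))
  consistent : labelling.Consistent M
  nonNatural : Set Border
  borderChoice : labelling.BorderChoice M nonNatural

/-! ## Pyramids and the graph `G(M, r)` -/

/-- Nodes of the layered quadtree over the grid of side `2 ^ h`: layer `z` is a grid of side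
`2 ^ (h - z)`, for `z = 0, …, h`. -/
@[ext]
structure Pyramid (h : ℕ) where
  x : ℕ
  y : ℕ
  z : ℕ
  z_le : z ≤ h
  x_lt : x < 2 ^ (h - z)
  y_lt : y < 2 ^ (h - z)

theorem Pyramid.x_lt' {h : ℕ} (p : Pyramid h) : p.x < 2 ^ h :=
  p.x_lt.trans_le (Nat.pow_le_pow_right (by norm_num) (Nat.sub_le _ _))

theorem Pyramid.y_lt' {h : ℕ} (p : Pyramid h) : p.y < 2 ^ h :=
  p.y_lt.trans_le (Nat.pow_le_pow_right (by norm_num) (Nat.sub_le _ _))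

/-- The layered quadtree: grid edges within each layer, and an edge from each node to its parent in
the next layer. With coordinates counted from `0`, the parent of `(x, y, z)` is
`(⌊x/2⌋, ⌊y/2⌋, z + 1)`. -/
def pyramidGraph (h : ℕ) : SimpleGraph (Pyramid h) :=
  SimpleGraph.fromRel (fun p q =>
    (q.z = p.z ∧ q.x = p.x + 1 ∧ q.y = p.y) ∨
    (q.z = p.z ∧ q.x = p.x ∧ q.y = p.y + 1) ∨
    (q.z = p.z + 1 ∧ q.x = p.x / 2 ∧ q.y = p.y / 2))

/-- Nodes of `G(M, r)` for a machine `M` with running time `2 ^ h - 1`: the pyramid over the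
execution table, and a pyramid over each fragment. -/
abbrev Node (M : Machine) (r h : ℕ) : Type := Pyramid h ⊕ (Fragment M r × Pyramid (3 * r))

/-- The edges of `G(M, r)`: those of the pyramids, and edges that connect each node of a non-natural
border of a fragment to the pivot, that is, to the top left node of the execution table. -/
def instanceGraph (M : Machine) (r h : ℕ) : SimpleGraph (Node M r h) :=
  SimpleGraph.fromRel (fun u v =>
    match u, v with
    | .inl p, .inl q => (pyramidGraph h).Adj p q
    | .inr (F, p), .inr (F', q) => F = F' ∧ (pyramidGraph (3 * r)).Adj p q
    | .inl p, .inr (F, q) =>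
        (p.x = 0 ∧ p.y = 0 ∧ p.z = 0) ∧
        (q.z = 0 ∧ ∃ b ∈ F.nonNatural, Border.Contains (2 ^ (3 * r)) q.x q.y b)
    | .inr _, .inl _ => False)

/-- The labels of `G(M, r)`. -/
def instanceLabel (M : Machine) (r h : ℕ) : Node M r h → Label
  | .inl p => ((M, r), if p.z = 0 then some (tableCell M p.x p.y) else none)
  | .inr (F, p) =>
      ((M, r), if p.z = 0 then some (F.labelling ⟨p.x, p.x_lt'⟩ ⟨p.y, p.y_lt'⟩) else none)

/-- The property `{ G(M, r) : M outputs 0 }`, where `M` ranges over the machines whose running time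
`s` on the blank tape is such that the side `s + 1` of the table is a power of two. -/
def propertyP : LabelledGraphProperty Label where
  holds {V} G x := ∃ (M : Machine) (r h s : ℕ), s + 1 = 2 ^ h ∧ HaltsWithOutput M s 0 ∧
    ∃ φ : G ≃g instanceGraph M r h, ∀ v, x v = instanceLabel M r h (φ v)
  iso_invariant := by
    rintro V W G H x y φ hxy ⟨M, r, h, s, hs, hM, ψ, hψ⟩
    refine ⟨M, r, h, s, hs, hM, φ.symm.trans ψ, fun w => ?_⟩
    have h1 := hxy (φ.symm w)
    have h2 := hψ (φ.symm w)
    simp only [RelIso.apply_symm_apply] at h1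
    rw [← h1, h2]
    rfl

end LocalDecision

/-! The decider combines a deterministic structural check with a randomised simulation. The check
succeeds at all nodes of a connected graph exactly when the graph is some `G(M, r)`, where `M` halts
after `s` steps with `s + 1 = 2 ^ h`, whatever its output (`Accepted.exists_iso` and
`InstanceLayout.structureCheck`). It remains to detect a nonzero output.

A node tosses its coin until the first head, after `k` tails say, simulates `M` for `2 ^ k` steps,
and says no if `M` has halted with a nonzero output. Hence no node ever errs on a yes-instance. The
bottom layer over the execution table alone has `4 ^ h` nodes, so `n ≥ 4 ^ h`, and a node sees at
least `h` tails with probability `2 ^ (-h) ≥ 1 / √n`; such a node simulates `M` to the end. By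
independence all nodes miss with probability at most `(1 - 1 / √n) ^ n ≤ exp (-√n)`
(`le_coinMeasure_exists_firstHead`, `tendsto_bound`). Identifiers are never consulted.

The check consists of first-order formulas whose quantifiers range over neighbours, so that
quantifier depth bounds the radius and evaluation is primitive recursive
(`LocalFormula.primrecPred_holds`, `LocalFormula.holds_view_iff`), and of one further condition at
the pivot: the other ends of its foreign edges match the computable list of all non-natural border
positions of all fragments (`IsMatching`).

That the check suffices has three ingredients. Pyramids are rigid: the rules for parents and lateral
edges, together with coordinates modulo 3 on the bottom layer, leave only complete quadtrees over
square grids. The coordinates propagate upwards, because modulo 3 the sum of four corners of a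
square is its centre (`QuadForest.regular`, `QuadForest.lat_node`). Next, every foreign edge joins a
pivot to an attached node, and the non-natural borders of a fragment are connected, so a matched
corner drags the whole border into one table (`exists_matching_table`); by connectivity there is one
pivot table, and all other tables belong to its fragments (`eq_or_isFragmentTable`). Finally,
contents propagate row by row: in the pivot table from the blank initial row, which yields the
execution of `M` (`exists_config`), and in a fragment table from its matched borders, with
naturality supplying what comes from outside elsewhere (`IsFragmentTable.cellOf_eq`). -/

namespace LocalDecision

open MeasureTheory

/-! ## Local formulas -/

/-- Extend an environment by a new value for the variable `0`. -/
def envCons {W : Type} (w : W) (e : ℕ → W) : ℕ → W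
  | 0 => w
  | n + 1 => e n

/-- First-order formulas about a labelled graph, in de Bruijn notation, in which each quantifier is
bounded to the neighbours of a variable. -/
inductive LocalFormula : Type
  | adj (i j : ℕ)
  | eq (i j : ℕ)
  | label (i j : ℕ) (R : Label → Label → Prop) (hR : PrimrecRel R)
  | not (φ : LocalFormula)
  | and (φ ψ : LocalFormula)
  | or (φ ψ : LocalFormula)
  | imp (φ ψ : LocalFormula)
  | exNbr (i : ℕ) (φ : LocalFormula)
  | allNbr (i : ℕ) (φ : LocalFormula)

namespace LocalFormula

/-- Truth of a formula in a structure with adjacency relation `A` and labels `L`. -/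
def Holds {W : Type} (A : W → W → Prop) (L : W → Label) : LocalFormula → (ℕ → W) → Prop
  | adj i j, e => A (e i) (e j)
  | eq i j, e => e i = e j
  | label i j R _, e => R (L (e i)) (L (e j))
  | not φ, e => ¬ Holds A L φ e
  | and φ ψ, e => Holds A L φ e ∧ Holds A L ψ e
  | or φ ψ, e => Holds A L φ e ∨ Holds A L ψ e
  | imp φ ψ, e => Holds A L φ e → Holds A L ψ e
  | exNbr i φ, e => ∃ w, A (e i) w ∧ Holds A L φ (envCons w e)
  | allNbr i φ, e => ∀ w, A (e i) w → Holds A L φ (envCons w e)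

/-- The quantifier depth. -/
def depth : LocalFormula → ℕ
  | adj _ _ => 0
  | eq _ _ => 0
  | label _ _ _ _ => 0
  | not φ => depth φ
  | and φ ψ => max (depth φ) (depth ψ)
  | or φ ψ => max (depth φ) (depth ψ)
  | imp φ ψ => max (depth φ) (depth ψ)
  | exNbr _ φ => depth φ + 1
  | allNbr _ φ => depth φ + 1

end LocalFormula

/-! ### Evaluation in an encoded view -/

instance : Inhabited Move := ⟨.stay⟩

/-- Adjacency of the nodes number `i` and `j` of an encoded view. -/
def viewAdj (w : View Label) (i j : ℕ) : Prop := (w.2.1.getD i []).getD j false = true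

/-- Label of the node number `i` of an encoded view. -/
def viewLabel (w : View Label) (i : ℕ) : Label := (w.2.2.getD i default).1

theorem primrecPred_viewAdj {α : Type} [Primcodable α] {w : α → View Label} {f g : α → ℕ}
    (hw : Primrec w) (hf : Primrec f) (hg : Primrec g) :
    PrimrecPred fun a => viewAdj (w a) (f a) (g a) :=
  Primrec.eq.comp
    ((Primrec.list_getD false).comp ((Primrec.list_getD []).comp (Primrec.fst.comp (Primrec.snd.comp hw)) hf) hg)
    (Primrec.const true)

theorem primrec_viewLabel {α : Type} [Primcodable α] {w : α → View Label} {f : α → ℕ}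
    (hw : Primrec w) (hf : Primrec f) : Primrec fun a => viewLabel (w a) (f a) :=
  Primrec.fst.comp ((Primrec.list_getD default).comp (Primrec.snd.comp (Primrec.snd.comp hw)) hf)

/-- The environment given by a list, with default value `d`. -/
def listEnv (d : ℕ) (e : List ℕ) : ℕ → ℕ := fun i => e.getD i d

theorem envCons_listEnv (d j : ℕ) (e : List ℕ) :
    envCons j (listEnv d e) = listEnv d (j :: e) := by
  funext i
  cases i <;> rfl

/-- Missing matrix entries count as `false`. Quantification over neighbours thereby becomes
quantification over a finite range, which preserves primitive recursiveness. -/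
theorem viewAdj_lt {w : View Label} {i j : ℕ} (h : viewAdj w i j) :
    j < (w.2.1.getD i []).length := by
  by_contra hj
  rw [viewAdj, List.getD_eq_default _ _ (not_lt.mp hj)] at h
  cases h

theorem PrimrecPred.imp {α : Type} [Primcodable α] {p q : α → Prop} (hp : PrimrecPred p)
    (hq : PrimrecPred q) : PrimrecPred fun a => p a → q a :=
  (hp.not.or hq).of_eq fun _ => imp_iff_not_or.symm

theorem PrimrecPred.iff {α : Type} [Primcodable α] {p q : α → Prop} (hp : PrimrecPred p)
    (hq : PrimrecPred q) : PrimrecPred fun a => p a ↔ q a :=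
  ((PrimrecPred.imp hp hq).and (PrimrecPred.imp hq hp)).of_eq fun _ => iff_iff_implies_and_implies.symm

theorem PrimrecPred.exists_mem {α β : Type} [Primcodable α] [Primcodable β] {f : α → List β}
    {p : α → β → Prop} (hf : Primrec f) (hp : PrimrecRel p) :
    PrimrecPred fun a => ∃ b ∈ f a, p a b :=
  (PrimrecRel.comp (PrimrecRel.exists_mem_list
    (R := fun (b : β) (a : α) => p a b) (hp.comp Primrec.snd Primrec.fst)) hf Primrec.id)

theorem PrimrecPred.forall_mem {α β : Type} [Primcodable α] [Primcodable β] {f : α → List β}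
    {p : α → β → Prop} (hf : Primrec f) (hp : PrimrecRel p) :
    PrimrecPred fun a => ∀ b ∈ f a, p a b :=
  (PrimrecRel.comp (PrimrecRel.forall_mem_list
    (R := fun (b : β) (a : α) => p a b) (hp.comp Primrec.snd Primrec.fst)) hf Primrec.id)

/-- A formula can be evaluated in an encoded view by a primitive recursive function. -/
theorem LocalFormula.primrecPred_holds (φ : LocalFormula) {α : Type} [Primcodable α]
    {w : α → View Label} {d : α → ℕ} {e : α → List ℕ} (hw : Primrec w) (hd : Primrec d)
    (he : Primrec e) :
    PrimrecPred fun a => φ.Holds (viewAdj (w a)) (viewLabel (w a)) (listEnv (d a) (e a)) := by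
  -- The induction needs the environment as an input of the predicate, since each quantifier puts a
  -- new entry in front of the list.
  have key : ∀ φ : LocalFormula, PrimrecPred fun a : View Label × ℕ × List ℕ =>
      φ.Holds (viewAdj a.1) (viewLabel a.1) (listEnv a.2.1 a.2.2) := by
    have hvar (i : ℕ) : Primrec fun a : View Label × ℕ × List ℕ => listEnv a.2.1 a.2.2 i := by
      have : Primrec fun a : View Label × ℕ × List ℕ => (a.2.2[i]?).getD a.2.1 :=
        Primrec.option_getD.comp (Primrec.list_getElem?.comp (Primrec.snd.comp Primrec.snd)
          (Primrec.const i)) (Primrec.fst.comp Primrec.snd)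
      exact this.of_eq fun a => by simp [listEnv]
    have hq (i : ℕ) : Primrec fun a : View Label × ℕ × List ℕ =>
        List.range (a.1.2.1.getD (listEnv a.2.1 a.2.2 i) []).length :=
      Primrec.list_range.comp (Primrec.list_length.comp ((Primrec.list_getD []).comp
        (Primrec.fst.comp (Primrec.snd.comp Primrec.fst)) (hvar i)))
    intro φ
    induction φ with
    | adj i j => exact primrecPred_viewAdj Primrec.fst (hvar i) (hvar j)
    | eq i j => exact Primrec.eq.comp (hvar i) (hvar j)
    | label i j R hR =>
      exact hR.comp (primrec_viewLabel Primrec.fst (hvar i)) (primrec_viewLabel Primrec.fst (hvar j))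
    | not φ ih => exact ih.not
    | and φ ψ h1 h2 => exact h1.and h2
    | or φ ψ h1 h2 => exact h1.or h2
    | imp φ ψ h1 h2 => exact PrimrecPred.imp h1 h2
    | exNbr i φ ih =>
      have h1 : PrimrecRel fun (a : View Label × ℕ × List ℕ) (j : ℕ) =>
          viewAdj a.1 (listEnv a.2.1 a.2.2 i) j ∧
            φ.Holds (viewAdj a.1) (viewLabel a.1) (listEnv a.2.1 (j :: a.2.2)) :=
        (primrecPred_viewAdj (Primrec.fst.comp Primrec.fst) ((hvar i).comp Primrec.fst)
          Primrec.snd).and (ih.comp (f := fun p : (View Label × ℕ × List ℕ) × ℕ =>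
            (p.1.1, p.1.2.1, p.2 :: p.1.2.2))
          ((Primrec.fst.comp Primrec.fst).pair ((Primrec.fst.comp (Primrec.snd.comp Primrec.fst)).pair
            (Primrec.list_cons.comp Primrec.snd (Primrec.snd.comp (Primrec.snd.comp Primrec.fst))))))
      refine (PrimrecPred.exists_mem (hq i) h1).of_eq fun a => ?_
      simp only [Holds, envCons_listEnv, List.mem_range]
      exact ⟨fun ⟨j, _, h⟩ => ⟨j, h⟩, fun ⟨j, h⟩ => ⟨j, viewAdj_lt h.1, h⟩⟩
    | allNbr i φ ih =>
      have h1 : PrimrecRel fun (a : View Label × ℕ × List ℕ) (j : ℕ) =>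
          viewAdj a.1 (listEnv a.2.1 a.2.2 i) j →
            φ.Holds (viewAdj a.1) (viewLabel a.1) (listEnv a.2.1 (j :: a.2.2)) :=
        PrimrecPred.imp (primrecPred_viewAdj (Primrec.fst.comp Primrec.fst)
          ((hvar i).comp Primrec.fst) Primrec.snd)
          (ih.comp (f := fun p : (View Label × ℕ × List ℕ) × ℕ => (p.1.1, p.1.2.1, p.2 :: p.1.2.2))
          ((Primrec.fst.comp Primrec.fst).pair ((Primrec.fst.comp (Primrec.snd.comp Primrec.fst)).pair
            (Primrec.list_cons.comp Primrec.snd (Primrec.snd.comp (Primrec.snd.comp Primrec.fst))))))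
      refine (PrimrecPred.forall_mem (hq i) h1).of_eq fun a => ?_
      simp only [Holds, envCons_listEnv, List.mem_range]
      exact ⟨fun h j hj => h j (viewAdj_lt hj) hj, fun h j _ hj => h j hj⟩
  exact (key φ).comp (f := fun a => (w a, d a, e a)) (hw.pair (hd.pair he))

/-! ### Evaluation in a view and evaluation in the graph -/

section Transfer

variable {V : Type} {G : SimpleGraph V} {x : V → Label} {ident : V → ℕ} {ω : V × ℕ → Bool}
  {m t : ℕ} {l : List V} {v : V}

theorem viewAdj_view {i j : ℕ} {a b : V} (hi : l[i]? = some a) (hj : l[j]? = some b) :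
    viewAdj (view G x ident ω m l v) i j ↔ G.Adj a b := by
  simp [viewAdj, view, List.getD_eq_getElem?_getD, List.getElem?_map, hi, hj]

theorem viewAdj_view_lt {i j : ℕ} (h : viewAdj (view G x ident ω m l v) i j) :
    j < l.length := by
  by_contra hj
  have h2 : l[j]? = none := by simpa using hj
  rcases hi : l[i]? with _ | a
  · simp [viewAdj, view, List.getD_eq_getElem?_getD, List.getElem?_map, hi] at h
  · simp [viewAdj, view, List.getD_eq_getElem?_getD, List.getElem?_map, hi, h2] at h

theorem viewLabel_view {i : ℕ} {a : V} (hi : l[i]? = some a) :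
    viewLabel (view G x ident ω m l v) i = x a := by
  simp [viewLabel, view, List.getD_eq_getElem?_getD, List.getElem?_map, hi]

theorem self_mem_ball : v ∈ ball G v t := ⟨.nil, by simp⟩

theorem ball_mono {s : ℕ} (h : s ≤ t) : ball G v s ⊆ ball G v t :=
  fun _ ⟨p, hp⟩ => ⟨p, hp.trans h⟩

theorem adj_mem_ball {s : ℕ} {a b : V} (ha : a ∈ ball G v s) (hab : G.Adj a b) :
    b ∈ ball G v (s + 1) := by
  obtain ⟨p, hp⟩ := ha
  exact ⟨p.concat hab, by simpa using hp⟩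

theorem Enumerates.getElem?_inj {S : Set V} (hl : Enumerates l S) {i j : ℕ} {a : V}
    (hi : l[i]? = some a) (hj : l[j]? = some a) : i = j := by
  obtain ⟨h1, _⟩ := List.getElem?_eq_some_iff.mp hi
  exact (List.getElem?_inj h1 hl.1).mp (hi.trans hj.symm)

/-- Evaluating a formula in an encoded view gives the same result as evaluating it in the graph. -/
theorem LocalFormula.holds_view_iff (hl : Enumerates l (ball G v t)) (φ : LocalFormula) {s : ℕ}
    (hs : s + φ.depth ≤ t) {e : ℕ → ℕ} {env : ℕ → V} (he : ∀ i, l[e i]? = some (env i))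
    (hb : ∀ i, env i ∈ ball G v s) :
    φ.Holds (viewAdj (view G x ident ω m l v)) (viewLabel (view G x ident ω m l v)) e ↔
      φ.Holds G.Adj x env := by
  -- Each quantifier costs one unit of radius: a neighbour of a node at distance at most `s` lies
  -- within `s + 1 ≤ t` and is therefore listed in the view.
  have step : ∀ {s : ℕ} {i : ℕ} {e : ℕ → ℕ} {env : ℕ → V}, (∀ i, l[e i]? = some (env i)) →
      (∀ i, env i ∈ ball G v s) → s + 1 ≤ t → ∀ w, G.Adj (env i) w →
      ∃ j, (∀ i, l[envCons j e i]? = some (envCons w env i)) ∧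
        ∀ i, envCons w env i ∈ ball G v (s + 1) := by
    intro s i e env he hb hs w hw
    have hw' := adj_mem_ball (hb i) hw
    obtain ⟨j, hj⟩ := List.mem_iff_getElem?.mp ((hl.2 w).mpr (ball_mono hs hw'))
    refine ⟨j, fun k => ?_, fun k => ?_⟩
    · cases k
      · exact hj
      · exact he _
    · cases k
      · exact hw'
      · exact ball_mono (Nat.le_succ s) (hb _)
  induction φ generalizing s e env with
  | adj i j => exact viewAdj_view (he i) (he j)
  | eq i j =>
    refine ⟨fun h => ?_, fun h => ?_⟩
    · have h' : e i = e j := h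
      have := he i
      rw [h', he j] at this
      exact (Option.some.inj this).symm
    · have h' : env i = env j := h
      exact hl.getElem?_inj (he i) (h' ▸ he j)
  | label i j R hR => simp only [Holds, viewLabel_view (he i), viewLabel_view (he j)]
  | not φ ih => exact not_congr (ih hs he hb)
  | and φ ψ h1 h2 =>
    simp only [depth] at hs
    exact and_congr (h1 (by omega) he hb) (h2 (by omega) he hb)
  | or φ ψ h1 h2 =>
    simp only [depth] at hs
    exact or_congr (h1 (by omega) he hb) (h2 (by omega) he hb)
  | imp φ ψ h1 h2 =>
    simp only [depth] at hs
    exact imp_congr (h1 (by omega) he hb) (h2 (by omega) he hb)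
  | exNbr i φ ih =>
    simp only [depth] at hs
    constructor
    · rintro ⟨j, hj, h⟩
      obtain ⟨b, hb'⟩ : ∃ b, l[j]? = some b := ⟨_, List.getElem?_eq_getElem (viewAdj_view_lt hj)⟩
      have hadj := (viewAdj_view (he i) hb').mp hj
      obtain ⟨j', h1, h2⟩ := step he hb (by omega) b hadj
      obtain rfl : j' = j := hl.getElem?_inj (h1 0) hb'
      exact ⟨b, hadj, (ih (by omega) h1 h2).mp h⟩
    · rintro ⟨b, hadj, h⟩
      obtain ⟨j, h1, h2⟩ := step he hb (by omega) b hadj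
      exact ⟨j, (viewAdj_view (he i) (h1 0)).mpr hadj, (ih (by omega) h1 h2).mpr h⟩
  | allNbr i φ ih =>
    simp only [depth] at hs
    constructor
    · intro h b hadj
      obtain ⟨j, h1, h2⟩ := step he hb (by omega) b hadj
      exact (ih (by omega) h1 h2).mp (h j ((viewAdj_view (he i) (h1 0)).mpr hadj))
    · intro h j hj
      obtain ⟨b, hb'⟩ : ∃ b, l[j]? = some b := ⟨_, List.getElem?_eq_getElem (viewAdj_view_lt hj)⟩
      have hadj := (viewAdj_view (he i) hb').mp hj
      obtain ⟨j', h1, h2⟩ := step he hb (by omega) b hadj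
      obtain rfl : j' = j := hl.getElem?_inj (h1 0) hb'
      exact (ih (by omega) h1 h2).mpr (h b hadj)

end Transfer

end LocalDecision

namespace LocalDecision

open MeasureTheory

/-! ## The local rules -/

/-! ### Conditions on labels -/

/-- The state in which the head has arrived at a cell by the movement `m`, if so. -/
def arrival (m : Move) (c : Content) : Option ℕ :=
  c.2.bind fun h => if h.2 = m then some h.1 else none

/-- The state in which the head leaves a cell by the movement `m`, if so. -/
def emission (M : Machine) (m : Move) (c : Content) : Option ℕ :=
  (action M c).bind fun a => if a.2.2 = m then some a.1 else none

theorem arrival_eq_some {m : Move} {c : Content} {q : ℕ} :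
    arrival m c = some q ↔ c.2 = some (q, m) := by
  rcases c with ⟨a, _ | ⟨q', m'⟩⟩ <;> simp [arrival]
  constructor
  · rintro ⟨rfl, rfl⟩; exact ⟨rfl, rfl⟩
  · rintro ⟨rfl, rfl⟩; exact ⟨rfl, rfl⟩

theorem emission_eq_some {M : Machine} {m : Move} {c : Content} {q : ℕ} :
    emission M m c = some q ↔ Emits M c m q := by
  unfold emission Emits
  rcases action M c with _ | ⟨q', b', m'⟩ <;> simp
  constructor
  · rintro ⟨rfl, rfl⟩; exact ⟨rfl, rfl⟩
  · rintro ⟨rfl, rfl⟩; exact ⟨rfl, rfl⟩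

theorem arrival_eq_none {m : Move} {c : Content} :
    arrival m c = none ↔ ∀ q, c.2 ≠ some (q, m) := by
  rw [Option.eq_none_iff_forall_ne_some]
  simp only [ne_eq, arrival_eq_some]

theorem emission_eq_none {M : Machine} {m : Move} {c : Content} :
    emission M m c = none ↔ ∀ q, ¬ Emits M c m q := by
  rw [Option.eq_none_iff_forall_ne_some]
  simp only [ne_eq, emission_eq_some]

/-- A cell holds at most one head, so the family of equivalences over all states and moves collapses
to three equations between optional states, which are easy to decide and to chain. -/
theorem follows_iff {M : Machine} {L C R C' : Content} :
    Follows M L C R C' ↔ ¬ IsHalted M C ∧ C'.1 = written M C ∧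
      arrival .right C' = emission M .right L ∧ arrival .stay C' = emission M .stay C ∧
      arrival .left C' = emission M .left R := by
  unfold Follows
  refine and_congr_right fun _ => and_congr_right fun _ => ?_
  constructor
  · intro h
    refine ⟨Option.ext fun q => ?_, Option.ext fun q => ?_, Option.ext fun q => ?_⟩ <;>
      simp [arrival_eq_some, emission_eq_some, h]
  · rintro ⟨h1, h2, h3⟩ q m
    rw [← arrival_eq_some]
    cases m <;> simp [h1, h2, h3, emission_eq_some]

/-- Two contents are equal if the symbols and all arrivals are. -/
theorem content_ext {C C' : Content} (h : C.1 = C'.1)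
    (ha : ∀ m, arrival m C = arrival m C') : C = C' := by
  refine Prod.ext h (Option.ext fun ⟨q, m⟩ => ?_)
  rw [← arrival_eq_some, ← arrival_eq_some, ha]

/-- The cell label of a node, with a default value for the nodes that do not have one. -/
def cellOf (l : Label) : Cell := l.2.getD default

def coords (l : Label) : Fin 3 × Fin 3 := (cellOf l).1

def content (l : Label) : Content := (cellOf l).2

namespace LabelRel

def Same (l l' : Label) : Prop := l.1 = l'.1
-- Conditions on one label are also written as binary relations, the shape that `LocalFormula.label`
-- takes.
def Up (l _l' : Label) : Prop := l.2 = none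
def SameCoords (l l' : Label) : Prop := coords l = coords l'
def EastOf (l l' : Label) : Prop := coords l' = ((coords l).1 + 1, (coords l).2)
def SouthOf (l l' : Label) : Prop := coords l' = ((coords l).1, (coords l).2 + 1)
def Neighbours (l l' : Label) : Prop :=
  EastOf l l' ∨ EastOf l' l ∨ SouthOf l l' ∨ SouthOf l' l
def Corner (l _l' : Label) : Prop := cellOf l = ((0, 0), (0, some (0, .stay)))
def BlankTop (l _l' : Label) : Prop := (coords l).2 = 0 ∧ content l = (0, none)
def Below (l l' : Label) : Prop :=
  ¬ IsHalted l.1.1 (content l) ∧ (content l').1 = written l.1.1 (content l) ∧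
    arrival .stay (content l') = emission l.1.1 .stay (content l)
def FromLeft (l l' : Label) : Prop :=
  arrival .right (content l') = emission l.1.1 .right (content l)
def FromRight (l l' : Label) : Prop :=
  arrival .left (content l') = emission l.1.1 .left (content l)
def NaturalLeft (l _l' : Label) : Prop :=
  arrival .right (content l) = none ∧ emission l.1.1 .left (content l) = none
def NaturalRight (l _l' : Label) : Prop :=
  arrival .left (content l) = none ∧ emission l.1.1 .right (content l) = none
def NaturalBottom (l _l' : Label) : Prop :=
  (content l).2 ≠ none → IsHalted l.1.1 (content l)

end LabelRel

/-! ### Primitive recursiveness of the conditions on labels -/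

section Computability

variable {α : Type} [Primcodable α]

theorem primrec_transition {M : α → Machine} {q a : α → ℕ} (hM : Primrec M) (hq : Primrec q)
    (ha : Primrec a) : Primrec fun i => transition (M i) (q i) (a i) :=
  (Primrec.listLookup.comp (hq.pair ha) hM).of_eq fun i => by
    -- The two lookups compare keys by different instances of boolean equality; lawful ones
    -- coincide.
    rw [transition, lawful_beq_subsingleton instBEqOfDecidableEq (instBEqProd : BEq (ℕ × ℕ))]

theorem primrec_action {M : α → Machine} {c : α → Content} (hM : Primrec M) (hc : Primrec c) :
    Primrec fun i => action (M i) (c i) :=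
  Primrec.option_bind (Primrec.snd.comp hc)
    (primrec_transition (hM.comp Primrec.fst) (Primrec.fst.comp Primrec.snd)
      (Primrec.fst.comp (hc.comp Primrec.fst)))

theorem primrec_arrival (m : Move) {c : α → Content} (hc : Primrec c) :
    Primrec fun i => arrival m (c i) :=
  Primrec.option_bind (Primrec.snd.comp hc)
    (Primrec.ite (Primrec.eq.comp (Primrec.snd.comp Primrec.snd) (Primrec.const m))
      (Primrec.option_some.comp (Primrec.fst.comp Primrec.snd)) (Primrec.const none))

theorem primrec_emission (m : Move) {M : α → Machine} {c : α → Content} (hM : Primrec M)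
    (hc : Primrec c) : Primrec fun i => emission (M i) m (c i) :=
  Primrec.option_bind (primrec_action hM hc)
    (Primrec.ite (Primrec.eq.comp (Primrec.snd.comp (Primrec.snd.comp Primrec.snd)) (Primrec.const m))
      (Primrec.option_some.comp (Primrec.fst.comp Primrec.snd)) (Primrec.const none))

theorem primrec_written {M : α → Machine} {c : α → Content} (hM : Primrec M) (hc : Primrec c) :
    Primrec fun i => written (M i) (c i) := by
  have : Primrec fun i => ((action (M i) (c i)).map fun a => a.2.1).getD (c i).1 :=
    Primrec.option_getD.comp (Primrec.option_map (primrec_action hM hc)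
      (Primrec.fst.comp (Primrec.snd.comp Primrec.snd))) (Primrec.fst.comp hc)
  refine this.of_eq fun i => ?_
  unfold written
  rcases action (M i) (c i) with _ | ⟨q, b, m⟩ <;> rfl

theorem primrecPred_isHalted {M : α → Machine} {c : α → Content} (hM : Primrec M)
    (hc : Primrec c) : PrimrecPred fun i => IsHalted (M i) (c i) :=
  (Primrec.eq.comp (Primrec.option_isSome.comp (Primrec.snd.comp hc)) (Primrec.const true)).and
    (Primrec.eq.comp (primrec_action hM hc) (Primrec.const none))

theorem primrec_cellOf : Primrec cellOf :=
  Primrec.option_getD.comp Primrec.snd (Primrec.const default)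

theorem primrec_coords : Primrec coords := Primrec.fst.comp primrec_cellOf

theorem primrec_content : Primrec content := Primrec.snd.comp primrec_cellOf

theorem primrec_machine : Primrec fun l : Label => l.1.1 := Primrec.fst.comp Primrec.fst

namespace LabelRel

theorem primrec_same : PrimrecRel Same :=
  Primrec.eq.comp (Primrec.fst.comp Primrec.fst) (Primrec.fst.comp Primrec.snd)

theorem primrec_up : PrimrecRel Up :=
  Primrec.eq.comp (Primrec.snd.comp Primrec.fst) (Primrec.const none)

theorem primrec_sameCoords : PrimrecRel SameCoords :=
  Primrec.eq.comp (primrec_coords.comp Primrec.fst) (primrec_coords.comp Primrec.snd)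

theorem primrec_eastOf : PrimrecRel EastOf :=
  Primrec.eq.comp (primrec_coords.comp Primrec.snd)
    ((Primrec.dom_finite fun p : Fin 3 × Fin 3 => (p.1 + 1, p.2)).comp
      (primrec_coords.comp Primrec.fst))

theorem primrec_southOf : PrimrecRel SouthOf :=
  Primrec.eq.comp (primrec_coords.comp Primrec.snd)
    ((Primrec.dom_finite fun p : Fin 3 × Fin 3 => (p.1, p.2 + 1)).comp
      (primrec_coords.comp Primrec.fst))

theorem primrec_neighbours : PrimrecRel Neighbours :=
  primrec_eastOf.or ((primrec_eastOf.comp Primrec.snd Primrec.fst).or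
    (primrec_southOf.or (primrec_southOf.comp Primrec.snd Primrec.fst)))

theorem primrec_corner : PrimrecRel Corner :=
  Primrec.eq.comp (primrec_cellOf.comp Primrec.fst) (Primrec.const _)

theorem primrec_blankTop : PrimrecRel BlankTop :=
  (Primrec.eq.comp (Primrec.snd.comp (primrec_coords.comp Primrec.fst)) (Primrec.const _)).and
    (Primrec.eq.comp (primrec_content.comp Primrec.fst) (Primrec.const _))

theorem primrec_below : PrimrecRel Below :=
  (primrecPred_isHalted (primrec_machine.comp Primrec.fst)
    (primrec_content.comp Primrec.fst)).not.and
    ((Primrec.eq.comp (Primrec.fst.comp (primrec_content.comp Primrec.snd))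
      (primrec_written (primrec_machine.comp Primrec.fst) (primrec_content.comp Primrec.fst))).and
    (Primrec.eq.comp (primrec_arrival _ (primrec_content.comp Primrec.snd))
      (primrec_emission _ (primrec_machine.comp Primrec.fst) (primrec_content.comp Primrec.fst))))

theorem primrec_fromLeft : PrimrecRel FromLeft :=
  Primrec.eq.comp (primrec_arrival _ (primrec_content.comp Primrec.snd))
    (primrec_emission _ (primrec_machine.comp Primrec.fst) (primrec_content.comp Primrec.fst))

theorem primrec_fromRight : PrimrecRel FromRight :=
  Primrec.eq.comp (primrec_arrival _ (primrec_content.comp Primrec.snd))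
    (primrec_emission _ (primrec_machine.comp Primrec.fst) (primrec_content.comp Primrec.fst))

theorem primrec_naturalLeft : PrimrecRel NaturalLeft :=
  (Primrec.eq.comp (primrec_arrival _ (primrec_content.comp Primrec.fst)) (Primrec.const _)).and
    (Primrec.eq.comp (primrec_emission _ (primrec_machine.comp Primrec.fst)
      (primrec_content.comp Primrec.fst)) (Primrec.const _))

theorem primrec_naturalRight : PrimrecRel NaturalRight :=
  (Primrec.eq.comp (primrec_arrival _ (primrec_content.comp Primrec.fst)) (Primrec.const _)).and
    (Primrec.eq.comp (primrec_emission _ (primrec_machine.comp Primrec.fst)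
      (primrec_content.comp Primrec.fst)) (Primrec.const _))

theorem primrec_naturalBottom : PrimrecRel NaturalBottom :=
  PrimrecPred.imp
    (Primrec.eq.comp (Primrec.snd.comp (primrec_content.comp Primrec.fst)) (Primrec.const _)).not
    (primrecPred_isHalted (primrec_machine.comp Primrec.fst) (primrec_content.comp Primrec.fst))

end LabelRel

end Computability

/-! ### Local predicates -/

section Predicates

variable {W : Type} (A : W → W → Prop) (L : W → Label)

/-- `u` looks like the parent of `c`: it has no cell label, and `c` lies on a 4-cycle of
neighbours of `u`. -/
def IsParent (c u : W) : Prop :=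
  A u c ∧ LabelRel.Up (L u) (L u) ∧ ∃ a, A u a ∧ ∃ b, A u b ∧ ∃ d, A u d ∧
    (A c a ∧ A a b ∧ A b d ∧ A d c ∧ ¬ c = b ∧ ¬ a = d)

/-- `u` and `w` look like neighbours in the same layer of a pyramid. -/
def Lateral (u w : W) : Prop :=
  A u w ∧ ¬ IsParent A L u w ∧ ¬ IsParent A L w u ∧ ∃ p, A u p ∧ ∃ q, A w q ∧
    (IsParent A L u p ∧ IsParent A L w q ∧ (p = q ∨ A p q))

/-- An edge that does not belong to a pyramid. -/
def Foreign (u w : W) : Prop :=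
  A u w ∧ ¬ IsParent A L u w ∧ ¬ IsParent A L w u ∧ ¬ Lateral A L u w

/-- Exactly one foreign edge is incident to `v`. -/
def Attached (v : W) : Prop :=
  ∃ p, A v p ∧ (Foreign A L v p ∧ ∀ p', A v p' → Foreign A L v p' → p' = p)

def East (v w : W) : Prop := Lateral A L v w ∧ LabelRel.EastOf (L v) (L w)

def South (v w : W) : Prop := Lateral A L v w ∧ LabelRel.SouthOf (L v) (L w)

def NoEast (v : W) : Prop := ∀ w, A v w → ¬ East A L v w

def NoWest (v : W) : Prop := ∀ w, A v w → ¬ East A L w v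

def NoSouth (v : W) : Prop := ∀ w, A v w → ¬ South A L v w

def NoNorth (v : W) : Prop := ∀ w, A v w → ¬ South A L w v

end Predicates

namespace LocalFormula

section Macros

def up (u : ℕ) : LocalFormula := label u u LabelRel.Up LabelRel.primrec_up

/-- Indices shift by one under each quantifier: inside, `c` has become `c + 3`, and the other three
corners of the 4-cycle are the variables 2, 1, 0, in the order in which they were introduced. -/
def parent (c u : ℕ) : LocalFormula :=
  (adj u c).and ((up u).and (exNbr u (exNbr (u + 1) (exNbr (u + 2)
    ((adj (c + 3) 2).and ((adj 2 1).and ((adj 1 0).and ((adj 0 (c + 3)).and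
      ((eq (c + 3) 1).not.and (eq 2 0).not)))))))))

def lateral (u w : ℕ) : LocalFormula :=
  (adj u w).and ((parent u w).not.and ((parent w u).not.and (exNbr u (exNbr (w + 1)
    ((parent (u + 2) 1).and ((parent (w + 2) 0).and ((eq 1 0).or (adj 1 0))))))))

def foreign (u w : ℕ) : LocalFormula :=
  (adj u w).and ((parent u w).not.and ((parent w u).not.and (lateral u w).not))

def attached (v : ℕ) : LocalFormula :=
  exNbr v ((foreign (v + 1) 0).and (allNbr (v + 1) ((foreign (v + 2) 0).imp (eq 0 1))))

def east (v w : ℕ) : LocalFormula :=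
  (lateral v w).and (label v w LabelRel.EastOf LabelRel.primrec_eastOf)

def south (v w : ℕ) : LocalFormula :=
  (lateral v w).and (label v w LabelRel.SouthOf LabelRel.primrec_southOf)

def noEast (v : ℕ) : LocalFormula := allNbr v (east (v + 1) 0).not

def noWest (v : ℕ) : LocalFormula := allNbr v (east 0 (v + 1)).not

def noSouth (v : ℕ) : LocalFormula := allNbr v (south (v + 1) 0).not

def noNorth (v : ℕ) : LocalFormula := allNbr v (south 0 (v + 1)).not

end Macros

end LocalFormula

/-! ### The rules -/

/-- All rules that are expressed by local formulas hold everywhere in the labelled graph. -/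
structure LocallyConsistent {W : Type} (A : W → W → Prop) (L : W → Label) : Prop where
  same_param : ∀ v u, A v u → LabelRel.Same (L v) (L u)
  children : ∀ v, LabelRel.Up (L v) (L v) → ∃ a, A v a ∧ ∃ b, A v b ∧ ∃ c, A v c ∧ ∃ d, A v d ∧
    (IsParent A L a v ∧ IsParent A L b v ∧ IsParent A L c v ∧ IsParent A L d v ∧
      Lateral A L a b ∧ Lateral A L b c ∧ Lateral A L c d ∧ Lateral A L d a ∧
      ¬ a = c ∧ ¬ b = d ∧ ∀ e, A v e → IsParent A L e v → e = a ∨ e = b ∨ e = c ∨ e = d)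
  parent_unique : ∀ v p, A v p → ∀ q, A v q → IsParent A L v p → IsParent A L v q → p = q
  lateral_up : ∀ v u, A v u → Lateral A L v u →
    (LabelRel.Up (L v) (L v) → LabelRel.Up (L u) (L u))
  lateral_parents : ∀ v u, A v u → ∀ p, A v p → ∀ q, A u q → Lateral A L v u →
    IsParent A L v p → IsParent A L u q → p = q ∨ Lateral A L p q
  -- Two crossing edges are required because a single one would be compatible with squares that are
  -- shifted against each other.
  lateral_children : ∀ v u, A v u → Lateral A L v u → LabelRel.Up (L v) (L v) →
    ∃ a, A v a ∧ ∃ b, A u b ∧ ∃ a', A v a' ∧ ∃ b', A u b' ∧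
      (IsParent A L a v ∧ IsParent A L b u ∧ IsParent A L a' v ∧ IsParent A L b' u ∧
        Lateral A L a b ∧ Lateral A L a' b' ∧ Lateral A L a a' ∧ Lateral A L b b')
  foreign_base : ∀ v u, A v u → Foreign A L v u → ¬ LabelRel.Up (L v) (L v)
  lateral_coords : ∀ v u, A v u → Lateral A L v u → ¬ LabelRel.Up (L v) (L v) →
    LabelRel.Neighbours (L v) (L u) ∧ ∀ w, A v w → Lateral A L v w →
      LabelRel.SameCoords (L u) (L w) → u = w
  -- Exactly one end of a foreign edge is attached; by `pivot_corner` the other end is the top left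
  -- corner of its table.
  foreign_attached : ∀ v u, A v u → Foreign A L v u →
    ((Attached A L v → ¬ Attached A L u) ∧ (¬ Attached A L u → Attached A L v))
  top : ∀ v, ¬ LabelRel.Up (L v) (L v) → ¬ Attached A L v → NoNorth A L v →
    (NoWest A L v → LabelRel.Corner (L v) (L v)) ∧
    (¬ NoWest A L v → LabelRel.BlankTop (L v) (L v))
  pivot_corner : ∀ v u, A v u → ¬ Attached A L v → Foreign A L v u →
    NoNorth A L v ∧ NoWest A L v
  below : ∀ v u, A v u → South A L v u → LabelRel.Below (L v) (L u) ∧ ∀ w, A v w →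
    (East A L w v → LabelRel.FromLeft (L w) (L u)) ∧
    (East A L v w → LabelRel.FromRight (L w) (L u))
  natural : ∀ v, ¬ LabelRel.Up (L v) (L v) → ¬ Attached A L v →
    (NoWest A L v → LabelRel.NaturalLeft (L v) (L v)) ∧
    (NoEast A L v → LabelRel.NaturalRight (L v) (L v)) ∧
    (NoSouth A L v → LabelRel.NaturalBottom (L v) (L v))

namespace LocalFormula

def ruleSameParam : LocalFormula := allNbr 0 (label 1 0 _ LabelRel.primrec_same)

def ruleChildren : LocalFormula :=
  (up 0).imp (exNbr 0 (exNbr 1 (exNbr 2 (exNbr 3 ((parent 3 4).and ((parent 2 4).and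
    ((parent 1 4).and ((parent 0 4).and ((lateral 3 2).and ((lateral 2 1).and ((lateral 1 0).and
    ((lateral 0 3).and ((eq 3 1).not.and ((eq 2 0).not.and (allNbr 4 ((parent 0 5).imp
    ((eq 0 4).or ((eq 0 3).or ((eq 0 2).or (eq 0 1))))))))))))))))))))

def ruleParentUnique : LocalFormula :=
  allNbr 0 (allNbr 1 ((parent 2 1).imp ((parent 2 0).imp (eq 1 0))))

def ruleLateralUp : LocalFormula := allNbr 0 ((lateral 1 0).imp ((up 1).imp (up 0)))

def ruleLateralParents : LocalFormula :=
  allNbr 0 (allNbr 1 (allNbr 1 ((lateral 3 2).imp ((parent 3 1).imp ((parent 2 0).imp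
    ((eq 1 0).or (lateral 1 0)))))))

def ruleLateralChildren : LocalFormula :=
  allNbr 0 ((lateral 1 0).imp ((up 1).imp (exNbr 1 (exNbr 1 (exNbr 3 (exNbr 3
    ((parent 3 5).and ((parent 2 4).and ((parent 1 5).and ((parent 0 4).and ((lateral 3 2).and
    ((lateral 1 0).and ((lateral 3 1).and (lateral 2 0))))))))))))))

def ruleForeignBase : LocalFormula := allNbr 0 ((foreign 1 0).imp (up 1).not)

def ruleLateralCoords : LocalFormula :=
  allNbr 0 ((lateral 1 0).imp ((up 1).not.imp ((label 1 0 _ LabelRel.primrec_neighbours).and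
    (allNbr 1 ((lateral 2 0).imp ((label 1 0 _ LabelRel.primrec_sameCoords).imp (eq 1 0)))))))

def ruleForeignAttached : LocalFormula :=
  allNbr 0 ((foreign 1 0).imp (((attached 1).imp (attached 0).not).and
    ((attached 0).not.imp (attached 1))))

def ruleTop : LocalFormula :=
  (up 0).not.imp ((attached 0).not.imp ((noNorth 0).imp
    (((noWest 0).imp (label 0 0 _ LabelRel.primrec_corner)).and
    ((noWest 0).not.imp (label 0 0 _ LabelRel.primrec_blankTop)))))

def rulePivotCorner : LocalFormula :=
  allNbr 0 ((attached 1).not.imp ((foreign 1 0).imp ((noNorth 1).and (noWest 1))))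

def ruleBelow : LocalFormula :=
  allNbr 0 ((south 1 0).imp ((label 1 0 _ LabelRel.primrec_below).and (allNbr 1
    (((east 0 2).imp (label 0 1 _ LabelRel.primrec_fromLeft)).and
    ((east 2 0).imp (label 0 1 _ LabelRel.primrec_fromRight))))))

def ruleNatural : LocalFormula :=
  (up 0).not.imp ((attached 0).not.imp
    (((noWest 0).imp (label 0 0 _ LabelRel.primrec_naturalLeft)).and
    (((noEast 0).imp (label 0 0 _ LabelRel.primrec_naturalRight)).and
    ((noSouth 0).imp (label 0 0 _ LabelRel.primrec_naturalBottom)))))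

/-- The conjunction of all local rules. -/
def rules : LocalFormula :=
  ruleSameParam.and (ruleChildren.and (ruleParentUnique.and (ruleLateralUp.and
    (ruleLateralParents.and (ruleLateralChildren.and (ruleForeignBase.and (ruleLateralCoords.and
    (ruleForeignAttached.and (ruleTop.and (rulePivotCorner.and (ruleBelow.and
    ruleNatural)))))))))))

/-- The formulas are arranged so that `Holds` unfolds definitionally to the fields, in the same
order. -/
theorem forall_holds_rules {W : Type} (A : W → W → Prop) (L : W → Label) :
    (∀ v, rules.Holds A L fun _ => v) ↔ LocallyConsistent A L := by
  constructor
  · intro h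
    exact {
      same_param := fun v => (h v).1
      children := fun v => (h v).2.1
      parent_unique := fun v => (h v).2.2.1
      lateral_up := fun v => (h v).2.2.2.1
      lateral_parents := fun v => (h v).2.2.2.2.1
      lateral_children := fun v => (h v).2.2.2.2.2.1
      foreign_base := fun v => (h v).2.2.2.2.2.2.1
      lateral_coords := fun v => (h v).2.2.2.2.2.2.2.1
      foreign_attached := fun v => (h v).2.2.2.2.2.2.2.2.1
      top := fun v => (h v).2.2.2.2.2.2.2.2.2.1
      pivot_corner := fun v => (h v).2.2.2.2.2.2.2.2.2.2.1
      below := fun v => (h v).2.2.2.2.2.2.2.2.2.2.2.1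
      natural := fun v => (h v).2.2.2.2.2.2.2.2.2.2.2.2 }
  · intro h v
    exact ⟨h.same_param v, h.children v, h.parent_unique v, h.lateral_up v, h.lateral_parents v,
      h.lateral_children v, h.foreign_base v, h.lateral_coords v, h.foreign_attached v, h.top v,
      h.pivot_corner v, h.below v, h.natural v⟩

end LocalFormula

end LocalDecision

namespace LocalDecision

open MeasureTheory

/-! ## Codes of table fragments -/

section Lists

variable {α β : Type}

/-- All lists of length `k` with entries from `l`. -/
def listsOfLength (l : List α) (k : ℕ) : List (List α) :=
  k.rec [[]] fun _ acc => acc.flatMap fun t => l.map fun a => a :: t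

theorem mem_listsOfLength {l : List α} {k : ℕ} {t : List α} :
    t ∈ listsOfLength l k ↔ t.length = k ∧ ∀ a ∈ t, a ∈ l := by
  induction k generalizing t with
  | zero => simp +contextual [listsOfLength]
  | succ k ih =>
    change t ∈ (listsOfLength l k).flatMap (fun t => l.map fun a => a :: t) ↔ _
    simp only [List.mem_flatMap, List.mem_map, ih]
    constructor
    · rintro ⟨s, ⟨h1, h2⟩, a, ha, rfl⟩
      simp_all
    · rcases t with _ | ⟨a, t⟩
      · simp
      · intro h
        refine ⟨t, ?_, a, ?_, rfl⟩ <;> simp_all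

variable [Primcodable α] [Primcodable β]

theorem primrec_listsOfLength {f : α → List β} {k : α → ℕ} (hf : Primrec f) (hk : Primrec k) :
    Primrec fun a => listsOfLength (f a) (k a) :=
  Primrec.nat_rec' hk (Primrec.const [[]])
    (Primrec.list_flatMap (Primrec.snd.comp Primrec.snd)
      (Primrec.list_map (hf.comp (Primrec.fst.comp Primrec.fst))
        (Primrec.list_cons.comp Primrec.snd (Primrec.snd.comp Primrec.fst)).to₂).to₂).to₂

theorem primrec_sublists' {f : α → List β} (hf : Primrec f) :
    Primrec fun a => (f a).sublists' := by
  have : Primrec fun a => (f a).foldr (fun b acc => acc ++ acc.map (List.cons b)) [[]] :=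
    Primrec.list_foldr hf (Primrec.const [[]])
      (Primrec.list_append.comp (Primrec.snd.comp Primrec.snd)
        (Primrec.list_map (Primrec.snd.comp Primrec.snd)
          (Primrec.list_cons.comp (Primrec.fst.comp (Primrec.snd.comp Primrec.fst))
            Primrec.snd).to₂)).to₂
  refine this.of_eq fun a => ?_
  induction f a with
  | nil => rfl
  | cons b l ih => rw [List.foldr_cons, ih, List.sublists'_cons]

theorem primrec_product {γ : Type} [Primcodable γ] {f : α → List β} {g : α → List γ}
    (hf : Primrec f) (hg : Primrec g) : Primrec fun a => (f a).product (g a) :=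
  Primrec.list_flatMap hf (Primrec.list_map (hg.comp Primrec.fst)
    (Primrec.pair (Primrec.snd.comp Primrec.fst) Primrec.snd))

end Lists

theorem primrec_two_pow {α : Type} [Primcodable α] {k : α → ℕ} (hk : Primrec k) :
    Primrec fun a => 2 ^ k a := by
  have : Primrec fun a => (k a).rec (motive := fun _ => ℕ) 1 fun _ y => y * 2 :=
    Primrec.nat_rec' hk (Primrec.const 1)
      (Primrec.nat_mul.comp (Primrec.snd.comp Primrec.snd) (Primrec.const 2)).to₂
  refine this.of_eq fun a => ?_
  induction k a with
  | zero => rfl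
  | succ n ih => rw [pow_succ, ← ih]

theorem primrec_fin_ofNat {α : Type} [Primcodable α] {k : α → ℕ} (hk : Primrec k) :
    Primrec fun a => Fin.ofNat 3 (k a) :=
  Primrec.fin_val_iff.mp (Primrec.nat_mod.comp hk (Primrec.const 3))

/-! ### Windows and borders -/

theorem lookup_mem {M : Machine} {k : ℕ × ℕ} {a : ℕ × ℕ × Move} (h : M.lookup k = some a) :
    (k, a) ∈ M := by
  induction M with
  | nil => simp at h
  | cons i M ih =>
    obtain ⟨k', a'⟩ := i
    rw [List.lookup_cons] at h
    by_cases hk : k = k'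
    · subst hk
      simp at h
      simp [h]
    · have : (k == k') = false := by simpa using hk
      rw [this] at h
      exact List.mem_cons_of_mem _ (ih h)

/-- Contents range over an infinite set, but an emission depends only on the instruction that fires,
so the keys of the instructions suffice. A shadowed instruction does no harm: its key is looked up
again and yields the instruction that counts. -/
theorem exists_emission_iff {M : Machine} {m : Move} {o : Option ℕ} :
    (∃ L, o = emission M m L) ↔
      o = none ∨ ∃ i ∈ M, o = emission M m (i.1.2, some (i.1.1, .stay)) := by
  constructor
  · rintro ⟨L, rfl⟩
    rcases h : action M L with _ | a
    · left; simp [emission, h]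
    · right
      rcases L with ⟨s, _ | ⟨q, m'⟩⟩
      · simp [action] at h
      · refine ⟨((q, s), a), lookup_mem h, ?_⟩
        simp only [emission, action, Option.bind_some]
  · rintro (rfl | ⟨i, _, rfl⟩)
    · exact ⟨(0, none), by simp [emission, action]⟩
    · exact ⟨_, rfl⟩

/-- The unknown `L` only influences arrivals from the left at `C`, and `R` only arrivals from the
right at `D`; so the two existential quantifiers separate. -/
theorem windowConsistent_iff {M : Machine} {A B C D : Content} :
    WindowConsistent M A B C D ↔ (¬ IsHalted M A ∧ ¬ IsHalted M B ∧ C.1 = written M A ∧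
      D.1 = written M B) ∧ (arrival .stay C = emission M .stay A ∧
      arrival .left C = emission M .left B ∧ arrival .right D = emission M .right A ∧
      arrival .stay D = emission M .stay B) ∧ (∃ L, arrival .right C = emission M .right L) ∧
      ∃ R, arrival .left D = emission M .left R := by
  unfold WindowConsistent
  simp only [follows_iff]
  constructor
  · rintro ⟨L, R, h1, h2⟩
    exact ⟨⟨h1.1, h2.1, h1.2.1, h2.2.1⟩, ⟨h1.2.2.2.1, h1.2.2.2.2, h2.2.2.1, h2.2.2.2.1⟩,
      ⟨L, h1.2.2.1⟩, R, h2.2.2.2.2⟩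
  · rintro ⟨h1, h2, ⟨L, hL⟩, R, hR⟩
    exact ⟨L, R, ⟨h1.1, h1.2.2.1, hL, h2.1, h2.2.1⟩, h1.2.1, h1.2.2.2, h2.2.2.1, h2.2.2.2, hR⟩

/-- An equation between sets of borders is tested on the four borders. The ambiguous case is the one
with natural sides and a non-natural bottom. -/
theorem borderChoice_iff {M : Machine} {n : ℕ} {F : Labelling n} {S : Set Border} :
    F.BorderChoice M S ↔ .top ∈ S ∧
      ((F.Natural M .left ∧ F.Natural M .right ∧ ¬ F.Natural M .bottom ∧ .bottom ∈ S ∧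
          (.left ∈ S ↔ ¬ .right ∈ S)) ∨
        (¬ (F.Natural M .left ∧ F.Natural M .right ∧ ¬ F.Natural M .bottom) ∧
          (.left ∈ S ↔ ¬ F.Natural M .left) ∧ (.right ∈ S ↔ ¬ F.Natural M .right) ∧
          (.bottom ∈ S ↔ ¬ F.Natural M .bottom))) := by
  have hall (p : Border → Prop) : (∀ b, p b) ↔ p .top ∧ p .left ∧ p .right ∧ p .bottom :=
    ⟨fun h => ⟨h _, h _, h _, h _⟩, fun h b => by cases b <;> tauto⟩
  have htop : ¬ F.Natural M .top := id
  unfold Labelling.BorderChoice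
  simp only [ne_eq, Set.ext_iff, hall, Set.mem_ofPred_eq, Set.mem_insert_iff,
    Set.mem_singleton_iff, reduceCtorEq, htop, or_false, or_true, not_false_eq_true, true_and,
    iff_true, iff_false, not_not]
  grind

/-! ### Codes -/

/-- A fragment as a list of rows; the flags tell whether the left, the right and the bottom border
are interpreted as non-natural. -/
abbrev FragmentCode : Type := List (List Cell) × (Bool × Bool × Bool)

/-- A fragment and a position (column, row). -/
abbrev BorderCode : Type := FragmentCode × (ℕ × ℕ)

namespace FragmentCode

def cell (f : FragmentCode) (x y : ℕ) : Cell := (f.1.getD y []).getD x default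

def labelling (f : FragmentCode) (n : ℕ) : Labelling n := fun x y => f.cell x y

/-- The top needs no flag, because it is never natural and thus belongs to every choice. -/
def borders (f : FragmentCode) : Set Border
  | .top => True
  | .left => f.2.1 = true
  | .right => f.2.2.1 = true
  | .bottom => f.2.2.2 = true

/-- The code describes a fragment of side `n`. -/
structure Valid (M : Machine) (n : ℕ) (f : FragmentCode) : Prop where
  length_eq : f.1.length = n
  row_length : ∀ row ∈ f.1, row.length = n
  consistent : (f.labelling n).Consistent M
  borderChoice : (f.labelling n).BorderChoice M f.borders

open Classical in
/-- The code of a fragment. -/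
noncomputable def ofFragment {M : Machine} {r : ℕ} (F : Fragment M r) : FragmentCode :=
  (List.ofFn fun y => List.ofFn fun x => F.labelling x y,
    decide (.left ∈ F.nonNatural), decide (.right ∈ F.nonNatural),
    decide (.bottom ∈ F.nonNatural))

section

variable {M : Machine} {r : ℕ}

theorem cell_ofFragment (F : Fragment M r) (x y : Fin (2 ^ (3 * r))) :
    (ofFragment F).cell x y = F.labelling x y := by
  simp [cell, ofFragment, List.getD_eq_getElem?_getD]

theorem labelling_ofFragment (F : Fragment M r) :
    (ofFragment F).labelling (2 ^ (3 * r)) = F.labelling := by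
  funext x y
  exact cell_ofFragment F x y

theorem top_mem_nonNatural (F : Fragment M r) : .top ∈ F.nonNatural :=
  (borderChoice_iff.mp F.borderChoice).1

theorem borders_ofFragment (F : Fragment M r) : (ofFragment F).borders = F.nonNatural := by
  ext b
  cases b
  · exact iff_of_true trivial (top_mem_nonNatural F)
  all_goals exact @decide_eq_true_iff _ (Classical.propDecidable _)

theorem valid_ofFragment (F : Fragment M r) : (ofFragment F).Valid M (2 ^ (3 * r)) where
  length_eq := by simp [ofFragment]
  row_length := by
    intro row h
    simp only [ofFragment, List.mem_ofFn] at h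
    obtain ⟨y, rfl⟩ := h
    simp
  consistent := by rw [labelling_ofFragment]; exact F.consistent
  borderChoice := by rw [labelling_ofFragment, borders_ofFragment]; exact F.borderChoice

theorem ofFragment_injective : Function.Injective (ofFragment (M := M) (r := r)) := by
  intro F F' h
  ext1
  · rw [← labelling_ofFragment, h, labelling_ofFragment]
  · rw [← borders_ofFragment, h, borders_ofFragment]

/-- The fragment described by a valid code. -/
def Valid.toFragment {f : FragmentCode} (h : f.Valid M (2 ^ (3 * r))) : Fragment M r :=
  ⟨_, h.consistent, _, h.borderChoice⟩

/-- With `valid_ofFragment` and `ofFragment_injective` this makes fragments and valid codes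
correspond one to one; the two copies of an ambiguous labelling differ in their flags. -/
theorem Valid.ofFragment_toFragment {f : FragmentCode} (h : f.Valid M (2 ^ (3 * r))) :
    ofFragment h.toFragment = f := by
  obtain ⟨rows, l, ri, b⟩ := f
  refine Prod.ext ?_ (Prod.ext ?_ (Prod.ext ?_ ?_))
  · have hlen := h.length_eq
    dsimp only at hlen
    refine List.ext_getElem (by simp [ofFragment, hlen]) fun y h1 h2 => ?_
    have hrow : rows[y].length = _ := h.row_length _ (List.getElem_mem h2)
    refine List.ext_getElem (by simp [ofFragment, hrow]) fun x h3 h4 => ?_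
    simp [ofFragment, Valid.toFragment, labelling, cell, List.getD_eq_getElem?_getD, h2, h4]
  all_goals exact Bool.eq_iff_iff.mpr (@decide_eq_true_iff _ (Classical.propDecidable _))

end

end FragmentCode

/-- The position lies on a border that is interpreted as non-natural. -/
def BorderCode.OnBorder (n : ℕ) (c : BorderCode) : Prop :=
  c.2.1 < n ∧ c.2.2 < n ∧ (c.2.2 = 0 ∨ (c.1.2.1 = true ∧ c.2.1 = 0) ∨
    (c.1.2.2.1 = true ∧ c.2.1 + 1 = n) ∨ (c.1.2.2.2 = true ∧ c.2.2 + 1 = n))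

/-- Neighbouring positions in the same fragment, from left to right or from top to bottom. -/
def BorderCode.Adj (c d : BorderCode) : Prop :=
  c.1 = d.1 ∧ ((d.2.1 = c.2.1 + 1 ∧ d.2.2 = c.2.2) ∨ (d.2.1 = c.2.1 ∧ d.2.2 = c.2.2 + 1))

/-! ### The list of all fragments -/

/-- All possible contents of the cells of a fragment. -/
def cellList (M : Machine) : List Cell :=
  ((List.finRange 3).product (List.finRange 3)).product ((symbols M).product
    (none :: ((states M).product [Move.left, Move.stay, Move.right]).map some))

theorem mem_cellList {M : Machine} {c : Cell} :
    c ∈ cellList M ↔ c.2.1 ∈ symbols M ∧ ∀ q m, c.2.2 = some (q, m) → q ∈ states M := by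
  obtain ⟨⟨a, b⟩, s, o⟩ := c
  unfold cellList
  simp only [List.pair_mem_product, List.mem_finRange, true_and, List.mem_cons, List.mem_map,
    Prod.exists, and_congr_right_iff, List.not_mem_nil, or_false]
  intro _
  constructor
  · rintro (rfl | ⟨q, m, ⟨h, _⟩, rfl⟩) q' m' h'
    · cases h'
    · cases h'; exact h
  · intro h
    rcases o with _ | ⟨q, m⟩
    · exact Or.inl rfl
    · exact Or.inr ⟨q, m, ⟨h q m rfl, by cases m <;> simp⟩, rfl⟩

/-- The conditions on a fragment code other than those on its size and its entries. -/
def FragmentCode.Ok (M : Machine) (n : ℕ) (f : FragmentCode) : Prop :=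
  (∃ a ∈ List.range 3, ∃ b ∈ List.range 3, ∀ x ∈ List.range n, ∀ y ∈ List.range n,
    (f.cell x y).1 = mod3 (a + x) (b + y)) ∧
  (∀ x ∈ List.range n, ∀ y ∈ List.range n, x + 1 < n → y + 1 < n →
    WindowConsistent M (f.cell x y).2 (f.cell (x + 1) y).2 (f.cell x (y + 1)).2
      (f.cell (x + 1) (y + 1)).2) ∧
  (f.labelling n).BorderChoice M f.borders

theorem mod3_mod (a b x y : ℕ) : mod3 (a % 3 + x) (b % 3 + y) = mod3 (a + x) (b + y) := by
  simp [mod3, Fin.ofNat]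

/-- Validity splits into membership in an explicit finite list and a condition with bounded
quantifiers, which makes the collection of fragments computable. -/
theorem FragmentCode.valid_iff {M : Machine} {n : ℕ} {f : FragmentCode} :
    f.Valid M n ↔ f.1 ∈ listsOfLength (listsOfLength (cellList M) n) n ∧ f.Ok M n := by
  simp only [mem_listsOfLength]
  have hcell {x y : ℕ} (h1 : f.1.length = n) (h2 : ∀ row ∈ f.1, row.length = n) (hx : x < n)
      (hy : y < n) : ∃ row ∈ f.1, f.cell x y ∈ row := by
    have hy' : y < f.1.length := by omega
    have hr := h2 _ (List.getElem_mem hy')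
    refine ⟨f.1[y], List.getElem_mem hy', ?_⟩
    have hx' : x < f.1[y].length := by omega
    have : f.cell x y = f.1[y][x] := by
      simp [cell, List.getD_eq_getElem?_getD, hy', hx']
    rw [this]
    exact List.getElem_mem hx'
  constructor
  · intro h
    refine ⟨⟨h.length_eq, fun row hrow => ⟨h.row_length row hrow, fun c hc => ?_⟩⟩, ?_, ?_,
      h.borderChoice⟩
    · obtain ⟨y, hy, rfl⟩ := List.mem_iff_getElem.mp hrow
      obtain ⟨x, hx, rfl⟩ := List.mem_iff_getElem.mp hc
      have hx' : x < n := by rw [← h.row_length _ hrow]; exact hx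
      have hy' : y < n := by rw [← h.length_eq]; exact hy
      have : f.labelling n ⟨x, hx'⟩ ⟨y, hy'⟩ = f.1[y][x] := by
        simp [labelling, cell, List.getD_eq_getElem?_getD, hy, hx]
      rw [mem_cellList, ← this]
      exact ⟨h.consistent.symbols_mem _ _, h.consistent.states_mem _ _⟩
    · obtain ⟨a, b, hab⟩ := h.consistent.orientation
      -- Only the residues of the offsets matter, so a search below 3 finds them.
      refine ⟨a % 3, by simp [Nat.mod_lt], b % 3, by simp [Nat.mod_lt], fun x hx y hy => ?_⟩
      rw [mod3_mod]
      exact hab ⟨x, List.mem_range.mp hx⟩ ⟨y, List.mem_range.mp hy⟩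
    · intro x hx y hy hx' hy'
      exact h.consistent.windows ⟨x, List.mem_range.mp hx⟩ ⟨y, List.mem_range.mp hy⟩ ⟨x + 1, hx'⟩
        ⟨y + 1, hy'⟩ rfl rfl
  · rintro ⟨⟨h1, h2⟩, ⟨a, _, b, _, hab⟩, h4, h5⟩
    have hc (x y : Fin n) : f.labelling n x y ∈ cellList M := by
      obtain ⟨row, hrow, hc⟩ := hcell h1 (fun row hr => (h2 row hr).1) x.2 y.2
      exact (h2 row hrow).2 _ hc
    exact ⟨h1, fun row hr => (h2 row hr).1,
      ⟨fun x y => (mem_cellList.mp (hc x y)).1, fun x y => (mem_cellList.mp (hc x y)).2,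
        ⟨a, b, fun x y => hab x (List.mem_range.mpr x.2) y (List.mem_range.mpr y.2)⟩,
        fun x y x' y' hx hy => by
          have := h4 x (List.mem_range.mpr x.2) y (List.mem_range.mpr y.2) (hx ▸ x'.2) (hy ▸ y'.2)
          simpa only [labelling, hx, hy] using this⟩, h5⟩

/-! ### Computability of the list of all border positions -/

section

variable {α : Type} [Primcodable α]

theorem primrec_cell {f : α → FragmentCode} {x y : α → ℕ} (hf : Primrec f) (hx : Primrec x)
    (hy : Primrec y) : Primrec fun a => (f a).cell (x a) (y a) :=
  (Primrec.list_getD default).comp ((Primrec.list_getD []).comp (Primrec.fst.comp hf) hy) hx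

theorem primrecPred_exists_emission {m : Move} {M : α → Machine} {o : α → Option ℕ}
    (hM : Primrec M) (ho : Primrec o) : PrimrecPred fun a => ∃ L, o a = emission (M a) m L := by
  simp only [exists_emission_iff]
  refine (Primrec.eq.comp ho (Primrec.const none)).or (PrimrecPred.exists_mem hM ?_)
  have hi : Primrec fun p : α × ((ℕ × ℕ) × ℕ × ℕ × Move) => p.2.1 :=
    Primrec.fst.comp Primrec.snd
  exact Primrec.eq.comp (ho.comp Primrec.fst) (primrec_emission m (hM.comp Primrec.fst)
    ((Primrec.snd.comp hi).pair (Primrec.option_some.comp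
      ((Primrec.fst.comp hi).pair (Primrec.const Move.stay)))))

theorem primrecPred_windowConsistent {M : α → Machine} {A B C D : α → Content} (hM : Primrec M)
    (hA : Primrec A) (hB : Primrec B) (hC : Primrec C) (hD : Primrec D) :
    PrimrecPred fun a => WindowConsistent (M a) (A a) (B a) (C a) (D a) := by
  simp only [windowConsistent_iff]
  refine ((primrecPred_isHalted hM hA).not.and ((primrecPred_isHalted hM hB).not.and
    ((Primrec.eq.comp (Primrec.fst.comp hC) (primrec_written hM hA)).and
    (Primrec.eq.comp (Primrec.fst.comp hD) (primrec_written hM hB))))).and (PrimrecPred.and ?_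
    ((primrecPred_exists_emission hM (primrec_arrival _ hC)).and
    (primrecPred_exists_emission hM (primrec_arrival _ hD))))
  exact (Primrec.eq.comp (primrec_arrival _ hC) (primrec_emission _ hM hA)).and
    ((Primrec.eq.comp (primrec_arrival _ hC) (primrec_emission _ hM hB)).and
    ((Primrec.eq.comp (primrec_arrival _ hD) (primrec_emission _ hM hA)).and
    (Primrec.eq.comp (primrec_arrival _ hD) (primrec_emission _ hM hB))))

theorem FragmentCode.natural_left_iff {M : Machine} {n : ℕ} {f : FragmentCode} :
    (f.labelling n).Natural M .left ↔ ∀ y ∈ List.range n,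
      arrival .right (f.cell 0 y).2 = none ∧ emission M .left (f.cell 0 y).2 = none := by
  simp only [Labelling.Natural, Border.Contains, arrival_eq_none, emission_eq_none, List.mem_range]
  constructor
  · intro h y hy
    exact h ⟨0, by omega⟩ ⟨y, hy⟩ rfl
  · intro h x y hx
    have := h y y.2
    simpa [labelling, hx] using this

/-- For `n = 0` both sides are vacuous, so the truncated `n - 1` is harmless. -/
theorem FragmentCode.natural_right_iff {M : Machine} {n : ℕ} {f : FragmentCode} :
    (f.labelling n).Natural M .right ↔ ∀ y ∈ List.range n,
      arrival .left (f.cell (n - 1) y).2 = none ∧ emission M .right (f.cell (n - 1) y).2 = none := by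
  simp only [Labelling.Natural, Border.Contains, arrival_eq_none, emission_eq_none, List.mem_range]
  constructor
  · intro h y hy
    exact h ⟨n - 1, by omega⟩ ⟨y, hy⟩ (Nat.sub_add_cancel (by omega))
  · intro h x y hx
    have hx' : (x : ℕ) = n - 1 := by omega
    have := h y y.2
    simpa [labelling, hx'] using this

theorem FragmentCode.natural_bottom_iff {M : Machine} {n : ℕ} {f : FragmentCode} :
    (f.labelling n).Natural M .bottom ↔ ∀ x ∈ List.range n,
      (f.cell x (n - 1)).2.2.isSome = true → IsHalted M (f.cell x (n - 1)).2 := by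
  simp only [Labelling.Natural, Border.Contains, List.mem_range]
  constructor
  · intro h x hx
    exact h ⟨x, hx⟩ ⟨n - 1, by omega⟩ (Nat.sub_add_cancel (by omega))
  · intro h x y hy
    have hy' : (y : ℕ) = n - 1 := by omega
    have := h x x.2
    simpa [labelling, hy'] using this

theorem primrecPred_ok {M : α → Machine} {n : α → ℕ} {f : α → FragmentCode} (hM : Primrec M)
    (hn : Primrec n) (hf : Primrec f) : PrimrecPred fun a => (f a).Ok (M a) (n a) := by
  unfold FragmentCode.Ok
  have hr := Primrec.list_range.comp hn
  refine PrimrecPred.and ?_ (PrimrecPred.and ?_ ?_)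
  · refine PrimrecPred.exists_mem (Primrec.const _) (PrimrecPred.exists_mem (Primrec.const _)
      (PrimrecPred.forall_mem (hr.comp (Primrec.fst.comp Primrec.fst))
      (PrimrecPred.forall_mem (hr.comp (Primrec.fst.comp (Primrec.fst.comp Primrec.fst))) ?_)))
    have ha : Primrec fun p : (((α × ℕ) × ℕ) × ℕ) × ℕ => p.1.1.1.1 :=
      Primrec.fst.comp (Primrec.fst.comp (Primrec.fst.comp Primrec.fst))
    have h1 : Primrec fun p : (((α × ℕ) × ℕ) × ℕ) × ℕ => p.1.1.1.2 :=
      Primrec.snd.comp (Primrec.fst.comp (Primrec.fst.comp Primrec.fst))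
    have h2 : Primrec fun p : (((α × ℕ) × ℕ) × ℕ) × ℕ => p.1.1.2 :=
      Primrec.snd.comp (Primrec.fst.comp Primrec.fst)
    have h3 : Primrec fun p : (((α × ℕ) × ℕ) × ℕ) × ℕ => p.1.2 := Primrec.snd.comp Primrec.fst
    have h4 : Primrec fun p : (((α × ℕ) × ℕ) × ℕ) × ℕ => p.2 := Primrec.snd
    exact Primrec.eq.comp (Primrec.fst.comp (primrec_cell (hf.comp ha) h3 h4))
      ((primrec_fin_ofNat (Primrec.nat_add.comp h1 h3)).pair
        (primrec_fin_ofNat (Primrec.nat_add.comp h2 h4)))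
  · refine PrimrecPred.forall_mem hr (PrimrecPred.forall_mem (hr.comp Primrec.fst) ?_)
    have ha : Primrec fun p : (α × ℕ) × ℕ => p.1.1 := Primrec.fst.comp Primrec.fst
    have h1 : Primrec fun p : (α × ℕ) × ℕ => p.1.2 := Primrec.snd.comp Primrec.fst
    have h2 : Primrec fun p : (α × ℕ) × ℕ => p.2 := Primrec.snd
    have h1' := Primrec.succ.comp h1
    have h2' := Primrec.succ.comp h2
    exact PrimrecPred.imp (Primrec.nat_lt.comp h1' (hn.comp ha))
      (PrimrecPred.imp (Primrec.nat_lt.comp h2' (hn.comp ha))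
        (primrecPred_windowConsistent (hM.comp ha)
          (Primrec.snd.comp (primrec_cell (hf.comp ha) h1 h2))
          (Primrec.snd.comp (primrec_cell (hf.comp ha) h1' h2))
          (Primrec.snd.comp (primrec_cell (hf.comp ha) h1 h2'))
          (Primrec.snd.comp (primrec_cell (hf.comp ha) h1' h2'))))
  · simp only [borderChoice_iff]
    have hc (x y : α × ℕ → ℕ) (hx : Primrec x) (hy : Primrec y) :
        Primrec fun p : α × ℕ => ((f p.1).cell (x p) (y p)).2 :=
      Primrec.snd.comp (primrec_cell (hf.comp Primrec.fst) hx hy)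
    have hM' : Primrec fun p : α × ℕ => M p.1 := hM.comp Primrec.fst
    have hn' : Primrec fun p : α × ℕ => n p.1 - 1 := Primrec.pred.comp (hn.comp Primrec.fst)
    have h1 : PrimrecPred fun a => ((f a).labelling (n a)).Natural (M a) .left := by
      simp only [FragmentCode.natural_left_iff]
      have := hc _ _ (Primrec.const 0) Primrec.snd
      exact PrimrecPred.forall_mem hr
        ((Primrec.eq.comp (primrec_arrival _ this) (Primrec.const none)).and
        (Primrec.eq.comp (primrec_emission _ hM' this) (Primrec.const none)))
    have h2 : PrimrecPred fun a => ((f a).labelling (n a)).Natural (M a) .right := by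
      simp only [FragmentCode.natural_right_iff]
      have := hc _ _ hn' Primrec.snd
      exact PrimrecPred.forall_mem hr
        ((Primrec.eq.comp (primrec_arrival _ this) (Primrec.const none)).and
        (Primrec.eq.comp (primrec_emission _ hM' this) (Primrec.const none)))
    have h3 : PrimrecPred fun a => ((f a).labelling (n a)).Natural (M a) .bottom := by
      simp only [FragmentCode.natural_bottom_iff]
      have := hc _ _ Primrec.snd hn'
      exact PrimrecPred.forall_mem hr (PrimrecPred.imp
        (Primrec.eq.comp (Primrec.option_isSome.comp (Primrec.snd.comp this)) (Primrec.const true))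
        (primrecPred_isHalted hM' this))
    have hb : ∀ {g : α → Bool}, Primrec g → PrimrecPred fun a => g a = true := fun hg =>
      Primrec.eq.comp hg (Primrec.const true)
    have l1 : PrimrecPred fun a => Border.left ∈ (f a).borders :=
      hb (Primrec.fst.comp (Primrec.snd.comp hf))
    have l2 : PrimrecPred fun a => Border.right ∈ (f a).borders :=
      hb (Primrec.fst.comp (Primrec.snd.comp (Primrec.snd.comp hf)))
    have l3 : PrimrecPred fun a => Border.bottom ∈ (f a).borders :=
      hb (Primrec.snd.comp (Primrec.snd.comp (Primrec.snd.comp hf)))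
    have l0 : PrimrecPred fun a => Border.top ∈ (f a).borders :=
      (hb (Primrec.const true)).of_eq fun a => iff_of_true rfl trivial
    exact l0.and ((h1.and (h2.and (h3.not.and (l3.and (PrimrecPred.iff l1 l2.not))))).or
      ((h1.and (h2.and h3.not)).not.and ((PrimrecPred.iff l1 h1.not).and
        ((PrimrecPred.iff l2 h2.not).and (PrimrecPred.iff l3 h3.not)))))

end

open Classical in
/-- All border positions of all fragments of side `2 ^ (3 r)`. -/
noncomputable def borderList (p : Machine × ℕ) : List BorderCode :=
  (((listsOfLength (listsOfLength (cellList p.1) (2 ^ (3 * p.2))) (2 ^ (3 * p.2))).product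
    ([true, false].product ([true, false].product [true, false]))).product
    ((List.range (2 ^ (3 * p.2))).product (List.range (2 ^ (3 * p.2))))).filter fun c =>
      FragmentCode.Ok p.1 (2 ^ (3 * p.2)) c.1 ∧ BorderCode.OnBorder (2 ^ (3 * p.2)) c

theorem mem_borderList {p : Machine × ℕ} {c : BorderCode} :
    c ∈ borderList p ↔ c.1.Valid p.1 (2 ^ (3 * p.2)) ∧ c.OnBorder (2 ^ (3 * p.2)) := by
  obtain ⟨⟨rows, l, ri, b⟩, x, y⟩ := c
  rw [borderList, FragmentCode.valid_iff]
  simp only [List.mem_filter, List.pair_mem_product, List.mem_range, decide_eq_true_eq]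
  have hb (b : Bool) : b ∈ [true, false] := by cases b <;> simp
  simp only [hb, and_true, BorderCode.OnBorder]
  tauto

theorem primrec_symbols : Primrec symbols :=
  Primrec.list_cons.comp (Primrec.const 0) (Primrec.list_flatMap Primrec.id
    (Primrec.list_cons.comp (Primrec.snd.comp (Primrec.fst.comp Primrec.snd))
      (Primrec.list_cons.comp (Primrec.fst.comp (Primrec.snd.comp (Primrec.snd.comp Primrec.snd)))
        (Primrec.const []))))

theorem primrec_states : Primrec states :=
  Primrec.list_cons.comp (Primrec.const 0) (Primrec.list_flatMap Primrec.id
    (Primrec.list_cons.comp (Primrec.fst.comp (Primrec.fst.comp Primrec.snd))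
      (Primrec.list_cons.comp (Primrec.fst.comp (Primrec.snd.comp Primrec.snd))
        (Primrec.const []))))

theorem primrec_cellList : Primrec cellList :=
  primrec_product (Primrec.const _) (primrec_product primrec_symbols (Primrec.list_cons.comp
    (Primrec.const none) (Primrec.list_map (primrec_product primrec_states (Primrec.const _))
      (Primrec.option_some.comp Primrec.snd))))

theorem primrecPred_onBorder {α : Type} [Primcodable α] {n : α → ℕ} {c : α → BorderCode}
    (hn : Primrec n) (hc : Primrec c) : PrimrecPred fun a => (c a).OnBorder (n a) := by
  have hx : Primrec fun a => (c a).2.1 := Primrec.fst.comp (Primrec.snd.comp hc)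
  have hy : Primrec fun a => (c a).2.2 := Primrec.snd.comp (Primrec.snd.comp hc)
  have hs : Primrec fun a => (c a).1.2 := Primrec.snd.comp (Primrec.fst.comp hc)
  have hb : ∀ {g : α → Bool}, Primrec g → PrimrecPred fun a => g a = true := fun hg =>
    Primrec.eq.comp hg (Primrec.const true)
  exact (Primrec.nat_lt.comp hx hn).and ((Primrec.nat_lt.comp hy hn).and
    ((Primrec.eq.comp hy (Primrec.const 0)).or
    (((hb (Primrec.fst.comp hs)).and (Primrec.eq.comp hx (Primrec.const 0))).or
    (((hb (Primrec.fst.comp (Primrec.snd.comp hs))).and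
      (Primrec.eq.comp (Primrec.succ.comp hx) hn)).or
    ((hb (Primrec.snd.comp (Primrec.snd.comp hs))).and
      (Primrec.eq.comp (Primrec.succ.comp hy) hn))))))

theorem primrec_borderList : Primrec borderList := by
  have hn : Primrec fun p : Machine × ℕ => 2 ^ (3 * p.2) :=
    primrec_two_pow (Primrec.nat_mul.comp (Primrec.const 3) Primrec.snd)
  have hr := Primrec.list_range.comp hn
  have hl : Primrec fun p : Machine × ℕ =>
      ((listsOfLength (listsOfLength (cellList p.1) (2 ^ (3 * p.2))) (2 ^ (3 * p.2))).product
      ([true, false].product ([true, false].product [true, false]))).product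
      ((List.range (2 ^ (3 * p.2))).product (List.range (2 ^ (3 * p.2)))) :=
    primrec_product (primrec_product (primrec_listsOfLength (primrec_listsOfLength
      (primrec_cellList.comp Primrec.fst) hn) hn) (Primrec.const _)) (primrec_product hr hr)
  have hp : PrimrecPred fun q : (Machine × ℕ) × BorderCode =>
      FragmentCode.Ok q.1.1 (2 ^ (3 * q.1.2)) q.2.1 ∧ BorderCode.OnBorder (2 ^ (3 * q.1.2)) q.2 :=
    (primrecPred_ok (Primrec.fst.comp Primrec.fst) (hn.comp Primrec.fst)
      (Primrec.fst.comp Primrec.snd)).and (primrecPred_onBorder (hn.comp Primrec.fst) Primrec.snd)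
  classical
  have hf : Primrec fun p : Machine × ℕ => (((listsOfLength (listsOfLength (cellList p.1)
      (2 ^ (3 * p.2))) (2 ^ (3 * p.2))).product
      ([true, false].product ([true, false].product [true, false]))).product
      ((List.range (2 ^ (3 * p.2))).product (List.range (2 ^ (3 * p.2))))).filterMap fun c =>
        if FragmentCode.Ok p.1 (2 ^ (3 * p.2)) c.1 ∧ BorderCode.OnBorder (2 ^ (3 * p.2)) c
        then some c else none :=
    Primrec.listFilterMap hl (Primrec.ite hp (Primrec.option_some.comp Primrec.snd)
      (Primrec.const none))
  refine hf.of_eq fun p => ?_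
  rw [borderList, ← List.filterMap_eq_filter]
  refine List.filterMap_congr fun c _ => ?_
  simp only [Option.guard, decide_eq_true_eq]

end LocalDecision

namespace LocalDecision

open MeasureTheory

/-! ## The check of the fragment collection at the pivot -/

/-- `v` should be the pivot: the top left node of a table that is not attached to another one. -/
def IsPivot {W : Type} (A : W → W → Prop) (L : W → Label) (v : W) : Prop :=
  ¬ LabelRel.Up (L v) (L v) ∧ ¬ Attached A L v ∧ NoNorth A L v ∧ NoWest A L v

def LocalFormula.pivot : LocalFormula :=
  (LocalFormula.up 0).not.and ((LocalFormula.attached 0).not.and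
    ((LocalFormula.noNorth 0).and (LocalFormula.noWest 0)))

/-- The node `w` has the cell label and lies on the borders prescribed by the position `c`. -/
structure MatchesNode {W : Type} (A : W → W → Prop) (L : W → Label) (n : ℕ) (w : W)
    (c : BorderCode) : Prop where
  label : (L w).2 = some (c.1.cell c.2.1 c.2.2)
  west : NoWest A L w ↔ c.2.1 = 0
  east : NoEast A L w ↔ c.2.1 + 1 = n
  north : NoNorth A L w ↔ c.2.2 = 0
  south : NoSouth A L w ↔ c.2.2 + 1 = n

/-- `ρ` is a one-to-one correspondence between the nodes that are attached to `v` and the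
non-natural border positions of all fragments. -/
structure IsMatching {W : Type} (A : W → W → Prop) (L : W → Label) (v : W)
    (ρ : W → BorderCode → Prop) : Prop where
  total : ∀ c ∈ borderList (L v).1, ∃ w, ρ w c
  mem : ∀ w c, ρ w c → c ∈ borderList (L v).1
  bij : ∀ w c w' c', ρ w c → ρ w' c' → (w = w' ↔ c = c')
  cover : ∀ w, Foreign A L v w → ∃ c, ρ w c
  foreign : ∀ w c, ρ w c → Foreign A L v w
  node : ∀ w c, ρ w c → MatchesNode A L (2 ^ (3 * (L v).1.2)) w c
  adj : ∀ w c w' c', ρ w c → ρ w' c' → c.Adj c' → A w w'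

/-! ### Computability -/

/-- The number of nodes in an encoded view. -/
def viewSize (w : View Label) : ℕ := w.2.2.length

/-- `IsMatching` for a relation that is given by a list. -/
def IsMatchingList (w : View Label) (i : ℕ) (g : List (ℕ × BorderCode)) : Prop :=
  (∀ c ∈ borderList (viewLabel w i).1, ∃ p ∈ g, p.2 = c) ∧
  (∀ p ∈ g, p.2 ∈ borderList (viewLabel w i).1) ∧
  (∀ p ∈ g, ∀ p' ∈ g, p.1 = p'.1 ↔ p.2 = p'.2) ∧
  (∀ j ∈ List.range (viewSize w), Foreign (viewAdj w) (viewLabel w) i j → ∃ p ∈ g, p.1 = j) ∧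
  (∀ p ∈ g, Foreign (viewAdj w) (viewLabel w) i p.1) ∧
  (∀ p ∈ g, MatchesNode (viewAdj w) (viewLabel w) (2 ^ (3 * (viewLabel w i).1.2)) p.1 p.2) ∧
  (∀ p ∈ g, ∀ p' ∈ g, p.2.Adj p'.2 → viewAdj w p.1 p'.1)

/-- All possible pairs of a node and a border position. -/
noncomputable def matchingCandidates (w : View Label) (i : ℕ) : List (ℕ × BorderCode) :=
  (List.range (viewSize w)).product (borderList (viewLabel w i).1)

/-- The matrix in the view has as many columns as there are nodes. -/
def ViewBounded (w : View Label) : Prop := ∀ i j, viewAdj w i j → j < viewSize w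

/-- A matching is a finite set of pairs drawn from the candidates: foreign neighbours have indices
below `viewSize` by `ViewBounded`. The search over all relations thus becomes a search over
sublists. -/
theorem exists_isMatching_iff {w : View Label} (hw : ViewBounded w) {i : ℕ} :
    (∃ ρ, IsMatching (viewAdj w) (viewLabel w) i ρ) ↔
      ∃ g ∈ (matchingCandidates w i).sublists', IsMatchingList w i g := by
  constructor
  · rintro ⟨ρ, h⟩
    classical
    have hg (p : ℕ × BorderCode) :
        p ∈ (matchingCandidates w i).filter (fun p => ρ p.1 p.2) ↔ ρ p.1 p.2 := by
      simp only [List.mem_filter, decide_eq_true_eq, and_iff_right_iff_imp]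
      intro hp
      exact List.pair_mem_product.mpr ⟨List.mem_range.mpr (hw _ _ (h.foreign _ _ hp).1),
        h.mem _ _ hp⟩
    refine ⟨(matchingCandidates w i).filter fun p => ρ p.1 p.2,
      List.mem_sublists'.mpr List.filter_sublist, ?_⟩
    simp only [IsMatchingList, hg]
    exact ⟨fun c hc => (h.total c hc).imp' (fun w => (w, c)) fun w hw => ⟨hw, rfl⟩,
      fun p hp => h.mem _ _ hp, fun p hp p' hp' => h.bij _ _ _ _ hp hp',
      fun j _ hj => (h.cover j hj).imp' (fun c => (j, c)) fun c hc => ⟨hc, rfl⟩,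
      fun p hp => h.foreign _ _ hp, fun p hp => h.node _ _ hp,
      fun p hp p' hp' => h.adj _ _ _ _ hp hp'⟩
  · rintro ⟨g, _, h1, h2, h3, h4, h5, h6, h7⟩
    refine ⟨fun j c => (j, c) ∈ g, ?_, fun j c h => h2 _ h, fun j c j' c' h h' => h3 _ h _ h', ?_,
      fun j c h => h5 _ h, fun j c h => h6 _ h, fun j c j' c' h h' => h7 _ h _ h'⟩
    · intro c hc
      obtain ⟨⟨j, c⟩, hp, rfl⟩ := h1 c hc
      exact ⟨j, hp⟩
    · intro j hj
      obtain ⟨⟨j, c⟩, hp, rfl⟩ := h4 j (List.mem_range.mpr (hw _ _ hj.1)) hj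
      exact ⟨c, hp⟩

section

variable {α : Type} [Primcodable α] {w : α → View Label} {i : α → ℕ}

theorem primrec_viewSize (hw : Primrec w) : Primrec fun a => viewSize (w a) :=
  Primrec.list_length.comp (Primrec.snd.comp (Primrec.snd.comp hw))

theorem primrecPred_foreign {j : α → ℕ} (hw : Primrec w) (hi : Primrec i) (hj : Primrec j) :
    PrimrecPred fun a => Foreign (viewAdj (w a)) (viewLabel (w a)) (i a) (j a) :=
  (LocalFormula.foreign 0 1).primrecPred_holds hw (Primrec.const 0) (Primrec.list_cons.comp hi
    (Primrec.list_cons.comp hj (Primrec.const [])))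

theorem primrecPred_matchesNode {n : α → ℕ} {c : α → BorderCode} (hw : Primrec w)
    (hi : Primrec i) (hn : Primrec n) (hc : Primrec c) :
    PrimrecPred fun a => MatchesNode (viewAdj (w a)) (viewLabel (w a)) (n a) (i a) (c a) := by
  have hx : Primrec fun a => (c a).2.1 := Primrec.fst.comp (Primrec.snd.comp hc)
  have hy : Primrec fun a => (c a).2.2 := Primrec.snd.comp (Primrec.snd.comp hc)
  have hφ (φ : LocalFormula) := φ.primrecPred_holds hw (Primrec.const 0)
    (Primrec.list_cons.comp hi (Primrec.const []))
  have h1 : PrimrecPred fun a => (viewLabel (w a) (i a)).2 =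
      some ((c a).1.cell (c a).2.1 (c a).2.2) :=
    Primrec.eq.comp (Primrec.snd.comp (primrec_viewLabel hw hi))
      (Primrec.option_some.comp (primrec_cell (Primrec.fst.comp hc) hx hy))
  have h2 := PrimrecPred.iff (hφ (LocalFormula.noWest 0)) (Primrec.eq.comp hx (Primrec.const 0))
  have h3 := PrimrecPred.iff (hφ (LocalFormula.noEast 0)) (Primrec.eq.comp (Primrec.succ.comp hx) hn)
  have h4 := PrimrecPred.iff (hφ (LocalFormula.noNorth 0)) (Primrec.eq.comp hy (Primrec.const 0))
  have h5 := PrimrecPred.iff (hφ (LocalFormula.noSouth 0)) (Primrec.eq.comp (Primrec.succ.comp hy) hn)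
  exact (h1.and (h2.and (h3.and (h4.and h5)))).of_eq fun a =>
    ⟨fun h => ⟨h.1, h.2.1, h.2.2.1, h.2.2.2.1, h.2.2.2.2⟩,
      fun h => ⟨h.label, h.west, h.east, h.north, h.south⟩⟩

theorem primrecPred_borderCode_adj {c d : α → BorderCode} (hc : Primrec c) (hd : Primrec d) :
    PrimrecPred fun a => (c a).Adj (d a) := by
  have hx {c : α → BorderCode} (hc : Primrec c) : Primrec fun a => (c a).2.1 :=
    Primrec.fst.comp (Primrec.snd.comp hc)
  have hy {c : α → BorderCode} (hc : Primrec c) : Primrec fun a => (c a).2.2 :=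
    Primrec.snd.comp (Primrec.snd.comp hc)
  exact (Primrec.eq.comp (Primrec.fst.comp hc) (Primrec.fst.comp hd)).and
    (((Primrec.eq.comp (hx hd) (Primrec.succ.comp (hx hc))).and (Primrec.eq.comp (hy hd) (hy hc))).or
    ((Primrec.eq.comp (hx hd) (hx hc)).and (Primrec.eq.comp (hy hd) (Primrec.succ.comp (hy hc)))))

theorem primrecPred_isMatchingList {g : α → List (ℕ × BorderCode)} (hw : Primrec w)
    (hi : Primrec i) (hg : Primrec g) : PrimrecPred fun a => IsMatchingList (w a) (i a) (g a) := by
  have hp : Primrec fun a => (viewLabel (w a) (i a)).1 := Primrec.fst.comp (primrec_viewLabel hw hi)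
  have hl : Primrec fun a => borderList (viewLabel (w a) (i a)).1 := primrec_borderList.comp hp
  have e1 : Primrec fun p : α × (ℕ × BorderCode) => p.2.1 := Primrec.fst.comp Primrec.snd
  have e2 : Primrec fun p : α × (ℕ × BorderCode) => p.2.2 := Primrec.snd.comp Primrec.snd
  have f1 : Primrec fun p : (α × (ℕ × BorderCode)) × (ℕ × BorderCode) => p.1.2.1 :=
    e1.comp Primrec.fst
  have f2 : Primrec fun p : (α × (ℕ × BorderCode)) × (ℕ × BorderCode) => p.1.2.2 :=
    e2.comp Primrec.fst
  have f3 : Primrec fun p : (α × (ℕ × BorderCode)) × (ℕ × BorderCode) => p.2.1 :=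
    Primrec.fst.comp Primrec.snd
  have f4 : Primrec fun p : (α × (ℕ × BorderCode)) × (ℕ × BorderCode) => p.2.2 :=
    Primrec.snd.comp Primrec.snd
  refine PrimrecPred.and ?_ (PrimrecPred.and ?_ (PrimrecPred.and ?_ (PrimrecPred.and ?_
    (PrimrecPred.and ?_ (PrimrecPred.and ?_ ?_)))))
  · exact PrimrecPred.forall_mem hl (PrimrecPred.exists_mem (hg.comp Primrec.fst)
      (Primrec.eq.comp (Primrec.snd.comp Primrec.snd) (Primrec.snd.comp Primrec.fst)))
  · refine PrimrecPred.forall_mem hg ((PrimrecPred.exists_mem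
      (p := fun (q : α × (ℕ × BorderCode)) c => q.2.2 = c) (hl.comp Primrec.fst)
      (Primrec.eq.comp (Primrec.snd.comp (Primrec.snd.comp Primrec.fst)) Primrec.snd)).of_eq
      fun p => ?_)
    simp
  · exact PrimrecPred.forall_mem hg (PrimrecPred.forall_mem (hg.comp Primrec.fst)
      (PrimrecPred.iff (Primrec.eq.comp f1 f3) (Primrec.eq.comp f2 f4)))
  · exact PrimrecPred.forall_mem (Primrec.list_range.comp (primrec_viewSize hw))
      (PrimrecPred.imp (primrecPred_foreign (hw.comp Primrec.fst) (hi.comp Primrec.fst) Primrec.snd)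
      (PrimrecPred.exists_mem (hg.comp Primrec.fst)
      (Primrec.eq.comp (Primrec.fst.comp Primrec.snd) (Primrec.snd.comp Primrec.fst))))
  · exact PrimrecPred.forall_mem hg
      (primrecPred_foreign (hw.comp Primrec.fst) (hi.comp Primrec.fst) e1)
  · exact PrimrecPred.forall_mem hg (primrecPred_matchesNode (hw.comp Primrec.fst) e1
      (primrec_two_pow (Primrec.nat_mul.comp (Primrec.const 3)
        (Primrec.snd.comp (hp.comp Primrec.fst)))) e2)
  · exact PrimrecPred.forall_mem hg (PrimrecPred.forall_mem (hg.comp Primrec.fst)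
      (PrimrecPred.imp (primrecPred_borderCode_adj f2 f4)
      (primrecPred_viewAdj (hw.comp (Primrec.fst.comp Primrec.fst)) f1 f3)))

theorem primrecPred_exists_matchingList (hw : Primrec w) (hi : Primrec i) : PrimrecPred fun a =>
    ∃ g ∈ (matchingCandidates (w a) (i a)).sublists', IsMatchingList (w a) (i a) g :=
  PrimrecPred.exists_mem (primrec_sublists' (primrec_product
    (Primrec.list_range.comp (primrec_viewSize hw))
    (primrec_borderList.comp (Primrec.fst.comp (primrec_viewLabel hw hi)))))
    (primrecPred_isMatchingList (hw.comp Primrec.fst) (hi.comp Primrec.fst) Primrec.snd)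

end

/-! ### The complete structural check -/

/-- The structural conditions at the node `v`. -/
def StructureCheck {W : Type} (A : W → W → Prop) (L : W → Label) (v : W) : Prop :=
  LocalFormula.rules.Holds A L (fun _ => v) ∧ (IsPivot A L v → ∃ ρ, IsMatching A L v ρ)

/-- The structural conditions, as they are evaluated in an encoded view. -/
def ViewCheck (w : View Label) : Prop :=
  LocalFormula.rules.Holds (viewAdj w) (viewLabel w) (listEnv w.1 []) ∧
    (LocalFormula.pivot.Holds (viewAdj w) (viewLabel w) (listEnv w.1 []) →
      ∃ g ∈ (matchingCandidates w w.1).sublists', IsMatchingList w w.1 g)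

theorem primrecPred_viewCheck : PrimrecPred ViewCheck :=
  (LocalFormula.rules.primrecPred_holds Primrec.id Primrec.fst (Primrec.const [])).and
    (PrimrecPred.imp (LocalFormula.pivot.primrecPred_holds Primrec.id Primrec.fst (Primrec.const []))
      (primrecPred_exists_matchingList Primrec.id Primrec.fst))

/-- The radius up to which the nodes look. -/
def checkRadius : ℕ := 20

/-! ### The structural check in a view and in the graph -/

section Transfer

variable {V : Type} {G : SimpleGraph V} {x : V → Label} {ident : V → ℕ} {ω : V × ℕ → Bool}
  {m : ℕ} {l : List V} {v : V}

theorem viewBounded_view : ViewBounded (view G x ident ω m l v) := fun _ _ h => by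
  have := viewAdj_view_lt h
  simpa [viewSize, view] using this

theorem getElem?_view_fst (hl : Enumerates l (ball G v checkRadius)) :
    l[(view G x ident ω m l v).1]? = some v := by
  classical
  have hv : v ∈ l := (hl.2 v).mpr self_mem_ball
  have : (view G x ident ω m l v).1 = l.idxOf v := by
    simp only [view]
  rw [this]
  simp [hv]

/-- Positions in `l` and nodes of the ball correspond one to one, so a matching can be carried from
indices to nodes and back. -/
theorem viewCheck_iff (hl : Enumerates l (ball G v checkRadius)) :
    ViewCheck (view G x ident ω m l v) ↔ StructureCheck G.Adj x v := by
  set w := view G x ident ω m l v with hw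
  have hv : l[w.1]? = some v := getElem?_view_fst hl
  -- The depth of `rules` is 10, attained by `ruleLateralChildren`: five quantifiers around
  -- `lateral`, whose own depth is 5. The radius 20 leaves ample room.
  have hrules : LocalFormula.rules.Holds (viewAdj w) (viewLabel w) (listEnv w.1 []) ↔
      LocalFormula.rules.Holds G.Adj x fun _ => v :=
    LocalFormula.holds_view_iff hl _ (s := 0) (by decide) (fun _ => hv) fun _ => self_mem_ball
  have hpivot : LocalFormula.pivot.Holds (viewAdj w) (viewLabel w) (listEnv w.1 []) ↔
      IsPivot G.Adj x v :=
    LocalFormula.holds_view_iff hl _ (s := 0) (by decide) (fun _ => hv) fun _ => self_mem_ball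
  -- Matched nodes are neighbours of `v`, so formulas about them start at distance 1.
  have hφ (φ : LocalFormula) (hd : φ.depth ≤ 10) {j : ℕ} {b : V} (hj : l[j]? = some b)
      (hb : b ∈ ball G v 1) : φ.Holds (viewAdj w) (viewLabel w) (envCons j fun _ => w.1) ↔
      φ.Holds G.Adj x (envCons b fun _ => v) := by
    refine LocalFormula.holds_view_iff hl φ (s := 1) (by unfold checkRadius; omega)
      (fun i => ?_) (fun i => ?_)
    · cases i
      · exact hj
      · exact hv
    · cases i
      · exact hb
      · exact self_mem_ball
  have hnbr {b : V} (hb : G.Adj v b) : b ∈ ball G v 1 := adj_mem_ball (s := 0) self_mem_ball hb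
  have hidx {j : ℕ} (hj : viewAdj w w.1 j) : ∃ b, l[j]? = some b ∧ b ∈ ball G v 1 := by
    have hlt := viewAdj_view_lt hj
    exact ⟨l[j], List.getElem?_eq_getElem hlt,
      hnbr ((viewAdj_view hv (List.getElem?_eq_getElem hlt)).mp hj)⟩
  have hmem {b : V} (hb : b ∈ ball G v 1) : ∃ j, l[j]? = some b :=
    List.mem_iff_getElem?.mp ((hl.2 b).mpr (ball_mono (by decide) hb))
  have hforeign {j : ℕ} {b : V} (hj : l[j]? = some b) (hb : b ∈ ball G v 1) :
      Foreign (viewAdj w) (viewLabel w) w.1 j ↔ Foreign G.Adj x v b :=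
    hφ (LocalFormula.foreign 1 0) (by decide) hj hb
  have hnode {j : ℕ} {b : V} (n : ℕ) (c : BorderCode) (hj : l[j]? = some b)
      (hb : b ∈ ball G v 1) :
      MatchesNode (viewAdj w) (viewLabel w) n j c ↔ MatchesNode G.Adj x n b c := by
    have h1 : NoWest (viewAdj w) (viewLabel w) j ↔ NoWest G.Adj x b :=
      hφ (LocalFormula.noWest 0) (by decide) hj hb
    have h2 : NoEast (viewAdj w) (viewLabel w) j ↔ NoEast G.Adj x b :=
      hφ (LocalFormula.noEast 0) (by decide) hj hb
    have h3 : NoNorth (viewAdj w) (viewLabel w) j ↔ NoNorth G.Adj x b :=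
      hφ (LocalFormula.noNorth 0) (by decide) hj hb
    have h4 : NoSouth (viewAdj w) (viewLabel w) j ↔ NoSouth G.Adj x b :=
      hφ (LocalFormula.noSouth 0) (by decide) hj hb
    have h0 : viewLabel w j = x b := viewLabel_view hj
    constructor
    · rintro ⟨e0, e1, e2, e3, e4⟩
      exact ⟨h0 ▸ e0, h1.symm.trans e1, h2.symm.trans e2, h3.symm.trans e3, h4.symm.trans e4⟩
    · rintro ⟨e0, e1, e2, e3, e4⟩
      exact ⟨h0 ▸ e0, h1.trans e1, h2.trans e2, h3.trans e3, h4.trans e4⟩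
  have hlab : viewLabel w w.1 = x v := viewLabel_view hv
  refine and_congr hrules (imp_congr hpivot ?_)
  rw [← exists_isMatching_iff viewBounded_view]
  constructor
  · rintro ⟨ρ, h⟩
    have hfor {j : ℕ} {c : BorderCode} (hj : ρ j c) : ∃ b, l[j]? = some b ∧ b ∈ ball G v 1 :=
      hidx (h.foreign j c hj).1
    refine ⟨fun b c => ∃ j, l[j]? = some b ∧ ρ j c, ?_, ?_, ?_, ?_, ?_, ?_, ?_⟩
    · intro c hc
      obtain ⟨j, hj⟩ := h.total c (by rwa [hlab])
      obtain ⟨b, hb, _⟩ := hfor hj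
      exact ⟨b, j, hb, hj⟩
    · rintro b c ⟨j, _, hj⟩
      rw [← hlab]
      exact h.mem j c hj
    · rintro b c b' c' ⟨j, hb, hj⟩ ⟨j', hb', hj'⟩
      rw [← h.bij _ _ _ _ hj hj']
      constructor
      · rintro rfl
        exact hl.getElem?_inj hb hb'
      · rintro rfl
        exact Option.some.inj (hb.symm.trans hb')
    · intro b hb
      obtain ⟨j, hj⟩ := hmem (hnbr hb.1)
      obtain ⟨c, hc⟩ := h.cover j ((hforeign hj (hnbr hb.1)).mpr hb)
      exact ⟨c, j, hj, hc⟩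
    · rintro b c ⟨j, hj, hc⟩
      obtain ⟨b', hb', hball⟩ := hfor hc
      obtain rfl := Option.some.inj (hj.symm.trans hb')
      exact (hforeign hj hball).mp (h.foreign _ _ hc)
    · rintro b c ⟨j, hj, hc⟩
      obtain ⟨b', hb', hball⟩ := hfor hc
      obtain rfl := Option.some.inj (hj.symm.trans hb')
      rw [← hlab]
      exact (hnode _ _ hj hball).mp (h.node _ _ hc)
    · rintro b c b' c' ⟨j, hb, hj⟩ ⟨j', hb', hj'⟩ hc
      exact (viewAdj_view hb hb').mp (h.adj _ _ _ _ hj hj' hc)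
  · rintro ⟨ρ, h⟩
    have hfor {b : V} {c : BorderCode} (hj : ρ b c) : b ∈ ball G v 1 := hnbr (h.foreign b c hj).1
    refine ⟨fun j c => ∃ b, l[j]? = some b ∧ ρ b c, ?_, ?_, ?_, ?_, ?_, ?_, ?_⟩
    · intro c hc
      obtain ⟨b, hb⟩ := h.total c (by rwa [← hlab])
      obtain ⟨j, hj⟩ := hmem (hfor hb)
      exact ⟨j, b, hj, hb⟩
    · rintro j c ⟨b, _, hb⟩
      rw [hlab]
      exact h.mem b c hb
    · rintro j c j' c' ⟨b, hj, hb⟩ ⟨b', hj', hb'⟩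
      rw [← h.bij _ _ _ _ hb hb']
      constructor
      · rintro rfl
        exact Option.some.inj (hj.symm.trans hj')
      · rintro rfl
        exact hl.getElem?_inj hj hj'
    · intro j hj
      obtain ⟨b, hb, hball⟩ := hidx hj.1
      obtain ⟨c, hc⟩ := h.cover b ((hforeign hb hball).mp hj)
      exact ⟨c, b, hb, hc⟩
    · rintro j c ⟨b, hj, hb⟩
      exact (hforeign hj (hfor hb)).mpr (h.foreign _ _ hb)
    · rintro j c ⟨b, hj, hb⟩
      rw [hlab]
      exact (hnode _ _ hj (hfor hb)).mpr (h.node _ _ hb)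
    · rintro j c j' c' ⟨b, hj, hb⟩ ⟨b', hj', hb'⟩ hc
      exact (viewAdj_view hj hj').mpr (h.adj _ _ _ _ hb hb' hc)

end Transfer

end LocalDecision

namespace LocalDecision

open MeasureTheory

/-! ## Simulation of a machine -/

/-- A configuration with a finite description: the state, the position of the head, and the list of
all symbols written so far, the most recent one first. -/
abbrev SimConfig : Type := ℕ × ℕ × List (ℕ × ℕ)

namespace SimConfig

/-- The symbol in the cell number `i`. -/
def symbol (c : SimConfig) (i : ℕ) : ℕ := (c.2.2.lookup i).getD 0

/-- The position of the head after a movement, if it is possible. -/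
def move (m : Move) (p : ℕ) : Option ℕ :=
  if m = .left then (if p = 0 then none else some (p - 1)) else if m = .stay then some p
  else some (p + 1)

/-- One step. A halted configuration is left unchanged. -/
def step (M : Machine) (c : SimConfig) : Option SimConfig :=
  ((transition M c.1 (c.symbol c.2.1)).map fun a =>
    (move a.2.2 c.2.1).map fun p => (a.1, p, (c.2.1, a.2.1) :: c.2.2)).getD (some c)

/-- The configuration after `t` steps on the blank tape, unless the machine is stuck. -/
def after (M : Machine) : ℕ → Option SimConfig
  | 0 => some (0, 0, [])
  | t + 1 => (after M t).bind (step M)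

/-- The description agrees with the configuration `C`. -/
structure Describes (c : SimConfig) (C : Config) : Prop where
  state : c.1 = C.state
  pos : c.2.1 = C.pos
  tape : ∀ i, c.symbol i = C.tape i

end SimConfig

/-- Within `t` steps, the machine halts with an output other than `0`. -/
def RejectsWithin (M : Machine) (t : ℕ) : Prop :=
  ∃ c ∈ (SimConfig.after M t).toList, transition M c.1 (c.symbol c.2.1) = none ∧
    c.symbol c.2.1 ≠ 0

namespace SimConfig

theorem symbol_cons (q p p' b : ℕ) (l : List (ℕ × ℕ)) (i : ℕ) :
    symbol (q, p, (p', b) :: l) i = if i = p' then b else symbol (q, p, l) i := by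
  unfold symbol
  rw [List.lookup_cons]
  by_cases h : i = p'
  · simp [h]
  · have : (i == p') = false := by simpa using h
    simp [this, h]

theorem Describes.transition_eq {M : Machine} {c : SimConfig} {C : Config} (h : Describes c C) :
    transition M c.1 (c.symbol c.2.1) = transition M C.state (C.tape C.pos) := by
  rw [h.tape, h.state, h.pos]

theorem Describes.step_of_halted {M : Machine} {c : SimConfig} {C : Config} (h : Describes c C)
    (hC : transition M C.state (C.tape C.pos) = none) : step M c = some c := by
  rw [step, h.transition_eq, hC]
  rfl

theorem Describes.step_iff {M : Machine} {c : SimConfig} {C : Config} (h : Describes c C)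
    (hC : transition M C.state (C.tape C.pos) ≠ none) :
    (step M c = none ∧ C.step M = none) ∨
      ∃ c' C', step M c = some c' ∧ C.step M = some C' ∧ Describes c' C' := by
  obtain ⟨q, p, l⟩ := c
  obtain ⟨h1, h2, h3⟩ := h
  dsimp only at h1 h2
  obtain ⟨⟨q', b, m⟩, ht⟩ := Option.ne_none_iff_exists'.mp hC
  have hd (q' p' : ℕ) (m : Move) :
      Describes (q', p', (p, b) :: l) ⟨q', p', Function.update C.tape C.pos b, m⟩ := by
    refine ⟨rfl, rfl, fun i => ?_⟩
    change _ = Function.update C.tape C.pos b i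
    rw [symbol_cons, ← h2, Function.update_apply, ← h3 i]
    rfl
  have hs : step M (q, p, l) = (move m p).map fun p' => (q', p', (p, b) :: l) := by
    rw [step, Describes.transition_eq ⟨h1, h2, h3⟩, ht]
    rfl
  rw [hs, Config.step, ht]
  rcases m
  · by_cases hp : p = 0
    · left
      simp [move, hp, ← h2]
    · right
      refine ⟨_, ⟨q', C.pos - 1, Function.update C.tape C.pos b, .left⟩, by simp [move, hp]; rfl,
        by simp [← h2, hp], ?_⟩
      rw [← h2]
      simpa [h2] using hd q' (p - 1) .left
  · right
    refine ⟨_, ⟨q', C.pos, Function.update C.tape C.pos b, .stay⟩, by simp [move]; rfl, rfl, ?_⟩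
    simpa [h2] using hd q' p .stay
  · right
    refine ⟨_, ⟨q', C.pos + 1, Function.update C.tape C.pos b, .right⟩, by simp [move]; rfl, rfl, ?_⟩
    simpa [h2] using hd q' (p + 1) .right

theorem describes_init : Describes (0, 0, []) Config.init := ⟨rfl, rfl, fun _ => rfl⟩

/-- The sequence `configAt` ends when the machine halts, whereas the simulation then stands still;
hence the description may belong to an earlier time `s`. -/
theorem exists_configAt_of_after {M : Machine} {t : ℕ} {c : SimConfig} (h : after M t = some c) :
    ∃ s ≤ t, ∃ C, configAt M s = some C ∧ Describes c C := by
  induction t generalizing c with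
  | zero =>
    obtain rfl := Option.some.inj h
    exact ⟨0, le_rfl, _, rfl, describes_init⟩
  | succ t ih =>
    obtain ⟨c0, h0, h1⟩ := Option.bind_eq_some_iff.mp h
    obtain ⟨s, hs, C, hC, hd⟩ := ih h0
    by_cases hh : transition M C.state (C.tape C.pos) = none
    · rw [hd.step_of_halted hh] at h1
      obtain rfl := Option.some.inj h1
      exact ⟨s, by omega, C, hC, hd⟩
    · rcases hd.step_iff hh with ⟨h2, _⟩ | ⟨c', C', h2, h3, h4⟩
      · rw [h2] at h1; cases h1
      · rw [h2] at h1
        obtain rfl := Option.some.inj h1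
        exact ⟨s + 1, by omega, C', by rw [configAt, hC]; exact h3, h4⟩

theorem exists_after_of_configAt {M : Machine} {t : ℕ} {C : Config} (h : configAt M t = some C) :
    ∃ c, after M t = some c ∧ Describes c C := by
  induction t generalizing C with
  | zero =>
    obtain rfl := Option.some.inj h
    exact ⟨_, rfl, describes_init⟩
  | succ t ih =>
    obtain ⟨C0, h0, h1⟩ := Option.bind_eq_some_iff.mp h
    obtain ⟨c, hc, hd⟩ := ih h0
    have hh : transition M C0.state (C0.tape C0.pos) ≠ none := by
      intro hh
      rw [Config.step, hh] at h1
      cases h1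
    rcases hd.step_iff hh with ⟨_, h2⟩ | ⟨c', C', h2, h3, h4⟩
    · rw [h2] at h1; cases h1
    · rw [h3] at h1
      obtain rfl := Option.some.inj h1
      exact ⟨c', by rw [after, hc]; exact h2, h4⟩

end SimConfig

-- A halted configuration is a fixed point of `step`, so an output reached at time `s` is still
-- visible at every later time `t`.
open SimConfig in
theorem rejectsWithin_iff {M : Machine} {t : ℕ} :
    RejectsWithin M t ↔ ∃ s ≤ t, ∃ o, o ≠ 0 ∧ HaltsWithOutput M s o := by
  simp only [RejectsWithin, Option.mem_toList]
  constructor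
  · rintro ⟨c, hc, h1, h2⟩
    obtain ⟨s, hs, C, hC, hd⟩ := exists_configAt_of_after hc
    refine ⟨s, hs, C.tape C.pos, ?_, C, hC, ?_, rfl⟩
    · rwa [← hd.pos, ← hd.tape]
    · rwa [← hd.transition_eq]
  · rintro ⟨s, hs, o, ho, C, hC, hh, rfl⟩
    obtain ⟨c, hc, hd⟩ := exists_after_of_configAt hC
    have : ∀ k, after M (s + k) = some c := by
      intro k
      induction k with
      | zero => exact hc
      | succ k ih => rw [← add_assoc, after, ih]; exact hd.step_of_halted hh
    refine ⟨c, ?_, ?_, ?_⟩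
    · obtain ⟨k, rfl⟩ := Nat.exists_eq_add_of_le hs
      exact this k
    · rwa [hd.transition_eq]
    · rwa [hd.pos, hd.tape]

section

variable {α : Type} [Primcodable α]

theorem primrec_symbol {c : α → SimConfig} {i : α → ℕ} (hc : Primrec c) (hi : Primrec i) :
    Primrec fun a => (c a).symbol (i a) :=
  Primrec.option_getD.comp ((Primrec.listLookup.comp hi (Primrec.snd.comp (Primrec.snd.comp hc))).of_eq
    fun a => by rw [lawful_beq_subsingleton instBEqOfDecidableEq (instBEqOfDecidableEq : BEq ℕ)])
    (Primrec.const 0)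

theorem primrec_move {m : α → Move} {p : α → ℕ} (hm : Primrec m) (hp : Primrec p) :
    Primrec fun a => SimConfig.move (m a) (p a) :=
  Primrec.ite (Primrec.eq.comp hm (Primrec.const _))
    (Primrec.ite (Primrec.eq.comp hp (Primrec.const _)) (Primrec.const none)
      (Primrec.option_some.comp (Primrec.pred.comp hp)))
    (Primrec.ite (Primrec.eq.comp hm (Primrec.const _)) (Primrec.option_some.comp hp)
      (Primrec.option_some.comp (Primrec.succ.comp hp)))

theorem primrec_simStep {M : α → Machine} {c : α → SimConfig} (hM : Primrec M) (hc : Primrec c) :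
    Primrec fun a => SimConfig.step (M a) (c a) := by
  have hp : Primrec fun a => (c a).2.1 := Primrec.fst.comp (Primrec.snd.comp hc)
  have h1 : Primrec fun a : α × (ℕ × ℕ × Move) => a.2.1 := Primrec.fst.comp Primrec.snd
  have h2 : Primrec fun a : α × (ℕ × ℕ × Move) => a.2.2.1 :=
    Primrec.fst.comp (Primrec.snd.comp Primrec.snd)
  have h3 : Primrec fun a : α × (ℕ × ℕ × Move) => a.2.2.2 :=
    Primrec.snd.comp (Primrec.snd.comp Primrec.snd)
  exact Primrec.option_getD.comp (Primrec.option_map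
    (primrec_transition hM (Primrec.fst.comp hc) (primrec_symbol hc hp))
    (Primrec.option_map (primrec_move h3 (hp.comp Primrec.fst))
      ((h1.comp Primrec.fst).pair (Primrec.snd.pair (Primrec.list_cons.comp
        (((hp.comp Primrec.fst).pair h2).comp Primrec.fst)
        ((Primrec.snd.comp (Primrec.snd.comp hc)).comp (Primrec.fst.comp Primrec.fst))))).to₂).to₂)
    (Primrec.option_some.comp hc)

theorem primrec_after {M : α → Machine} {t : α → ℕ} (hM : Primrec M) (ht : Primrec t) :
    Primrec fun a => SimConfig.after (M a) (t a) := by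
  have : Primrec fun a => (t a).rec (motive := fun _ => Option SimConfig) (some (0, 0, []))
      fun _ c => c.bind (SimConfig.step (M a)) :=
    Primrec.nat_rec' ht (Primrec.const _) (Primrec.option_bind (Primrec.snd.comp Primrec.snd)
      (primrec_simStep (hM.comp (Primrec.fst.comp Primrec.fst)) Primrec.snd).to₂).to₂
  refine this.of_eq fun a => ?_
  induction t a with
  | zero => rfl
  | succ t ih => rw [SimConfig.after, ← ih]

theorem primrecPred_rejectsWithin {M : α → Machine} {t : α → ℕ} (hM : Primrec M)
    (ht : Primrec t) : PrimrecPred fun a => RejectsWithin (M a) (t a) := by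
  have hp : Primrec fun a : α × SimConfig => a.2.2.1 := Primrec.fst.comp (Primrec.snd.comp Primrec.snd)
  have hs := primrec_symbol (Primrec.snd (α := α)) hp
  exact PrimrecPred.exists_mem (Primrec.optionToList.comp (primrec_after hM ht))
    ((Primrec.eq.comp (primrec_transition (hM.comp Primrec.fst) (Primrec.fst.comp Primrec.snd) hs)
      (Primrec.const none)).and (Primrec.eq.comp hs (Primrec.const 0)).not)

end

/-! ## The algorithm -/

/-- The bits of the random string of the node that have been read. -/
def ownBits (w : View Label) : List Bool := (w.2.2.getD w.1 default).2.2

/-- The machine in the label of the node. -/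
def ownMachine (w : View Label) : Machine := (viewLabel w w.1).1.1

open Classical in
/-- Output no if the structural check fails. Otherwise, simulate the machine for `2 ^ k` steps, where
`k` is the number of tails before the first head, and output no if it halts with an output other than
`0`. -/
noncomputable def runView (w : View Label) : Option Bool :=
  if ViewCheck w then
    if (ownBits w).idxOf true < (ownBits w).length then
      some (decide (¬ RejectsWithin (ownMachine w) (2 ^ (ownBits w).idxOf true)))
    else none
  else some false

theorem primrec_runView : Primrec runView := by
  classical
  have hb : Primrec ownBits := Primrec.snd.comp (Primrec.snd.comp ((Primrec.list_getD default).comp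
    (Primrec.snd.comp Primrec.snd) Primrec.fst))
  have hi : Primrec fun w : View Label => (ownBits w).idxOf true :=
    Primrec.list_idxOf.comp (Primrec.const true) hb
  have hM : Primrec ownMachine :=
    Primrec.fst.comp (Primrec.fst.comp (primrec_viewLabel Primrec.id Primrec.fst))
  exact Primrec.ite primrecPred_viewCheck
    (Primrec.ite (Primrec.nat_lt.comp hi (Primrec.list_length.comp hb))
      (Primrec.option_some.comp (primrecPred_rejectsWithin hM (primrec_two_pow hi)).not.decide)
      (Primrec.const none)) (Primrec.const (some false))

/-- The first head in the random string of `v` is bit number `k`. -/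
def FirstHead {V : Type} (ω : V × ℕ → Bool) (v : V) (k : ℕ) : Prop :=
  ω (v, k) = true ∧ ∀ j < k, ω (v, j) = false

/-- What the algorithm does at a node, in terms of the graph. -/
def NodeOutput {V : Type} (G : SimpleGraph V) (x : V → Label) (ω : V × ℕ → Bool) (v : V) (k : ℕ)
    (b : Bool) : Prop :=
  (¬ StructureCheck G.Adj x v ∧ b = false) ∨ (StructureCheck G.Adj x v ∧ FirstHead ω v k ∧
    (b = true ↔ ¬ RejectsWithin (x v).1.1 (2 ^ k)))

section

variable {V : Type} {G : SimpleGraph V} {x : V → Label} {ident : V → ℕ} {ω : V × ℕ → Bool}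
  {m : ℕ} {l : List V} {v : V} {b : Bool}

theorem idxOf_bits {f : ℕ → Bool} {k : ℕ} :
    (((List.range m).map f).idxOf true < m ∧ ((List.range m).map f).idxOf true = k) ↔
      k < m ∧ f k = true ∧ ∀ j < k, f j = false := by
  constructor
  · rintro ⟨h, rfl⟩
    refine ⟨h, ?_, fun j hj => ?_⟩
    · have := List.getElem_idxOf (x := true) (xs := (List.range m).map f) (by simpa using h)
      rwa [List.getElem_map, List.getElem_range] at this
    · have hne := List.not_of_lt_findIdx (p := (· == true)) (xs := (List.range m).map f) hj
      simpa using hne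
  · rintro ⟨hk, h1, h2⟩
    have : ((List.range m).map f).idxOf true = k := by
      rw [List.idxOf, List.findIdx_eq (by simpa using hk)]
      refine ⟨by simpa using h1, fun j hj => ?_⟩
      simpa using h2 j hj
    exact ⟨this ▸ hk, this⟩

-- The coins matter only through the first head among the bits read so far. This makes the result
-- stable when more bits are read and independent of the enumeration `l`.
open Classical in
theorem runView_view (hl : Enumerates l (ball G v checkRadius)) :
    runView (view G x ident ω m l v) = some b ↔
      (¬ StructureCheck G.Adj x v ∧ b = false) ∨
        ∃ k < m, StructureCheck G.Adj x v ∧ NodeOutput G x ω v k b := by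
  have hv := getElem?_view_fst (G := G) (x := x) (ident := ident) (ω := ω) (m := m) hl
  have hM : ownMachine (view G x ident ω m l v) = (x v).1.1 := by
    rw [ownMachine, viewLabel_view hv]
  have hB : ownBits (view G x ident ω m l v) = (List.range m).map fun k => ω (v, k) := by
    have : ((view G x ident ω m l v).2.2.getD (view G x ident ω m l v).1 default) =
        (x v, ident v, (List.range m).map fun k => ω (v, k)) := by
      generalize (view G x ident ω m l v).1 = i at hv
      simp [view, List.getD_eq_getElem?_getD, List.getElem?_map, hv]
    rw [ownBits, this]
  unfold runView
  rw [viewCheck_iff hl, hM, hB]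
  by_cases hS : StructureCheck G.Adj x v
  · simp only [hS, if_true, List.length_map, List.length_range, not_true_eq_false, false_and,
      false_or, NodeOutput, true_and]
    constructor
    · intro h
      split_ifs at h with hk
      obtain ⟨h1, h2, h3⟩ := (idxOf_bits (f := fun k => ω (v, k))).mp ⟨hk, rfl⟩
      refine ⟨_, h1, ⟨h2, h3⟩, ?_⟩
      rw [← Option.some.inj h, decide_eq_true_iff]
    · rintro ⟨k, hk, h1, h2⟩
      obtain ⟨h3, h4⟩ := (idxOf_bits (f := fun k => ω (v, k))).mpr ⟨hk, h1⟩
      rw [if_pos h3, h4, Option.some_inj]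
      rw [Bool.eq_iff_iff, decide_eq_true_iff, h2]
  · simp only [hS, if_false, not_false_eq_true, true_and, false_and, and_false, exists_false,
      or_false, Option.some_inj]
    exact eq_comm

end

/-- The algorithm. -/
noncomputable def decider : RandomisedLocalAlgorithm Label where
  horizon := checkRadius
  run := runView
  computable_run := primrec_runView.to_comp
  run_succ G x ident ω m l v b _ _ hl h := by
    rw [runView_view hl] at h ⊢
    exact h.imp_right fun ⟨k, hk, h⟩ => ⟨k, by omega, h⟩
  encoding_independent G x ident ω l l' v b _ _ hl hl' h := by
    obtain ⟨m, h⟩ := h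
    refine ⟨m, ?_⟩
    rw [runView_view hl] at h
    rwa [runView_view hl']

theorem exists_enumerates {V : Type} [Finite V] (S : Set V) : ∃ l : List V, Enumerates l S := by
  classical
  have := Fintype.ofFinite V
  exact ⟨S.toFinite.toFinset.toList, Finset.nodup_toList _, fun u => by simp⟩

/-- `NodeOutput` mentions neither identifiers nor encodings, which gives obliviousness at once. -/
theorem decider_outputs_iff {V : Type} [Finite V] {G : SimpleGraph V} {x : V → Label}
    {ident : V → ℕ} {ω : V × ℕ → Bool} {v : V} {b : Bool} :
    decider.Outputs G x ident ω v b ↔ ∃ k, NodeOutput G x ω v k b := by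
  constructor
  · rintro ⟨l, m, hl, h⟩
    rcases (runView_view hl).mp h with h | ⟨k, _, _, h⟩
    · exact ⟨0, Or.inl h⟩
    · exact ⟨k, h⟩
  · rintro ⟨k, h⟩
    obtain ⟨l, hl⟩ := exists_enumerates (ball G v checkRadius)
    refine ⟨l, k + 1, hl, (runView_view hl).mpr ?_⟩
    rcases h with h | h
    · exact Or.inl h
    · exact Or.inr ⟨k, by omega, h.1, Or.inr h⟩

theorem decider_idOblivious : decider.IdOblivious := by
  intro V _ G x ident ident' ω v b _ _ _
  rw [decider_outputs_iff, decider_outputs_iff]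

end LocalDecision

namespace LocalDecision

open MeasureTheory

/-! ## Probabilities -/

section Probability

theorem fairCoin_singleton (b : Bool) : fairCoin {b} = 2⁻¹ := by
  rw [fairCoin, PMF.toMeasure_apply_singleton _ _ (measurableSet_singleton b)]
  simp

variable {V : Type}

instance : IsProbabilityMeasure (coinMeasure V) :=
  inferInstanceAs (IsProbabilityMeasure (Measure.infinitePi _))

theorem infinitePi_tails (h : ℕ) :
    Measure.infinitePi (fun _ : ℕ => fairCoin) {f | ∀ j < h, f j = false} = 2⁻¹ ^ h := by
  have : {f : ℕ → Bool | ∀ j < h, f j = false} = Set.pi (Finset.range h) fun _ => {false} := by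
    ext f
    simp
  rw [this, Measure.infinitePi_pi _ fun _ _ => measurableSet_singleton _]
  simp [fairCoin_singleton]

theorem measurableSet_tails (h : ℕ) : MeasurableSet {f : ℕ → Bool | ∀ j < h, f j = false} := by
  have : {f : ℕ → Bool | ∀ j < h, f j = false} = Set.pi (Finset.range h) fun _ => {false} := by
    ext f
    simp
  rw [this]
  exact .pi (Finset.countable_toSet _) fun _ _ => measurableSet_singleton _

theorem coinMeasure_map_curry :
    (coinMeasure V).map (MeasurableEquiv.curry V ℕ Bool) =
      Measure.infinitePi fun _ : V => Measure.infinitePi fun _ : ℕ => fairCoin :=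
  Measure.infinitePi_map_curry fun _ _ => fairCoin

/-- An endless run of tails at `v` is contained, for every `h`, in an event of probability `2⁻¹ ^
h`. -/
theorem ae_exists_firstHead [Finite V] : ∀ᵐ ω ∂(coinMeasure V), ∀ v, ∃ k, FirstHead ω v k := by
  rw [ae_all_iff]
  intro v
  have key : coinMeasure V {ω | ∀ k, ω (v, k) = false} = 0 := by
    by_contra hne
    obtain ⟨h, hh⟩ := ((ENNReal.tendsto_pow_atTop_nhds_zero_of_lt_one
      ENNReal.one_half_lt_one).eventually_lt_const (pos_iff_ne_zero.mpr hne)).exists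
    refine hh.not_ge ?_
    have hs : {ω : V × ℕ → Bool | ∀ k, ω (v, k) = false} ⊆
        Set.pi ((Finset.range h).map ⟨fun k => (v, k), Prod.mk_right_injective v⟩ : Finset (V × ℕ))
          fun _ => {false} := by
      intro ω hω
      simp only [Finset.coe_map, Function.Embedding.coeFn_mk, Set.mem_pi, Set.mem_image,
        Set.mem_singleton_iff, forall_exists_index, and_imp]
      rintro _ k _ rfl
      exact hω k
    refine (measure_mono hs).trans ?_
    rw [coinMeasure, Measure.infinitePi_pi _ fun _ _ => measurableSet_singleton _]
    simp [fairCoin_singleton]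
  rw [ae_iff]
  refine measure_mono_null ?_ key
  intro ω hω
  simp only [Set.mem_ofPred_eq] at hω ⊢
  intro k
  by_contra hk
  refine hω ?_
  classical
  have hex : ∃ k, ω (v, k) = true := ⟨k, by simpa using hk⟩
  exact ⟨Nat.find hex, Nat.find_spec hex, fun j hj => by simpa using Nat.find_min hex hj⟩

/-- After currying, the event is a product over the nodes, and each factor has probability `1 - 2⁻¹
^ h`. -/
theorem coinMeasure_all_heads [Fintype V] (h : ℕ) :
    (coinMeasure V).real {ω | ∀ v, ∃ j < h, ω (v, j) = true} =
      (1 - (1 / 2 : ℝ) ^ h) ^ Fintype.card V := by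
  have hpre : {ω : V × ℕ → Bool | ∀ v, ∃ j < h, ω (v, j) = true} =
      MeasurableEquiv.curry V ℕ Bool ⁻¹'
        Set.univ.pi fun _ => {f : ℕ → Bool | ∀ j < h, f j = false}ᶜ := by
    ext ω
    simp
  have hc : Measure.infinitePi (fun _ : ℕ => fairCoin) {f | ∀ j < h, f j = false}ᶜ =
      1 - 2⁻¹ ^ h := by
    rw [prob_compl_eq_one_sub (measurableSet_tails h), infinitePi_tails]
  have hm : MeasurableSet (Set.univ.pi fun _ : V => {f : ℕ → Bool | ∀ j < h, f j = false}ᶜ) :=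
    .univ_pi fun _ => (measurableSet_tails h).compl
  rw [Measure.real, hpre, ← Measure.map_apply (MeasurableEquiv.measurable _) hm,
    coinMeasure_map_curry, Measure.infinitePi_eq_pi, Measure.pi_pi]
  simp only [hc, Finset.prod_const, Finset.card_univ, ENNReal.toReal_pow]
  rw [ENNReal.toReal_sub_of_le (pow_le_one₀ zero_le (by simp)) ENNReal.one_ne_top]
  simp

/-- With the stated probability, some node gets at least `h` tails before the first head. -/
theorem le_coinMeasure_exists_firstHead [Fintype V] [Nonempty V] {h : ℕ}
    (hh : 4 ^ h ≤ Fintype.card V) {S : Set (V × ℕ → Bool)}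
    (hS : ∀ ω, (∃ v, ∃ k, h ≤ k ∧ FirstHead ω v k) → ω ∈ S) :
    1 - (1 - 1 / Real.sqrt (Fintype.card V : ℝ)) ^ Fintype.card V ≤ (coinMeasure V).real S := by
  set n := Fintype.card V with hn
  have hn0 : 0 < n := Fintype.card_pos
  -- From `4 ^ h ≤ n` it follows that `2 ^ h ≤ √n`.
  have hsq : (1 / 2 : ℝ) ^ h ≥ 1 / Real.sqrt n := by
    rw [one_div_pow]
    refine one_div_le_one_div_of_le (by positivity) (Real.le_sqrt_of_sq_le ?_)
    rw [← pow_mul, mul_comm, pow_mul]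
    norm_num
    exact_mod_cast hh
  have h1 : (1 / 2 : ℝ) ^ h ≤ 1 := pow_le_one₀ (by norm_num) (by norm_num)
  have h2 : (1 - (1 / 2 : ℝ) ^ h) ^ n ≤ (1 - 1 / Real.sqrt n) ^ n :=
    pow_le_pow_left₀ (by linarith) (by linarith) n
  have h3 : (coinMeasure V).real {ω | ∀ v, ∃ j < h, ω (v, j) = true} =
      (1 - (1 / 2 : ℝ) ^ h) ^ n := coinMeasure_all_heads h
  -- `S` need not be measurable. Instead of taking complements, the proof covers a set of full
  -- measure by `S` and the event that all nodes see an early head, and uses subadditivity.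
  have h4 : (coinMeasure V).real (S ∪ {ω | ∀ v, ∃ j < h, ω (v, j) = true}) = 1 := by
    have hae : S ∪ {ω | ∀ v, ∃ j < h, ω (v, j) = true} ∈ ae (coinMeasure V) := by
      filter_upwards [ae_exists_firstHead (V := V)] with ω hω
      by_cases hall : ∀ v, ∃ j < h, ω (v, j) = true
      · exact Or.inr hall
      · push Not at hall
        obtain ⟨v, hv⟩ := hall
        obtain ⟨k, hk⟩ := hω v
        exact Or.inl (hS ω ⟨v, k, not_lt.mp fun hlt => hv k hlt hk.1, hk⟩)
    rw [Measure.real, measure_congr (Filter.eventuallyEq_univ.mpr hae), measure_univ,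
      ENNReal.toReal_one]
  have h5 := measureReal_union_le (μ := coinMeasure V) S {ω | ∀ v, ∃ j < h, ω (v, j) = true}
  linarith

/-- The inequality `1 - t ≤ exp (-t)` at `t = 1 / √n` bounds the `n`-th power by `exp (-√n)`. -/
theorem tendsto_bound :
    Filter.Tendsto (fun n : ℕ => 1 - (1 - 1 / Real.sqrt (n : ℝ)) ^ n) Filter.atTop
      (nhds (1 : ℝ)) := by
  have h : Filter.Tendsto (fun n : ℕ => (1 - 1 / Real.sqrt (n : ℝ)) ^ n) Filter.atTop (nhds 0) := by
    have hexp : Filter.Tendsto (fun n : ℕ => Real.exp (-Real.sqrt n)) Filter.atTop (nhds 0) :=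
      Real.tendsto_exp_neg_atTop_nhds_zero.comp
        (Real.tendsto_sqrt_atTop.comp tendsto_natCast_atTop_atTop)
    refine squeeze_zero' ?_ ?_ hexp
    all_goals
      filter_upwards [Filter.eventually_ge_atTop 1] with n hn
      have h1 : (1 : ℝ) ≤ Real.sqrt n := Real.one_le_sqrt.mpr (by exact_mod_cast hn)
      have h2 : 1 / Real.sqrt n ≤ 1 := (div_le_one (by linarith)).mpr h1
    · exact pow_nonneg (by linarith) n
    · calc (1 - 1 / Real.sqrt n) ^ n ≤ (Real.exp (-(1 / Real.sqrt n))) ^ n :=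
            pow_le_pow_left₀ (by linarith) (Real.one_sub_le_exp_neg _) n
        _ = Real.exp (-Real.sqrt n) := by
            rw [← Real.exp_nat_mul]
            congr 1
            have : (n : ℝ) / Real.sqrt n = Real.sqrt n := Real.div_sqrt
            rw [mul_neg, mul_one_div, this]
  simpa using h.const_sub 1

end Probability

end LocalDecision

namespace LocalDecision

/-! ## Quadtrees over grids -/

/-- Coordinates modulo 3. -/
abbrev Coord : Type := ZMod 3 × ZMod 3

namespace Coord

/-- A unit vector. -/
def IsDir (d : Coord) : Prop := (d.1 = 0 ∧ d.2 ≠ 0) ∨ (d.1 ≠ 0 ∧ d.2 = 0)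

/-- A diagonal vector. -/
def IsDiag (d : Coord) : Prop := d.1 ≠ 0 ∧ d.2 ≠ 0

instance : DecidablePred IsDir := fun _ => inferInstanceAs (Decidable (_ ∨ _))

instance : DecidablePred IsDiag := fun _ => inferInstanceAs (Decidable (_ ∧ _))

/-- If nodes at the diagonal offsets `s` and `t` from their parents are joined by a step `d`, then the
step leads out of the square of the first parent and into the square of the second one. -/
def Leaves (s t d : Coord) : Prop :=
  IsDir d ∧ d ≠ (s.1, 0) ∧ d ≠ (0, s.2) ∧ -d ≠ (t.1, 0) ∧ -d ≠ (0, t.2)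

instance (s t d : Coord) : Decidable (Leaves s t d) := inferInstanceAs (Decidable (_ ∧ _))

-- A closed walk of four unit steps whose opposite corners differ is a unit square, even modulo 3:
-- the third step undoes the first, and the second is perpendicular to both.
set_option synthInstance.maxHeartbeats 200000 in
theorem closed_walk : ∀ d, IsDir d → ∀ e, IsDir e → ∀ f, IsDir f → IsDir (-(d + e + f)) →
    d + e ≠ 0 → d ≠ d + e + f → f = -d ∧ IsDiag (d + e) ∧ IsDiag (e - d) := by decide

theorem diag_cases : ∀ d e s : Coord, IsDir d → IsDir e → IsDiag (d + e) → IsDiag (e - d) →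
    IsDiag s → s = d + e ∨ s = e - d ∨ s = -(d + e) ∨ s = d - e := by decide

/-- The centres of adjacent squares are two steps apart and `2 = -1` modulo 3. Therefore the edge
that crosses from one square to the next has direction `-D`, and it ends at the facing corner. -/
theorem cross_one : ∀ D, IsDir D → ∀ s, IsDiag s → ∀ t, IsDiag t → Leaves s t (D + t - s) →
    t = s + D ∧ D + t - s = -D := by decide

/-- One crossing edge would still allow a diagonal `D`, with the squares shifted along their common
side; a second edge along that side rules this out. -/
theorem cross_dir : ∀ s, IsDiag s → ∀ t, IsDiag t → ∀ D, Leaves s t (D + t - s) →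
    ∀ s', IsDiag s' → IsDir (s' - s) → ∀ t', IsDiag t' → IsDir (t' - t) →
    Leaves s' t' (D + t' - s') → IsDir D := by decide

/-- Only two of the four corners of a square face a neighbouring square in a given direction. -/
theorem diag_shift : ∀ D, IsDir D → ∀ s, IsDiag s → ∀ s', IsDiag s' → ∀ r, IsDiag r → s ≠ s' →
    IsDiag (s + D) ∧ IsDiag (s' + D) ∧ IsDiag (r + D) → r = s ∨ r = s' := by decide

/-- Flipping a sign leads to an adjacent corner of the square; the step is `(s.1, 0)` or `(0, s.2)`
because `-2 = 1` modulo 3. -/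
theorem diag_flip : ∀ s : Coord, IsDiag s → IsDiag (-s.1, s.2) ∧ IsDiag (s.1, -s.2) ∧
    (-s.1, s.2) - s = (s.1, 0) ∧ (s.1, -s.2) - s = (0, s.2) ∧ IsDir (s.1, (0 : ZMod 3)) ∧
    IsDir ((0 : ZMod 3), s.2) := by decide

end Coord

open Coord

/-- A family of nodes with a parent relation and a lateral relation that satisfies the local rules of
quadtrees over grids. -/
structure QuadForest (V : Type) where
  Par : V → V → Prop
  Lat : V → V → Prop
  Base : V → Prop
  col : V → Coord
  par_unique : ∀ {c p q}, Par c p → Par c q → p = q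
  not_base : ∀ {c p}, Par c p → ¬ Base p
  lat_symm : ∀ {u w}, Lat u w → Lat w u
  lat_ne : ∀ {u w}, Lat u w → u ≠ w
  lat_base : ∀ {u w}, Lat u w → Base u → Base w
  children : ∀ {v}, ¬ Base v → ∃ a b c d, (Par a v ∧ Par b v ∧ Par c v ∧ Par d v) ∧
    (Lat a b ∧ Lat b c ∧ Lat c d ∧ Lat d a) ∧ a ≠ c ∧ b ≠ d ∧
    ∀ e, Par e v → e = a ∨ e = b ∨ e = c ∨ e = d
  lat_parents : ∀ {u w}, Lat u w → ∃ p q, Par u p ∧ Par w q ∧ (p = q ∨ Lat p q)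
  lat_children : ∀ {u w}, Lat u w → ¬ Base u → ∃ a b a' b',
    (Par a u ∧ Par b w ∧ Par a' u ∧ Par b' w) ∧ Lat a b ∧ Lat a' b' ∧ Lat a a' ∧ Lat b b'
  lat_dir : ∀ {u w}, Lat u w → Base u → IsDir (col w - col u)
  lat_inj : ∀ {u w w'}, Lat u w → Lat u w' → Base u → col w = col w' → w = w'
  connected : ∀ S : Set V, S.Nonempty →
    (∀ u w, u ∈ S → Par u w ∨ Par w u ∨ Lat u w ∨ (Base u ∧ Base w) → w ∈ S) → ∀ v, v ∈ S

namespace QuadForest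

variable {V : Type} (Q : QuadForest V)

/-! ### Heights -/

/-- There is a path of `k` steps from `u` to a base node that follows the child relation. -/
inductive HasHeight : V → ℕ → Prop
  | base {u} : Q.Base u → HasHeight u 0
  | step {c u k} : HasHeight c k → Q.Par c u → HasHeight u (k + 1)

variable {Q}

/-- The children of a node lie on a lateral cycle, along which the height of one of them is carried
to the others. -/
theorem HasHeight.siblings {k : ℕ} (hlat : ∀ {u w}, Q.HasHeight u k → Q.Lat u w → Q.HasHeight w k)
    {c u e : V} (hc : Q.HasHeight c k) (hcu : Q.Par c u) (he : Q.Par e u) : Q.HasHeight e k := by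
  obtain ⟨a, b, c', d, _, ⟨h1, h2, h3, h4⟩, _, _, hall⟩ := Q.children (Q.not_base hcu)
  have ha : Q.HasHeight a k := by
    rcases hall c hcu with rfl | rfl | rfl | rfl
    · exact hc
    · exact hlat hc (Q.lat_symm h1)
    · exact hlat (hlat hc (Q.lat_symm h2)) (Q.lat_symm h1)
    · exact hlat hc h4
  have hb := hlat ha h1
  have hc' := hlat hb h2
  rcases hall e he with rfl | rfl | rfl | rfl
  · exact ha
  · exact hb
  · exact hc'
  · exact hlat hc' h3

/-- Lateral nodes have lateral children, so the claim descends to the bottom layer, where it is the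
rule `lat_base`. -/
theorem HasHeight.lat {k : ℕ} : ∀ {u w}, Q.HasHeight u k → Q.Lat u w → Q.HasHeight w k := by
  induction k with
  | zero =>
    rintro u w (h | _) hl
    exact .base (Q.lat_base hl h)
  | succ k ih =>
    rintro u w (_ | ⟨hc, hcu⟩) hl
    obtain ⟨a, b, _, _, ⟨ha, hb, _, _⟩, hab, _⟩ := Q.lat_children hl (Q.not_base hcu)
    exact .step (ih (hc.siblings ih hcu ha) hab) hb

theorem HasHeight.unique {k j : ℕ} {u : V} (h : Q.HasHeight u k) (h' : Q.HasHeight u j) :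
    k = j := by
  induction h generalizing j with
  | base hu =>
    rcases h' with _ | ⟨_, hc⟩
    · rfl
    · exact absurd hu (Q.not_base hc)
  | step _ hcu ih =>
    rcases h' with hb | ⟨hc', hcu'⟩
    · exact absurd hb (Q.not_base hcu)
    · rw [ih (hc'.siblings HasHeight.lat hcu' hcu)]

variable (Q)

/-- Otherwise every node has two distinct children and no child is shared, so `V` contains an
injective image of `V × Bool`, which finiteness forbids. -/
theorem exists_base [Finite V] [Nonempty V] : ∃ v, Q.Base v := by
  by_contra! hno
  have hch (v : V) : ∃ a b, Q.Par a v ∧ Q.Par b v ∧ a ≠ b := by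
    obtain ⟨a, b, c, d, ⟨ha, hb, hc, hd⟩, _, hac, _, _⟩ := Q.children (hno v)
    exact ⟨a, c, ha, hc, hac⟩
  choose a b ha hb hab using hch
  have hinj : Function.Injective fun p : V × Bool => if p.2 then a p.1 else b p.1 := by
    rintro ⟨v, i⟩ ⟨w, j⟩ h
    dsimp only at h
    have hp (v : V) (i : Bool) : Q.Par (if i then a v else b v) v := by
      cases i
      · exact hb v
      · exact ha v
    have hvw : v = w := Q.par_unique (hp v i) (h ▸ hp w j)
    subst hvw
    cases i <;> cases j <;> simp [hab v, (hab v).symm] at h ⊢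
  have := Nat.card_le_card_of_injective _ hinj
  have hpos : 0 < Nat.card V := Nat.card_pos
  rw [Nat.card_prod] at this
  simp at this

/-- Having a height is preserved by all moves in the field `connected`; jumps between base nodes,
which stand for foreign edges, are harmless since both ends have height 0. -/
theorem exists_hasHeight [Finite V] (v : V) : ∃ k, Q.HasHeight v k := by
  have : Nonempty V := ⟨v⟩
  obtain ⟨u, hu⟩ := Q.exists_base
  refine Q.connected {v | ∃ k, Q.HasHeight v k} ⟨u, 0, .base hu⟩ ?_ v
  rintro u w ⟨k, hk⟩ (h | h | h | ⟨_, h⟩)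
  · exact ⟨_, .step hk h⟩
  · rcases hk with hb | ⟨hc, hcu⟩
    · exact absurd hb (Q.not_base h)
    · exact ⟨_, hc.siblings HasHeight.lat hcu h⟩
  · exact ⟨k, hk.lat h⟩
  · exact ⟨0, .base h⟩

variable [Finite V]

/-- The height of a node. -/
noncomputable def ht (v : V) : ℕ := (Q.exists_hasHeight v).choose

theorem hasHeight_ht (v : V) : Q.HasHeight v (Q.ht v) := (Q.exists_hasHeight v).choose_spec

variable {Q}

theorem ht_par {c u : V} (h : Q.Par c u) : Q.ht u = Q.ht c + 1 :=
  (Q.hasHeight_ht u).unique (.step (Q.hasHeight_ht c) h)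

theorem ht_lat {u w : V} (h : Q.Lat u w) : Q.ht w = Q.ht u :=
  (Q.hasHeight_ht w).unique ((Q.hasHeight_ht u).lat h)

theorem ht_eq_zero {u : V} : Q.ht u = 0 ↔ Q.Base u := by
  constructor
  · intro h
    have := Q.hasHeight_ht u
    rw [h] at this
    rcases this with hb | _
    exact hb
  · intro h
    exact (Q.hasHeight_ht u).unique (.base h)

theorem not_base_of_ht {u : V} {k : ℕ} (h : Q.ht u = k + 1) : ¬ Q.Base u := fun hb => by
  rw [← ht_eq_zero, h] at hb
  omega

/-! ### Coordinates modulo 3 of all nodes -/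

variable (Q)

open Classical in
/-- The coordinates of the nodes of height `k`: those of a node are the sum of those of its
children. -/
noncomputable def coordAt : ℕ → V → Coord
  | 0, v => Q.col v
  | k + 1, v => ∑ᶠ c ∈ {c | Q.Par c v}, coordAt k c

noncomputable def coord (v : V) : Coord := Q.coordAt (Q.ht v) v

variable {Q}

theorem coord_base {v : V} (h : Q.Base v) : Q.coord v = Q.col v := by
  rw [coord, ht_eq_zero.mpr h, coordAt]

theorem coord_sum {v a b c d : V} (hp : Q.Par a v ∧ Q.Par b v ∧ Q.Par c v ∧ Q.Par d v)
    (hl : Q.Lat a b ∧ Q.Lat b c ∧ Q.Lat c d ∧ Q.Lat d a) (hac : a ≠ c) (hbd : b ≠ d)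
    (hall : ∀ e, Q.Par e v → e = a ∨ e = b ∨ e = c ∨ e = d) :
    Q.coord v = Q.coord a + Q.coord b + Q.coord c + Q.coord d := by
  classical
  have hs : {e | Q.Par e v} = (({a, b, c, d} : Finset V) : Set V) := by
    ext e
    simp only [Set.mem_ofPred_eq, Finset.coe_insert, Finset.coe_singleton, Set.mem_insert_iff,
      Set.mem_singleton_iff]
    refine ⟨hall e, ?_⟩
    rintro (rfl | rfl | rfl | rfl)
    exacts [hp.1, hp.2.1, hp.2.2.1, hp.2.2.2]
  have hk : Q.ht v = Q.ht a + 1 := ht_par hp.1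
  have hb : Q.ht b = Q.ht a := ht_lat hl.1
  have hd : Q.ht d = Q.ht a := ht_lat (Q.lat_symm hl.2.2.2)
  have hc : Q.ht c = Q.ht a := (ht_lat hl.2.1).trans hb
  rw [coord, hk, coordAt, hs, finsum_mem_coe_finset, Finset.sum_insert, Finset.sum_insert,
    Finset.sum_insert, Finset.sum_singleton]
  · simp only [coord, hb, hc, hd]
    ring
  · simp [Q.lat_ne hl.2.2.1]
  · simp [Q.lat_ne hl.2.1, hbd]
  · simp [Q.lat_ne hl.1, hac, (Q.lat_ne hl.2.2.2).symm]

/-- Lateral neighbours of a node differ from it, and from each other, in their coordinates. -/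
structure Regular (Q : QuadForest V) (k : ℕ) : Prop where
  dir : ∀ {u w}, Q.ht u = k → Q.Lat u w → IsDir (Q.coord w - Q.coord u)
  inj : ∀ {u w w'}, Q.ht u = k → Q.Lat u w → Q.Lat u w' → Q.coord w = Q.coord w' → w = w'

/-- The children of a node are at the four diagonal offsets. -/
structure Square (Q : QuadForest V) (u : V) : Prop where
  diag : ∀ {c}, Q.Par c u → IsDiag (Q.coord c - Q.coord u)
  inj : ∀ {c c'}, Q.Par c u → Q.Par c' u → Q.coord c = Q.coord c' → c = c'
  exists_child : ∀ s, IsDiag s → ∃ c, Q.Par c u ∧ Q.coord c = Q.coord u + s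
  lat_iff : ∀ {c c'}, Q.Par c u → Q.Par c' u → (Q.Lat c c' ↔ IsDir (Q.coord c' - Q.coord c))

/-- The children form a closed walk of unit steps, hence a square by `closed_walk`. As `4 = 1` and
`1 / 2 = -1` modulo 3, the sum of its corners is its centre, from which the corners are seen in the
four diagonal directions. -/
theorem Regular.square {k : ℕ} (hk : Q.Regular k) {u : V} (hu : Q.ht u = k + 1) : Q.Square u := by
  obtain ⟨a, b, c, d, hp, hl, hac, hbd, hall⟩ := Q.children (not_base_of_ht hu)
  have hsum := coord_sum hp hl hac hbd hall
  have hta : Q.ht a = k := by have := ht_par hp.1; omega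
  have htb : Q.ht b = k := by have := ht_par hp.2.1; omega
  have htc : Q.ht c = k := by have := ht_par hp.2.2.1; omega
  have htd : Q.ht d = k := by have := ht_par hp.2.2.2; omega
  obtain ⟨e1, h1⟩ : ∃ e, e = Q.coord b - Q.coord a := ⟨_, rfl⟩
  obtain ⟨e2, h2⟩ : ∃ e, e = Q.coord c - Q.coord b := ⟨_, rfl⟩
  obtain ⟨e3, h3⟩ : ∃ e, e = Q.coord d - Q.coord c := ⟨_, rfl⟩
  have hb : Q.coord b = Q.coord a + e1 := by rw [h1]; ring
  have hc : Q.coord c = Q.coord a + (e1 + e2) := by rw [h1, h2]; ring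
  have hd : Q.coord d = Q.coord a + (e1 + e2 + e3) := by rw [h1, h2, h3]; ring
  have d1 : IsDir e1 := h1 ▸ hk.dir hta hl.1
  have d2 : IsDir e2 := h2 ▸ hk.dir htb hl.2.1
  have d3 : IsDir e3 := h3 ▸ hk.dir htc hl.2.2.1
  have d4 : IsDir (-(e1 + e2 + e3)) := by
    have := hk.dir htd hl.2.2.2
    rw [hd] at this
    convert this using 1
    ring
  -- Opposite corners are distinct lateral neighbours of a third corner, so regularity one layer
  -- below separates their coordinates.
  obtain ⟨h31, g1, g2⟩ := closed_walk e1 d1 e2 d2 e3 d3 d4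
    (fun h => hac (hk.inj htd hl.2.2.2 (Q.lat_symm hl.2.2.1) (by rw [hc, h]; ring)))
    (fun h => hbd (hk.inj hta hl.1 (Q.lat_symm hl.2.2.2) (by rw [hb, hd, ← h])))
  have hd' : Q.coord d = Q.coord a + e2 := by rw [hd, h31]; ring
  have h3z : (3 : Coord) = 0 := by decide
  have hu' : Q.coord a = Q.coord u + (e1 + e2) := by
    rw [hsum, hb, hc, hd']
    linear_combination (-(Q.coord a) - (e1 + e2)) * h3z
  have hb' : Q.coord b = Q.coord u + (e2 - e1) := by
    rw [hb, hu']
    linear_combination e1 * h3z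
  have hc' : Q.coord c = Q.coord u + -(e1 + e2) := by
    rw [hc, hu']
    linear_combination (e1 + e2) * h3z
  have hd'' : Q.coord d = Q.coord u + (e1 - e2) := by
    rw [hd', hu']
    linear_combination e2 * h3z
  clear hb hc hd hd' hsum h1 h2 h3 h31 d3 d4 e3
  have key : ∀ e1 e2 : Coord, IsDir e1 → IsDir e2 → IsDiag (e1 + e2) → IsDiag (e2 - e1) →
      IsDiag (-(e1 + e2)) ∧ IsDiag (e1 - e2) ∧ e1 + e2 ≠ e2 - e1 ∧ e1 + e2 ≠ -(e1 + e2) ∧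
      e1 + e2 ≠ e1 - e2 ∧ e2 - e1 ≠ -(e1 + e2) ∧ e2 - e1 ≠ e1 - e2 ∧ -(e1 + e2) ≠ e1 - e2 ∧
      ¬ IsDir (-(e1 + e2) - (e1 + e2)) ∧ ¬ IsDir ((e1 + e2) - -(e1 + e2)) ∧
      ¬ IsDir ((e2 - e1) - (e1 - e2)) ∧ ¬ IsDir ((e1 - e2) - (e2 - e1)) ∧
      ¬ IsDir (0 : Coord) := by decide
  obtain ⟨g3, g4, n1, n2, n3, n4, n5, n6, i1, i2, i3, i4, i0⟩ := key e1 e2 d1 d2 g1 g2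
  have hlat : ∀ {c c'}, Q.Par c u → Q.Par c' u → IsDir (Q.coord c' - Q.coord c) → Q.Lat c c' := by
    intro v v' hv hv'
    rcases hall v hv with rfl | rfl | rfl | rfl <;> rcases hall v' hv' with rfl | rfl | rfl | rfl
    all_goals
      first
      | exact fun _ => hl.1
      | exact fun _ => hl.2.1
      | exact fun _ => hl.2.2.1
      | exact fun _ => hl.2.2.2
      | exact fun _ => Q.lat_symm hl.1
      | exact fun _ => Q.lat_symm hl.2.1
      | exact fun _ => Q.lat_symm hl.2.2.1
      | exact fun _ => Q.lat_symm hl.2.2.2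
      | (rw [sub_self]; exact fun h => absurd h i0)
      | (rw [hu', hc', add_sub_add_left_eq_sub]; intro h; contradiction)
      | (rw [hb', hd'', add_sub_add_left_eq_sub]; intro h; contradiction)
  refine ⟨?_, ?_, ?_, fun hv hv' => ⟨hk.dir (by have := ht_par hv; omega), hlat hv hv'⟩⟩
  · intro v hv
    rcases hall v hv with rfl | rfl | rfl | rfl
    · rwa [hu', add_sub_cancel_left]
    · rwa [hb', add_sub_cancel_left]
    · rwa [hc', add_sub_cancel_left]
    · rwa [hd'', add_sub_cancel_left]
  · intro v v' hv hv'
    rcases hall v hv with rfl | rfl | rfl | rfl <;> rcases hall v' hv' with rfl | rfl | rfl | rfl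
    all_goals
      first
      | exact fun _ => rfl
      | skip
    all_goals
      simp only [hu', hb', hc', hd'', add_right_inj]
      intro h
      first
      | contradiction
      | exact absurd h.symm (by assumption)
  · intro s hs
    rcases diag_cases e1 e2 s d1 d2 g1 g2 hs with rfl | rfl | rfl | rfl
    · exact ⟨a, hp.1, hu'⟩
    · exact ⟨b, hp.2.1, hb'⟩
    · exact ⟨c, hp.2.2.1, hc'⟩
    · exact ⟨d, hp.2.2.2, hd''⟩

end QuadForest

end LocalDecision

/-! ### Crossing edges between adjacent squares, and grid coordinates below a root -/

namespace LocalDecision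

open Coord

namespace QuadForest

variable {V : Type} [Finite V] {Q : QuadForest V}

/-- Lateral children of lateral nodes lie on facing sides. -/
theorem Regular.leaves {k : ℕ} (hk : Q.Regular k) {u w a b : V} (hu : Q.ht u = k + 1)
    (huw : Q.Lat u w) (ha : Q.Par a u) (hb : Q.Par b w) (hab : Q.Lat a b) :
    Leaves (Q.coord a - Q.coord u) (Q.coord b - Q.coord w)
      (Q.coord w - Q.coord u + (Q.coord b - Q.coord w) - (Q.coord a - Q.coord u)) := by
  have hw : Q.ht w = k + 1 := (ht_lat huw).trans hu
  have hta : Q.ht a = k := by have := ht_par ha; omega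
  have htb : Q.ht b = k := by have := ht_par hb; omega
  have e : Q.coord w - Q.coord u + (Q.coord b - Q.coord w) - (Q.coord a - Q.coord u) =
      Q.coord b - Q.coord a := by ring
  rw [e]
  have aux : ∀ {u w a b : V}, Q.ht u = k + 1 → Q.Lat u w → Q.Par a u → Q.Par b w → Q.ht a = k →
      Q.Lat a b → Q.coord b - Q.coord a ≠ ((Q.coord a - Q.coord u).1, 0) ∧
        Q.coord b - Q.coord a ≠ (0, (Q.coord a - Q.coord u).2) := by
    intro u w a b hu huw ha hb hta hab
    have hsq := hk.square hu
    obtain ⟨f1, f2, f3, f4, f5, f6⟩ := diag_flip _ (hsq.diag ha)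
    -- If the step stayed inside the square, regularity would identify `b` with a sibling of `a`;
    -- then `b` would have both parents `u` and `w`.
    have main : ∀ s d, IsDiag s → s - (Q.coord a - Q.coord u) = d → IsDir d →
        Q.coord b - Q.coord a ≠ d := by
      rintro s d hs rfl hd heq
      obtain ⟨c, hc, hcs⟩ := hsq.exists_child s hs
      have hcc : Q.coord c - Q.coord a = s - (Q.coord a - Q.coord u) := by rw [hcs]; ring
      have hac : Q.Lat a c := (hsq.lat_iff ha hc).mpr (hcc ▸ hd)
      have : b = c := hk.inj hta hab hac (by
        have := heq.trans hcc.symm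
        simpa using this)
      subst this
      exact Q.lat_ne huw (Q.par_unique hc hb)
    exact ⟨main _ _ f1 f3 f5, main _ _ f2 f4 f6⟩
  obtain ⟨a1, a2⟩ := aux hu huw ha hb hta hab
  obtain ⟨b1, b2⟩ := aux hw (Q.lat_symm huw) hb ha htb (Q.lat_symm hab)
  rw [← neg_sub] at b1 b2
  exact ⟨hk.dir hta hab, a1, a2, b1, b2⟩

/-- The children of lateral nodes. -/
structure Crossing (Q : QuadForest V) (u w : V) : Prop where
  dir : IsDir (Q.coord w - Q.coord u)
  forward : ∀ {a b}, Q.Par a u → Q.Par b w → Q.Lat a b →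
    Q.coord b - Q.coord a = -(Q.coord w - Q.coord u)
  backward : ∀ {a b}, Q.Par a u → Q.Par b w →
    Q.coord b - Q.coord w = Q.coord a - Q.coord u + (Q.coord w - Q.coord u) → Q.Lat a b

/-- The two crossing edges from `lat_children` feed `cross_dir`, after which `cross_one` determines
every crossing edge. In the converse direction only two corners face `w`, and these two edges
already start at both of them. -/
theorem Regular.crossing {k : ℕ} (hk : Q.Regular k) {u w : V} (hu : Q.ht u = k + 1)
    (huw : Q.Lat u w) : Q.Crossing u w := by
  have hw : Q.ht w = k + 1 := (ht_lat huw).trans hu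
  have hsu := hk.square hu
  have hsw := hk.square hw
  obtain ⟨a, b, a', b', ⟨ha, hb, ha', hb'⟩, hab, hab', haa, hbb⟩ :=
    Q.lat_children huw (not_base_of_ht hu)
  have l1 := hk.leaves hu huw ha hb hab
  have l2 := hk.leaves hu huw ha' hb' hab'
  have hdir : IsDir (Q.coord w - Q.coord u) := by
    refine cross_dir _ (hsu.diag ha) _ (hsw.diag hb) _ l1 _ (hsu.diag ha') ?_ _ (hsw.diag hb') ?_ l2
    · rw [sub_sub_sub_cancel_right]; exact (hsu.lat_iff ha ha').mp haa
    · rw [sub_sub_sub_cancel_right]; exact (hsw.lat_iff hb hb').mp hbb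
  have fwd : ∀ {a b}, Q.Par a u → Q.Par b w → Q.Lat a b →
      Q.coord b - Q.coord w = Q.coord a - Q.coord u + (Q.coord w - Q.coord u) ∧
      Q.coord b - Q.coord a = -(Q.coord w - Q.coord u) := by
    intro a b ha hb hab
    obtain ⟨h1, h2⟩ := cross_one _ hdir _ (hsu.diag ha) _ (hsw.diag hb) (hk.leaves hu huw ha hb hab)
    refine ⟨h1, ?_⟩
    rw [← h2]
    ring
  refine ⟨hdir, fun ha hb hab => (fwd ha hb hab).2, fun {c e} hc he h => ?_⟩
  have h1 := (fwd ha hb hab).1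
  have h2 := (fwd ha' hb' hab').1
  have hne : Q.coord a - Q.coord u ≠ Q.coord a' - Q.coord u := fun h =>
    Q.lat_ne haa (hsu.inj ha ha' (by simpa using h))
  rcases diag_shift _ hdir _ (hsu.diag ha) _ (hsu.diag ha') _ (hsu.diag hc) hne
    ⟨h1 ▸ hsw.diag hb, h2 ▸ hsw.diag hb', h ▸ hsw.diag he⟩ with h3 | h3
  · obtain rfl : c = a := hsu.inj hc ha (by simpa using h3)
    obtain rfl : e = b := hsw.inj he hb (by
      have := h.trans h1.symm
      simpa using this)
    exact hab
  · obtain rfl : c = a' := hsu.inj hc ha' (by simpa using h3)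
    obtain rfl : e = b' := hsw.inj he hb' (by
      have := h.trans h2.symm
      simpa using this)
    exact hab'

/-- Regularity climbs by one layer. If `w` and `w'` are lateral to `u` with equal coordinates, a
crossing edge from a child `a` leads to equally placed children of both; these coincide one layer
below, and parents are unique. -/
theorem regular (k : ℕ) : Q.Regular k := by
  induction k with
  | zero =>
    constructor
    · intro u w hu huw
      have hb := ht_eq_zero.mp hu
      rw [coord_base hb, coord_base (Q.lat_base huw hb)]
      exact Q.lat_dir huw hb
    · intro u w w' hu huw huw' h
      have hb := ht_eq_zero.mp hu
      rw [coord_base (Q.lat_base huw hb), coord_base (Q.lat_base huw' hb)] at h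
      exact Q.lat_inj huw huw' hb h
  | succ k ih =>
    refine ⟨fun hu huw => (ih.crossing hu huw).dir, fun {u w w'} hu huw huw' h => ?_⟩
    have hw' : Q.ht w' = k + 1 := (ht_lat huw').trans hu
    obtain ⟨a, b, _, _, ⟨ha, hb, _, _⟩, hab, _⟩ := Q.lat_children huw (not_base_of_ht hu)
    obtain ⟨hs, hd⟩ := cross_one _ (ih.crossing hu huw).dir _ ((ih.square hu).diag ha) _
      ((ih.square ((ht_lat huw).trans hu)).diag hb) (ih.leaves hu huw ha hb hab)
    obtain ⟨c, hc, hcs⟩ := (ih.square hw').exists_child (Q.coord b - Q.coord w)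
      ((ih.square ((ht_lat huw).trans hu)).diag hb)
    have hac : Q.Lat a c := (ih.crossing hu huw').backward ha hc (by
      rw [hcs, add_sub_cancel_left, hs, h])
    have hbc : b = c := ih.inj (by have := ht_par ha; omega) hab hac (by rw [hcs, ← h]; ring)
    subst hbc
    exact Q.par_unique hb hc

theorem square {u : V} (hu : ¬ Q.Base u) : Q.Square u := by
  rcases h : Q.ht u with _ | k
  · exact absurd (ht_eq_zero.mp h) hu
  · exact (regular k).square h

theorem crossing {u w : V} (hu : ¬ Q.Base u) (huw : Q.Lat u w) : Q.Crossing u w := by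
  rcases h : Q.ht u with _ | k
  · exact absurd (ht_eq_zero.mp h) hu
  · exact (regular k).crossing h huw

/-! ### Grid coordinates below a root -/

/-- `2 ^ k` modulo 3. -/
def scale (k : ℕ) : ZMod 3 := 2 ^ k

theorem scale_cases (k : ℕ) : scale k = 1 ∨ scale k = 2 := by
  induction k with
  | zero => left; rfl
  | succ k ih =>
    rw [scale, pow_succ, ← scale]
    rcases ih with h | h <;> rw [h]
    · right; decide
    · left; decide

/-- The offset of a child with the given parities of the coordinates. -/
def childOffset (k i j : ℕ) : Coord := (scale k * (1 + (i % 2 : ℕ)), scale k * (1 + (j % 2 : ℕ)))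

/-- Modulo 3 the parent is the centre of its children, so the even position has offset `scale k` and
the odd one `2 * scale k = -scale k`; neither vanishes. -/
theorem isDiag_childOffset (k i j : ℕ) : IsDiag (childOffset k i j) := by
  unfold childOffset
  rcases scale_cases k with h | h <;> rcases Nat.mod_two_eq_zero_or_one i with hi | hi <;>
    rcases Nat.mod_two_eq_zero_or_one j with hj | hj <;> rw [h, hi, hj] <;> decide

theorem exists_parity {k : ℕ} {s : Coord} (hs : IsDiag s) :
    ∃ i < 2, ∃ j < 2, s = childOffset k i j := by
  unfold childOffset
  have : ∀ t : ZMod 3, (t = 1 ∨ t = 2) → ∀ s : Coord, IsDiag s → ∃ i < 2, ∃ j < 2,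
      s = (t * (1 + (i % 2 : ℕ)), t * (1 + (j % 2 : ℕ))) := by decide
  exact this _ (scale_cases k) s hs

theorem childOffset_inj {k i j i' j' : ℕ} (h : childOffset k i j = childOffset k i' j') :
    i % 2 = i' % 2 ∧ j % 2 = j' % 2 := by
  have : ∀ t : ZMod 3, (t = 1 ∨ t = 2) → ∀ i < 2, ∀ j < 2,
      t * (1 + (i : ℕ)) = t * (1 + (j : ℕ)) → i = j := by decide
  have h' := Prod.ext_iff.mp h
  exact ⟨this _ (scale_cases k) _ (Nat.mod_lt _ (by norm_num)) _ (Nat.mod_lt _ (by norm_num)) h'.1,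
    this _ (scale_cases k) _ (Nat.mod_lt _ (by norm_num)) _ (Nat.mod_lt _ (by norm_num)) h'.2⟩

variable (Q)

open Classical in
/-- The child of `u` at the offset `s`. -/
noncomputable def childAt (u : V) (s : Coord) : V :=
  if h : ∃ c, Q.Par c u ∧ Q.coord c = Q.coord u + s then h.choose else u

/-- The node in column `X` and row `Y` among the descendants of `R` in depth `d`. -/
noncomputable def node (R : V) : ℕ → ℕ → ℕ → V
  | 0, _, _ => R
  | d + 1, X, Y => Q.childAt (node R d (X / 2) (Y / 2)) (childOffset (Q.ht R - (d + 1)) X Y)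

variable {Q}

theorem childAt_spec {u : V} (hu : ¬ Q.Base u) {s : Coord} (hs : IsDiag s) :
    Q.Par (Q.childAt u s) u ∧ Q.coord (Q.childAt u s) = Q.coord u + s := by
  have h := (square hu).exists_child s hs
  rw [childAt, dif_pos h]
  exact h.choose_spec

theorem ht_node {R : V} {d X Y : ℕ} (hd : d ≤ Q.ht R) : Q.ht (Q.node R d X Y) = Q.ht R - d := by
  induction d generalizing X Y with
  | zero => rfl
  | succ d ih =>
    have h1 := ih (X := X / 2) (Y := Y / 2) (by omega)
    have hb : ¬ Q.Base (Q.node R d (X / 2) (Y / 2)) := fun h => by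
      rw [← ht_eq_zero] at h
      omega
    have h2 := ht_par (childAt_spec hb (isDiag_childOffset (Q.ht R - (d + 1)) X Y)).1
    rw [node]
    omega

theorem not_base_node {R : V} {d X Y : ℕ} (hd : d < Q.ht R) : ¬ Q.Base (Q.node R d X Y) := by
  rw [← ht_eq_zero, ht_node hd.le]
  omega

theorem par_node {R : V} {d X Y : ℕ} (hd : d < Q.ht R) :
    Q.Par (Q.node R (d + 1) X Y) (Q.node R d (X / 2) (Y / 2)) :=
  (childAt_spec (not_base_node hd) (isDiag_childOffset _ X Y)).1

theorem coord_node_succ {R : V} {d X Y : ℕ} (hd : d < Q.ht R) :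
    Q.coord (Q.node R (d + 1) X Y) = Q.coord (Q.node R d (X / 2) (Y / 2)) +
      childOffset (Q.ht R - (d + 1)) X Y :=
  (childAt_spec (not_base_node hd) (isDiag_childOffset _ X Y)).2

theorem eq_node_of_par {R c : V} {d X Y : ℕ} (hd : d < Q.ht R) (hc : Q.Par c (Q.node R d X Y)) :
    ∃ X' Y', X' / 2 = X ∧ Y' / 2 = Y ∧ c = Q.node R (d + 1) X' Y' := by
  have hs := square (Q := Q) (not_base_node (X := X) (Y := Y) hd)
  obtain ⟨i, hi, j, hj, hij⟩ := exists_parity (k := Q.ht R - (d + 1)) (hs.diag hc)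
  have hX : (2 * X + i) / 2 = X := by omega
  have hY : (2 * Y + j) / 2 = Y := by omega
  refine ⟨2 * X + i, 2 * Y + j, hX, hY, ?_⟩
  have h1 := par_node (X := 2 * X + i) (Y := 2 * Y + j) hd
  have h2 := coord_node_succ (X := 2 * X + i) (Y := 2 * Y + j) hd
  rw [hX, hY] at h1 h2
  refine hs.inj hc h1 ?_
  rw [h2, ← sub_eq_iff_eq_add', hij, childOffset, childOffset]
  simp only [Nat.mul_add_mod]

/-- `R` has no parent. -/
def IsRoot (Q : QuadForest V) (R : V) : Prop := ∀ p, ¬ Q.Par R p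

/-- Climb from both descriptions by unique parents; a root has no parent, so both climbs end
together. The lost parities are recovered from the offsets. -/
theorem node_injective {R R' : V} (hR : Q.IsRoot R) (hR' : Q.IsRoot R') {d d' X Y X' Y' : ℕ}
    (hd : d ≤ Q.ht R) (hd' : d' ≤ Q.ht R') (hX : X < 2 ^ d) (hY : Y < 2 ^ d) (hX' : X' < 2 ^ d')
    (hY' : Y' < 2 ^ d') (h : Q.node R d X Y = Q.node R' d' X' Y') :
    R = R' ∧ d = d' ∧ X = X' ∧ Y = Y' := by
  induction d generalizing d' X Y X' Y' with
  | zero =>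
    rcases d' with _ | d'
    · simp at hX hY hX' hY'
      exact ⟨h, rfl, by omega, by omega⟩
    · have := par_node (Q := Q) (R := R') (d := d') (X := X') (Y := Y') hd'
      rw [← h] at this
      exact absurd this (hR _)
  | succ d ih =>
    have hp := par_node (Q := Q) (R := R) (d := d) (X := X) (Y := Y) hd
    rcases d' with _ | d'
    · rw [h] at hp
      exact absurd hp (hR' _)
    · have hp' := par_node (Q := Q) (R := R') (d := d') (X := X') (Y := Y') hd'
      rw [pow_succ] at hX hY hX' hY'
      obtain ⟨rfl, rfl, h1, h2⟩ := ih (by omega) (by omega) (by omega) (by omega) (by omega)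
        (by omega) (Q.par_unique hp (h ▸ hp'))
      have e := coord_node_succ (Q := Q) (X := X) (Y := Y) hd
      have e' := coord_node_succ (Q := Q) (X := X') (Y := Y') hd'
      rw [h, h1, h2, e', add_right_inj] at e
      obtain ⟨h3, h4⟩ := childOffset_inj e
      exact ⟨rfl, rfl, by omega, by omega⟩

/-- Heights are bounded because `V` is finite, so climbing to parents ends at a root. -/
theorem exists_eq_node (v : V) : ∃ R, Q.IsRoot R ∧ ∃ d ≤ Q.ht R, ∃ X < 2 ^ d, ∃ Y < 2 ^ d,
    v = Q.node R d X Y := by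
  obtain ⟨N, hN⟩ : ∃ N, ∀ v, Q.ht v ≤ N := by
    obtain ⟨N, hN⟩ := (Set.finite_range Q.ht).bddAbove
    exact ⟨N, fun v => hN ⟨v, rfl⟩⟩
  induction hm : N - Q.ht v using Nat.strong_induction_on generalizing v with
  | _ m ih =>
    by_cases hv : Q.IsRoot v
    · exact ⟨v, hv, 0, by omega, 0, by simp, 0, by simp, rfl⟩
    · unfold IsRoot at hv
      push Not at hv
      obtain ⟨p, hp⟩ := hv
      have h1 := ht_par hp
      have h2 := hN p
      obtain ⟨R, hR, d, hd, X, hX, Y, hY, rfl⟩ := ih (N - Q.ht p) (by omega) p rfl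
      have hd' : d < Q.ht R := by
        rw [ht_node hd] at h1
        omega
      obtain ⟨X', Y', rfl, rfl, rfl⟩ := eq_node_of_par hd' hp
      refine ⟨R, hR, d + 1, hd', X', ?_, Y', ?_, rfl⟩ <;> rw [pow_succ] <;> omega

/-- Coordinates are affine in the grid position. The scale halves on the way down, and `X = 2 * (X /
2) + X % 2` combines the position of the parent with the parity. -/
theorem exists_coord_node (R : V) (d : ℕ) (hd : d ≤ Q.ht R) : ∃ c : Coord, ∀ X Y, X < 2 ^ d →
    Y < 2 ^ d → Q.coord (Q.node R d X Y) =
      c + (scale (Q.ht R - d) * (X : ℕ), scale (Q.ht R - d) * (Y : ℕ)) := by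
  induction d with
  | zero =>
    refine ⟨Q.coord R, fun X Y hX hY => ?_⟩
    obtain rfl : X = 0 := by simpa using hX
    obtain rfl : Y = 0 := by simpa using hY
    simp [node]
  | succ d ih =>
    obtain ⟨c, hc⟩ := ih (by omega)
    refine ⟨c + (scale (Q.ht R - (d + 1)), scale (Q.ht R - (d + 1))), fun X Y hX hY => ?_⟩
    rw [pow_succ] at hX hY
    rw [coord_node_succ hd, hc _ _ (by omega) (by omega), childOffset]
    have hs : scale (Q.ht R - d) = scale (Q.ht R - (d + 1)) * 2 := by
      rw [show Q.ht R - d = Q.ht R - (d + 1) + 1 by omega, scale, pow_succ, ← scale]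
    have hd (X : ℕ) : (X : ZMod 3) = 2 * ((X / 2 : ℕ) : ZMod 3) + ((X % 2 : ℕ) : ZMod 3) := by
      conv_lhs => rw [← Nat.div_add_mod X 2]
      push_cast
      rfl
    rw [hs, hd X, hd Y]
    ext <;> simp only [Prod.fst_add, Prod.snd_add] <;> ring

theorem coord_node_sub {R : V} {d : ℕ} (hd : d ≤ Q.ht R) {X Y X' Y' : ℕ} (hX : X < 2 ^ d)
    (hY : Y < 2 ^ d) (hX' : X' < 2 ^ d) (hY' : Y' < 2 ^ d) :
    Q.coord (Q.node R d X' Y') - Q.coord (Q.node R d X Y) =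
      (scale (Q.ht R - d) * ((X' : ZMod 3) - X), scale (Q.ht R - d) * ((Y' : ZMod 3) - Y)) := by
  obtain ⟨c, hc⟩ := exists_coord_node (Q := Q) R d hd
  rw [hc X Y hX hY, hc X' Y' hX' hY', add_sub_add_left_eq_sub, Prod.mk_sub_mk, ← mul_sub, ← mul_sub]

theorem scale_mul_eq_zero {k : ℕ} {a : ZMod 3} : scale k * a = 0 ↔ a = 0 := by
  have : ∀ t : ZMod 3, (t = 1 ∨ t = 2) → ∀ a, t * a = 0 ↔ a = 0 := by decide
  exact this _ (scale_cases k) a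

theorem scale_mul_inj {k : ℕ} {a b : ZMod 3} : scale k * a = scale k * b ↔ a = b := by
  rw [← sub_eq_zero, ← mul_sub, scale_mul_eq_zero, sub_eq_zero]

theorem scale_succ (k : ℕ) : scale (k + 1) = scale k * 2 := pow_succ _ _

theorem natCast_sub_eq {X X' : ℕ} {a b : ℕ} (h : (X' : ZMod 3) - X = (a : ZMod 3) - b) :
    (X' + b) % 3 = (X + a) % 3 := by
  have : ((X' + b : ℕ) : ZMod 3) = ((X + a : ℕ) : ZMod 3) := by
    push_cast
    linear_combination h
  exact (ZMod.natCast_eq_natCast_iff' _ _ _).mp this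

/-- Adjacent positions either share a parent, and `Square` applies, or have adjacent parents, which
are lateral by induction, and `Crossing.backward` applies. -/
theorem lat_node_of_adj {R : V} {d : ℕ} (hd : d ≤ Q.ht R) {X Y X' Y' : ℕ}
    (hX : X' < 2 ^ d) (hY : Y' < 2 ^ d) (h : (X' = X + 1 ∧ Y' = Y) ∨ (X' = X ∧ Y' = Y + 1)) :
    Q.Lat (Q.node R d X Y) (Q.node R d X' Y') := by
  induction d generalizing X Y X' Y' with
  | zero =>
    simp only [pow_zero] at hX hY
    omega
  | succ d ih =>
    have hp := par_node (Q := Q) (R := R) (d := d) (X := X) (Y := Y) hd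
    have hp' := par_node (Q := Q) (R := R) (d := d) (X := X') (Y := Y') hd
    have hXd : X < 2 ^ (d + 1) := by omega
    have hYd : Y < 2 ^ (d + 1) := by omega
    have hsub := coord_node_sub hd hXd hYd hX hY
    rw [pow_succ] at hX hY
    by_cases hpar : X / 2 = X' / 2 ∧ Y / 2 = Y' / 2
    · rw [← hpar.1, ← hpar.2] at hp'
      refine ((square (not_base_node hd)).lat_iff hp hp').mpr ?_
      rw [hsub]
      rcases h with ⟨rfl, rfl⟩ | ⟨rfl, rfl⟩
      · right
        simp only [scale_mul_eq_zero, ne_eq]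
        constructor <;> push_cast <;> ring_nf <;> decide
      · left
        simp only [scale_mul_eq_zero, ne_eq]
        constructor <;> push_cast <;> ring_nf <;> decide
    · have hlat : Q.Lat (Q.node R d (X / 2) (Y / 2)) (Q.node R d (X' / 2) (Y' / 2)) :=
        ih (by omega) (by omega) (by omega) (by omega)
      refine (crossing (not_base_node hd) hlat).backward hp hp' ?_
      rw [coord_node_succ hd, coord_node_succ hd, add_sub_cancel_left, add_sub_cancel_left,
        coord_node_sub (by omega) (by omega) (by omega) (by omega) (by omega),
        show Q.ht R - d = Q.ht R - (d + 1) + 1 by omega, scale_succ]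
      have h3 : (3 : ZMod 3) = 0 := rfl
      rcases h with ⟨rfl, rfl⟩ | ⟨rfl, rfl⟩
      · have e1 : X % 2 = 1 := by omega
        have e2 : (X + 1) % 2 = 0 := by omega
        have e3 : (X + 1) / 2 = X / 2 + 1 := by omega
        simp only [childOffset, e1, e2, e3, Prod.mk_add_mk]
        push_cast
        ext
        · linear_combination (-scale (Q.ht R - (d + 1))) * h3
        · simp
      · have e1 : Y % 2 = 1 := by omega
        have e2 : (Y + 1) % 2 = 0 := by omega
        have e3 : (Y + 1) / 2 = Y / 2 + 1 := by omega
        simp only [childOffset, e1, e2, e3, Prod.mk_add_mk]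
        push_cast
        ext
        · simp
        · linear_combination (-scale (Q.ht R - (d + 1))) * h3

/-- A lateral edge has equal or lateral parents, whose positions differ by at most a grid step by
induction. The displacement modulo 3 then determines that of the children. Roots have no lateral
edges, as these require parents. -/
theorem lat_node {R : V} (hR : Q.IsRoot R) {d : ℕ} (hd : d ≤ Q.ht R) {X Y : ℕ} {w : V}
    (hX : X < 2 ^ d) (hY : Y < 2 ^ d) (h : Q.Lat (Q.node R d X Y) w) :
    ∃ X' Y', X' < 2 ^ d ∧ Y' < 2 ^ d ∧ w = Q.node R d X' Y' ∧
      ((X' = X + 1 ∧ Y' = Y) ∨ (X' = X ∧ Y' = Y + 1) ∨ (X = X' + 1 ∧ Y' = Y) ∨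
        (X' = X ∧ Y = Y' + 1)) := by
  induction d generalizing X Y w with
  | zero =>
    obtain ⟨p, _, hp, _⟩ := Q.lat_parents h
    exact absurd hp (hR p)
  | succ d ih =>
    obtain ⟨p, q, hp, hq, hpq⟩ := Q.lat_parents h
    have hp0 := par_node (Q := Q) (R := R) (d := d) (X := X) (Y := Y) hd
    obtain rfl := Q.par_unique hp hp0
    have hXd := hX
    have hYd := hY
    rw [pow_succ] at hX hY
    rcases hpq with rfl | hpq
    · obtain ⟨X', Y', h1, h2, rfl⟩ := eq_node_of_par hd hq
      have hX' : X' < 2 ^ (d + 1) := by rw [pow_succ]; omega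
      have hY' : Y' < 2 ^ (d + 1) := by rw [pow_succ]; omega
      refine ⟨X', Y', hX', hY', rfl, ?_⟩
      have hdir := (regular _).dir rfl h
      rw [coord_node_sub hd hXd hYd hX' hY'] at hdir
      simp only [IsDir, scale_mul_eq_zero, ne_eq, sub_eq_zero, ZMod.natCast_eq_natCast_iff'] at hdir
      omega
    · obtain ⟨X1, Y1, hX1, hY1, rfl, hadj⟩ := ih (by omega) (by omega) (by omega) hpq
      obtain ⟨X', Y', rfl, rfl, rfl⟩ := eq_node_of_par hd hq
      have hX' : X' < 2 ^ (d + 1) := by rw [pow_succ]; omega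
      have hY' : Y' < 2 ^ (d + 1) := by rw [pow_succ]; omega
      refine ⟨X', Y', hX', hY', rfl, ?_⟩
      have hf := (crossing (not_base_node hd) hpq).forward hp0 hq h
      rw [coord_node_sub hd hXd hYd hX' hY', coord_node_sub (by omega) (by omega) (by omega) hX1 hY1,
        show Q.ht R - d = Q.ht R - (d + 1) + 1 by omega, scale_succ, Prod.neg_mk, Prod.mk.injEq]
        at hf
      replace hf := hf.imp (fun h => scale_mul_inj.mp (h.trans (by ring :
          _ = scale (Q.ht R - (d + 1)) * -(2 * (((X' / 2 : ℕ) : ZMod 3) - (X / 2 : ℕ))))))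
        (fun h => scale_mul_inj.mp (h.trans (by ring :
          _ = scale (Q.ht R - (d + 1)) * -(2 * (((Y' / 2 : ℕ) : ZMod 3) - (Y / 2 : ℕ))))))
      have h3 : (3 : ZMod 3) = 0 := rfl
      -- Since `-2 = 1` modulo 3, children joined by a crossing edge are displaced like their
      -- parents modulo 3; with the halves of the positions known, this fixes the integers.
      have g1 : (X' : ZMod 3) - X = ((X' / 2 : ℕ) : ZMod 3) - (X / 2 : ℕ) := by
        linear_combination hf.1 - (((X' / 2 : ℕ) : ZMod 3) - (X / 2 : ℕ)) * h3
      have g2 : (Y' : ZMod 3) - Y = ((Y' / 2 : ℕ) : ZMod 3) - (Y / 2 : ℕ) := by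
        linear_combination hf.2 - (((Y' / 2 : ℕ) : ZMod 3) - (Y / 2 : ℕ)) * h3
      have g1' := natCast_sub_eq g1
      have g2' := natCast_sub_eq g2
      omega

end QuadForest

end LocalDecision

namespace LocalDecision

/-! ## Labelled graphs that pass the structural check -/

section Relations

variable {W : Type} {A : W → W → Prop} {L : W → Label} {u w : W}

theorem Lateral.symm (hA : ∀ u w, A u w → A w u) (h : Lateral A L u w) : Lateral A L w u := by
  obtain ⟨h1, h2, h3, p, hp, q, hq, h4, h5, h6⟩ := h
  exact ⟨hA _ _ h1, h3, h2, q, hq, p, hp, h5, h4, h6.imp Eq.symm (hA _ _)⟩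

theorem Foreign.symm (hA : ∀ u w, A u w → A w u) (h : Foreign A L u w) : Foreign A L w u :=
  ⟨hA _ _ h.1, h.2.2.1, h.2.1, fun hl => h.2.2.2 (hl.symm hA)⟩

theorem IsParent.up {c p : W} (h : IsParent A L c p) : (L p).2 = none := h.2.1

theorem adj_cases (h : A u w) :
    IsParent A L u w ∨ IsParent A L w u ∨ Lateral A L u w ∨ Foreign A L u w := by
  by_cases h1 : IsParent A L u w
  · exact .inl h1
  by_cases h2 : IsParent A L w u
  · exact .inr (.inl h2)
  by_cases h3 : Lateral A L u w
  · exact .inr (.inr (.inl h3))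
  · exact .inr (.inr (.inr ⟨h, h1, h2, h3⟩))

end Relations

theorem mod3_eq (X Y : ℕ) : mod3 X Y = (((X : ZMod 3), (Y : ZMod 3)) : Coord) := rfl

theorem LabelRel.Neighbours.isDir {l l' : Label} (h : LabelRel.Neighbours l l') :
    Coord.IsDir ((coords l' : Coord) - (coords l : Coord)) := by
  have : ∀ c d : Coord, (d = (c.1 + 1, c.2) ∨ c = (d.1 + 1, d.2) ∨ d = (c.1, c.2 + 1) ∨
      c = (d.1, d.2 + 1)) → Coord.IsDir (d - c) := by decide
  exact this _ _ h

/-- A connected labelled graph in which all nodes pass the structural check. -/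
structure Accepted {V : Type} (G : SimpleGraph V) (x : V → Label) : Prop where
  connected : G.Connected
  check : ∀ v, StructureCheck G.Adj x v

namespace Accepted

variable {V : Type} {G : SimpleGraph V} {x : V → Label}

theorem locallyConsistent (h : Accepted G x) : LocallyConsistent G.Adj x :=
  (LocalFormula.forall_holds_rules _ _).mp fun v => (h.check v).1

theorem adj_symm (u w : V) (h : G.Adj u w) : G.Adj w u := h.symm

theorem foreign_base (h : Accepted G x) {u w : V} (hf : Foreign G.Adj x u w) : (x u).2 ≠ none :=
  h.locallyConsistent.foreign_base u w hf.1 hf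

/-- The quadtrees in the graph. -/
def forest (h : Accepted G x) : QuadForest V where
  Par := IsParent G.Adj x
  Lat := Lateral G.Adj x
  Base v := (x v).2 ≠ none
  col v := coords (x v)
  par_unique {c p q} hp hq := h.locallyConsistent.parent_unique c p hp.1.symm q hq.1.symm hp hq
  not_base hp hb := hb hp.up
  lat_symm hl := hl.symm adj_symm
  lat_ne hl := hl.1.ne
  lat_base {u w} hl hu hw :=
    hu (h.locallyConsistent.lateral_up w u hl.1.symm (hl.symm adj_symm) hw)
  children {v} hv := by
    obtain ⟨a, _, b, _, c, _, d, _, h1, h2, h3, h4, h5, h6, h7, h8, h9, h10, h11⟩ :=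
      h.locallyConsistent.children v (not_not.mp hv)
    exact ⟨a, b, c, d, ⟨h1, h2, h3, h4⟩, ⟨h5, h6, h7, h8⟩, h9, h10,
      fun e he => h11 e he.1 he⟩
  lat_parents {u w} hl := by
    obtain ⟨_, _, _, p, hp, q, hq, h1, h2, _⟩ := id hl
    exact ⟨p, q, h1, h2, h.locallyConsistent.lateral_parents u w hl.1 p hp q hq hl h1 h2⟩
  lat_children {u w} hl hu := by
    obtain ⟨a, _, b, _, a', _, b', _, h1, h2, h3, h4, h5⟩ :=
      h.locallyConsistent.lateral_children u w hl.1 hl (not_not.mp hu)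
    exact ⟨a, b, a', b', ⟨h1, h2, h3, h4⟩, h5⟩
  lat_dir {u w} hl hu := (h.locallyConsistent.lateral_coords u w hl.1 hl hu).1.isDir
  lat_inj {u w w'} hl hl' hu hww :=
    (h.locallyConsistent.lateral_coords u w hl.1 hl hu).2 w' hl'.1 hl' hww
  connected S hS hcl v := by
    obtain ⟨u, hu⟩ := hS
    obtain ⟨p⟩ := h.connected u v
    induction p with
    | nil => exact hu
    | cons hadj _ ih =>
      refine ih (hcl _ _ hu ?_)
      rcases adj_cases (L := x) hadj with h1 | h1 | h1 | h1
      · exact .inl h1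
      · exact .inr (.inl h1)
      · exact .inr (.inr (.inl h1))
      · exact .inr (.inr (.inr ⟨h.foreign_base h1, h.foreign_base (h1.symm adj_symm)⟩))

/-! ### The tables -/

variable [Finite V] (h : Accepted G x)

/-- The side of the table at the base of the pyramid with the root `R`. -/
noncomputable def side (R : V) : ℕ := 2 ^ h.forest.ht R

/-- The node in column `X` and row `Y` of the table at the base of the pyramid with the root `R`. -/
noncomputable def tableNode (R : V) (X Y : ℕ) : V := h.forest.node R (h.forest.ht R) X Y

variable {h}

theorem side_pos {R : V} : 0 < h.side R := by unfold side; positivity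

theorem exists_eq_tableNode {v : V} (hv : (x v).2 ≠ none) : ∃ R, h.forest.IsRoot R ∧
    ∃ X < h.side R, ∃ Y < h.side R, v = h.tableNode R X Y := by
  obtain ⟨R, hR, d, hd, X, hX, Y, hY, rfl⟩ := h.forest.exists_eq_node v
  have h0 := QuadForest.ht_eq_zero.mpr (show h.forest.Base _ from hv)
  rw [QuadForest.ht_node hd] at h0
  obtain rfl : d = h.forest.ht R := by omega
  exact ⟨R, hR, X, hX, Y, hY, rfl⟩

theorem base_tableNode {R : V} {X Y : ℕ} : (x (h.tableNode R X Y)).2 ≠ none := by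
  refine (QuadForest.ht_eq_zero (Q := h.forest)).mp ?_
  rw [tableNode, QuadForest.ht_node le_rfl, Nat.sub_self]

theorem tableNode_injective {R R' : V} (hR : h.forest.IsRoot R) (hR' : h.forest.IsRoot R')
    {X Y X' Y' : ℕ} (hX : X < h.side R) (hY : Y < h.side R) (hX' : X' < h.side R')
    (hY' : Y' < h.side R') (he : h.tableNode R X Y = h.tableNode R' X' Y') :
    R = R' ∧ X = X' ∧ Y = Y' := by
  obtain ⟨h1, _, h3⟩ := QuadForest.node_injective hR hR' le_rfl le_rfl hX hY hX' hY' he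
  exact ⟨h1, h3⟩

theorem exists_coords_tableNode (R : V) : ∃ a b : ℕ, ∀ X Y, X < h.side R → Y < h.side R →
    coords (x (h.tableNode R X Y)) = mod3 (a + X) (b + Y) := by
  obtain ⟨c, hc⟩ := h.forest.exists_coord_node R _ le_rfl
  refine ⟨c.1.val, c.2.val, fun X Y hX hY => ?_⟩
  have h1 := hc X Y hX hY
  rw [QuadForest.coord_base base_tableNode, Nat.sub_self] at h1
  refine Eq.trans h1 ?_
  rw [mod3_eq]
  push_cast
  simp [QuadForest.scale]
  rfl

theorem adj_tableNode_east {R : V} {X Y : ℕ} (hX : X + 1 < h.side R) (hY : Y < h.side R) :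
    East G.Adj x (h.tableNode R X Y) (h.tableNode R (X + 1) Y) := by
  refine ⟨QuadForest.lat_node_of_adj (Q := h.forest) le_rfl hX hY (.inl ⟨rfl, rfl⟩), ?_⟩
  obtain ⟨a, b, hab⟩ := exists_coords_tableNode (h := h) R
  rw [LabelRel.EastOf, hab _ _ hX hY, hab X _ (by omega) hY, mod3_eq, mod3_eq]
  refine Prod.ext ?_ rfl
  change (((a + (X + 1) : ℕ) : ZMod 3)) = ((a + X : ℕ) : ZMod 3) + 1
  push_cast
  ring

theorem adj_tableNode_south {R : V} {X Y : ℕ} (hX : X < h.side R) (hY : Y + 1 < h.side R) :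
    South G.Adj x (h.tableNode R X Y) (h.tableNode R X (Y + 1)) := by
  refine ⟨QuadForest.lat_node_of_adj (Q := h.forest) le_rfl hX hY (.inr ⟨rfl, rfl⟩), ?_⟩
  obtain ⟨a, b, hab⟩ := exists_coords_tableNode (h := h) R
  rw [LabelRel.SouthOf, hab _ _ hX hY, hab _ Y hX (by omega), mod3_eq, mod3_eq]
  refine Prod.ext rfl ?_
  change (((b + (Y + 1) : ℕ) : ZMod 3)) = ((b + Y : ℕ) : ZMod 3) + 1
  push_cast
  ring

theorem lateral_tableNode {R : V} (hR : h.forest.IsRoot R) {X Y : ℕ} (hX : X < h.side R)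
    (hY : Y < h.side R) {w : V} (hw : Lateral G.Adj x (h.tableNode R X Y) w) :
    ∃ X' Y', X' < h.side R ∧ Y' < h.side R ∧ w = h.tableNode R X' Y' ∧
      ((X' = X + 1 ∧ Y' = Y) ∨ (X' = X ∧ Y' = Y + 1) ∨ (X = X' + 1 ∧ Y' = Y) ∨
        (X' = X ∧ Y = Y' + 1)) :=
  QuadForest.lat_node (Q := h.forest) hR le_rfl hX hY hw

theorem coords_tableNode_eq {R : V} {X Y X' Y' : ℕ} (hX : X < h.side R) (hY : Y < h.side R)
    (hX' : X' < h.side R) (hY' : Y' < h.side R) {i j : ℕ}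
    (he : coords (x (h.tableNode R X' Y')) =
      ((coords (x (h.tableNode R X Y))).1 + Fin.ofNat 3 i,
        (coords (x (h.tableNode R X Y))).2 + Fin.ofNat 3 j)) :
    X' % 3 = (X + i) % 3 ∧ Y' % 3 = (Y + j) % 3 := by
  obtain ⟨a, b, hab⟩ := exists_coords_tableNode (h := h) R
  rw [hab _ _ hX' hY', hab _ _ hX hY] at he
  have h1 := congrArg Fin.val (Prod.ext_iff.mp he).1
  have h2 := congrArg Fin.val (Prod.ext_iff.mp he).2
  simp only [mod3, Fin.ofNat, Fin.val_add] at h1 h2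
  omega

/-- Three residues are enough to tell a step from its reverse, so the labels single out one of the
at most four lateral neighbours. -/
theorem east_iff {R : V} (hR : h.forest.IsRoot R) {X Y : ℕ} (hX : X < h.side R)
    (hY : Y < h.side R) {w : V} : East G.Adj x (h.tableNode R X Y) w ↔
      X + 1 < h.side R ∧ w = h.tableNode R (X + 1) Y := by
  constructor
  · rintro ⟨h1, h2⟩
    obtain ⟨X', Y', hX', hY', rfl, hc⟩ := lateral_tableNode hR hX hY h1
    have := coords_tableNode_eq (i := 1) (j := 0) hX hY hX' hY'
      (h2.trans (by rw [show Fin.ofNat 3 0 = 0 from rfl, add_zero]; rfl))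
    have : X' = X + 1 ∧ Y' = Y := by omega
    rw [this.1, this.2]
    exact ⟨by omega, rfl⟩
  · rintro ⟨h1, rfl⟩
    exact adj_tableNode_east h1 hY

theorem south_iff {R : V} (hR : h.forest.IsRoot R) {X Y : ℕ} (hX : X < h.side R)
    (hY : Y < h.side R) {w : V} : South G.Adj x (h.tableNode R X Y) w ↔
      Y + 1 < h.side R ∧ w = h.tableNode R X (Y + 1) := by
  constructor
  · rintro ⟨h1, h2⟩
    obtain ⟨X', Y', hX', hY', rfl, hc⟩ := lateral_tableNode hR hX hY h1
    have := coords_tableNode_eq (i := 0) (j := 1) hX hY hX' hY'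
      (h2.trans (by rw [show Fin.ofNat 3 0 = 0 from rfl, add_zero]; rfl))
    have : X' = X ∧ Y' = Y + 1 := by omega
    rw [this.1, this.2]
    exact ⟨by omega, rfl⟩
  · rintro ⟨h1, rfl⟩
    exact adj_tableNode_south hX h1

theorem noEast_iff {R : V} (hR : h.forest.IsRoot R) {X Y : ℕ} (hX : X < h.side R)
    (hY : Y < h.side R) : NoEast G.Adj x (h.tableNode R X Y) ↔ X + 1 = h.side R := by
  constructor
  · intro h1
    by_contra hne
    have := adj_tableNode_east (h := h) (R := R) (X := X) (by omega) hY
    exact h1 _ this.1.1 this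
  · rintro h1 w _ hw
    have := ((east_iff hR hX hY).mp hw).1
    omega

theorem noSouth_iff {R : V} (hR : h.forest.IsRoot R) {X Y : ℕ} (hX : X < h.side R)
    (hY : Y < h.side R) : NoSouth G.Adj x (h.tableNode R X Y) ↔ Y + 1 = h.side R := by
  constructor
  · intro h1
    by_contra hne
    have := adj_tableNode_south (h := h) (R := R) (Y := Y) hX (by omega)
    exact h1 _ this.1.1 this
  · rintro h1 w _ hw
    have := ((south_iff hR hX hY).mp hw).1
    omega

theorem noWest_iff {R : V} (hR : h.forest.IsRoot R) {X Y : ℕ} (hX : X < h.side R)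
    (hY : Y < h.side R) : NoWest G.Adj x (h.tableNode R X Y) ↔ X = 0 := by
  constructor
  · intro h1
    by_contra hne
    have := adj_tableNode_east (h := h) (R := R) (X := X - 1) (by omega) hY
    rw [Nat.sub_add_cancel (by omega)] at this
    exact h1 _ this.1.1.symm this
  · rintro rfl w _ hw
    obtain ⟨X', Y', hX', hY', rfl, hc⟩ := lateral_tableNode hR hX hY (hw.1.symm adj_symm)
    obtain ⟨_, he⟩ := (east_iff hR hX' hY').mp hw
    have := tableNode_injective hR hR hX hY (by omega) hY' he
    omega

theorem noNorth_iff {R : V} (hR : h.forest.IsRoot R) {X Y : ℕ} (hX : X < h.side R)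
    (hY : Y < h.side R) : NoNorth G.Adj x (h.tableNode R X Y) ↔ Y = 0 := by
  constructor
  · intro h1
    by_contra hne
    have := adj_tableNode_south (h := h) (R := R) (Y := Y - 1) hX (by omega)
    rw [Nat.sub_add_cancel (by omega)] at this
    exact h1 _ this.1.1.symm this
  · rintro rfl w _ hw
    obtain ⟨X', Y', hX', hY', rfl, hc⟩ := lateral_tableNode hR hX hY (hw.1.symm adj_symm)
    obtain ⟨_, he⟩ := (south_iff hR hX' hY').mp hw
    have := tableNode_injective hR hR hX hY hX' (by omega) he
    omega

end Accepted

end LocalDecision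

namespace LocalDecision

namespace Accepted

variable {V : Type} {G : SimpleGraph V} {x : V → Label}

/-! ### Foreign edges -/

theorem param_eq (h : Accepted G x) (u v : V) : (x u).1 = (x v).1 := by
  obtain ⟨p⟩ := h.connected u v
  induction p with
  | nil => rfl
  | cons hadj _ ih => exact (h.locallyConsistent.same_param _ _ hadj).trans ih

theorem foreign_unique {v p q : V} (hv : Attached G.Adj x v) (hp : Foreign G.Adj x v p)
    (hq : Foreign G.Adj x v q) : p = q := by
  obtain ⟨o, _, _, ho⟩ := hv
  exact (ho p hp.1 hp).trans (ho q hq.1 hq).symm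

/-- The other end of a foreign edge at an unattached node is attached; through `isPivot_of_foreign`,
foreign edges occur only at pivots and at nodes attached to them. -/
theorem attached_of_foreign (h : Accepted G x) {v w : V} (hv : ¬ Attached G.Adj x v)
    (hf : Foreign G.Adj x v w) : Attached G.Adj x w :=
  (h.locallyConsistent.foreign_attached w v hf.1.symm (hf.symm adj_symm)).2 hv

theorem not_attached_of_foreign (h : Accepted G x) {v w : V} (hv : Attached G.Adj x v)
    (hf : Foreign G.Adj x v w) : ¬ Attached G.Adj x w :=
  (h.locallyConsistent.foreign_attached v w hf.1 hf).1 hv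

theorem isPivot_of_foreign (h : Accepted G x) {v w : V} (hv : ¬ Attached G.Adj x v)
    (hf : Foreign G.Adj x v w) : IsPivot G.Adj x v :=
  ⟨h.foreign_base hf, hv, h.locallyConsistent.pivot_corner v w hf.1 hv hf⟩

theorem isPivot_or_isPivot (h : Accepted G x) {u w : V} (hf : Foreign G.Adj x u w) :
    IsPivot G.Adj x u ∨ IsPivot G.Adj x w := by
  by_cases hu : Attached G.Adj x u
  · exact .inr (h.isPivot_of_foreign (h.not_attached_of_foreign hu hf) (hf.symm adj_symm))
  · exact .inl (h.isPivot_of_foreign hu hf)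

section

variable {p : V} {ρ : V → BorderCode → Prop} {f : FragmentCode} {X Y : ℕ}

/-- Both nodes have foreign edges, hence cell labels, so neither is a parent; both are attached, so
the edge between them is not foreign. Only a lateral edge remains. -/
theorem lateral_of_matching (hp : ¬ Attached G.Adj x p) (hρ : IsMatching G.Adj x p ρ)
    (h : Accepted G x) {w w' : V} {c c' : BorderCode} (hw : ρ w c) (hw' : ρ w' c')
    (hc : c.Adj c') : Lateral G.Adj x w w' := by
  have h1 := hρ.foreign _ _ hw
  have h2 := hρ.foreign _ _ hw'
  rcases adj_cases (L := x) (hρ.adj _ _ _ _ hw hw' hc) with h3 | h3 | h3 | h3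
  · exact absurd h3.up (h.foreign_base (h2.symm adj_symm))
  · exact absurd h3.up (h.foreign_base (h1.symm adj_symm))
  · exact h3
  · exact absurd (h.attached_of_foreign hp h2)
      (h.not_attached_of_foreign (h.attached_of_foreign hp h1) h3)

theorem coords_of_matching (hρ : IsMatching G.Adj x p ρ) {w : V} {c : BorderCode} (hw : ρ w c) :
    coords (x w) = (c.1.cell c.2.1 c.2.2).1 := by
  rw [coords, cellOf, (hρ.node _ _ hw).label]
  rfl

theorem exists_of_mem_borderList (hρ : IsMatching G.Adj x p ρ) (hc : (f, (X, Y)) ∈ borderList (x p).1) :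
    f.Valid (x p).1.1 (2 ^ (3 * (x p).1.2)) ∧ X < 2 ^ (3 * (x p).1.2) ∧
      Y < 2 ^ (3 * (x p).1.2) ∧ ∃ w, ρ w (f, (X, Y)) := by
  obtain ⟨h1, h2, h3, _⟩ := mem_borderList.mp hc
  exact ⟨h1, h2, h3, hρ.total _ hc⟩

end

variable [Finite V] {h : Accepted G x}

theorem isPivot_tableNode {R : V} (hR : h.forest.IsRoot R)
    (hna : ¬ Attached G.Adj x (h.tableNode R 0 0)) : IsPivot G.Adj x (h.tableNode R 0 0) :=
  ⟨base_tableNode, hna, (noNorth_iff hR side_pos side_pos).mpr rfl,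
    (noWest_iff hR side_pos side_pos).mpr rfl⟩

theorem exists_eq_of_isPivot {v : V} (hv : IsPivot G.Adj x v) :
    ∃ R, h.forest.IsRoot R ∧ v = h.tableNode R 0 0 := by
  obtain ⟨R, hR, X, hX, Y, hY, rfl⟩ := exists_eq_tableNode (h := h) hv.1
  obtain rfl := (noNorth_iff hR hX hY).mp hv.2.2.1
  obtain rfl := (noWest_iff hR hX hY).mp hv.2.2.2
  exact ⟨R, hR, rfl⟩

/-! ### The fragment that is matched with a table -/

section Matching

variable {p : V} {ρ : V → BorderCode → Prop}

theorem _root_.LocalDecision.FragmentCode.Valid.exists_coords {M : Machine} {n : ℕ}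
    {f : FragmentCode} (hf : f.Valid M n) :
    ∃ a b, ∀ X < n, ∀ Y < n, (f.cell X Y).1 = mod3 (a + X) (b + Y) := by
  obtain ⟨a, b, hab⟩ := hf.consistent.orientation
  exact ⟨a, b, fun X hX Y hY => hab ⟨X, hX⟩ ⟨Y, hY⟩⟩

theorem eastOf_mod3 (a b : ℕ) : mod3 (a + 1) b = ((mod3 a b).1 + 1, (mod3 a b).2) := by
  rw [mod3_eq, mod3_eq]
  refine Prod.ext ?_ rfl
  change ((a + 1 : ℕ) : ZMod 3) = (a : ZMod 3) + 1
  push_cast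
  ring

theorem southOf_mod3 (a b : ℕ) : mod3 a (b + 1) = ((mod3 a b).1, (mod3 a b).2 + 1) := by
  rw [mod3_eq, mod3_eq]
  refine Prod.ext rfl ?_
  change ((b + 1 : ℕ) : ZMod 3) = (b : ZMod 3) + 1
  push_cast
  ring

variable {f : FragmentCode} {R : V} {X Y : ℕ}

theorem east_of_matching (hp : ¬ Attached G.Adj x p) (hρ : IsMatching G.Adj x p ρ)
    (h : Accepted G x) {w w' : V} (hw : ρ w (f, (X, Y))) (hw' : ρ w' (f, (X + 1, Y))) :
    East G.Adj x w w' := by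
  refine ⟨lateral_of_matching hp hρ h hw hw' ⟨rfl, .inl ⟨rfl, rfl⟩⟩, ?_⟩
  obtain ⟨hf, hX, hY, _⟩ := exists_of_mem_borderList hρ (hρ.mem _ _ hw')
  obtain ⟨a, b, hab⟩ := hf.exists_coords
  rw [LabelRel.EastOf, coords_of_matching hρ hw, coords_of_matching hρ hw',
    hab _ hX _ hY, hab _ (by omega : X < _) _ hY, ← add_assoc, eastOf_mod3]

theorem south_of_matching (hp : ¬ Attached G.Adj x p) (hρ : IsMatching G.Adj x p ρ)
    (h : Accepted G x) {w w' : V} (hw : ρ w (f, (X, Y))) (hw' : ρ w' (f, (X, Y + 1))) :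
    South G.Adj x w w' := by
  refine ⟨lateral_of_matching hp hρ h hw hw' ⟨rfl, .inr ⟨rfl, rfl⟩⟩, ?_⟩
  obtain ⟨hf, hX, hY, _⟩ := exists_of_mem_borderList hρ (hρ.mem _ _ hw')
  obtain ⟨a, b, hab⟩ := hf.exists_coords
  rw [LabelRel.SouthOf, coords_of_matching hρ hw, coords_of_matching hρ hw',
    hab _ hX _ hY, hab _ hX _ (by omega : Y < _), ← add_assoc, southOf_mod3]

theorem matching_east (hp : ¬ Attached G.Adj x p) (hρ : IsMatching G.Adj x p ρ)
    (hR : h.forest.IsRoot R) (hX : X < h.side R) (hY : Y < h.side R)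
    (hw : ρ (h.tableNode R X Y) (f, (X, Y))) (hc : (f, (X + 1, Y)) ∈ borderList (x p).1) :
    X + 1 < h.side R ∧ ρ (h.tableNode R (X + 1) Y) (f, (X + 1, Y)) := by
  obtain ⟨_, _, _, w', hw'⟩ := exists_of_mem_borderList hρ hc
  obtain ⟨h1, rfl⟩ := (east_iff hR hX hY).mp (east_of_matching hp hρ h hw hw')
  exact ⟨h1, hw'⟩

theorem matching_south (hp : ¬ Attached G.Adj x p) (hρ : IsMatching G.Adj x p ρ)
    (hR : h.forest.IsRoot R) (hX : X < h.side R) (hY : Y < h.side R)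
    (hw : ρ (h.tableNode R X Y) (f, (X, Y))) (hc : (f, (X, Y + 1)) ∈ borderList (x p).1) :
    Y + 1 < h.side R ∧ ρ (h.tableNode R X (Y + 1)) (f, (X, Y + 1)) := by
  obtain ⟨_, _, _, w', hw'⟩ := exists_of_mem_borderList hρ hc
  obtain ⟨h1, rfl⟩ := (south_iff hR hX hY).mp (south_of_matching hp hρ h hw hw')
  exact ⟨h1, hw'⟩

theorem matching_west (hp : ¬ Attached G.Adj x p) (hρ : IsMatching G.Adj x p ρ)
    (hR : h.forest.IsRoot R) (hX : X + 1 < h.side R) (hY : Y < h.side R)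
    (hw : ρ (h.tableNode R (X + 1) Y) (f, (X + 1, Y))) (hc : (f, (X, Y)) ∈ borderList (x p).1) :
    ρ (h.tableNode R X Y) (f, (X, Y)) := by
  obtain ⟨_, _, _, w', hw'⟩ := exists_of_mem_borderList hρ hc
  have he := east_of_matching hp hρ h hw' hw
  obtain ⟨X', Y', hX', hY', rfl, _⟩ := lateral_tableNode hR hX hY (he.1.symm adj_symm)
  obtain ⟨_, h2⟩ := (east_iff hR hX' hY').mp he
  obtain ⟨_, h3, h4⟩ := tableNode_injective hR hR hX hY (by omega) hY' h2
  obtain rfl : X' = X := by omega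
  obtain rfl : Y' = Y := by omega
  exact hw'

/-- This is what the two copies of ambiguous fragments are for: a non-natural bottom is always
joined to the top by a non-natural side. -/
theorem _root_.LocalDecision.FragmentCode.Valid.left_or_right {M : Machine} {n : ℕ}
    (hf : f.Valid M n) (hb : f.2.2.2 = true) : f.2.1 = true ∨ f.2.2.1 = true := by
  have hb' : Border.bottom ∈ f.borders := hb
  change Border.left ∈ f.borders ∨ Border.right ∈ f.borders
  have := borderChoice_iff.mp hf.borderChoice
  tauto

/-- All non-natural border positions of a fragment are matched with the nodes in the same columns
and rows of a single table. -/
theorem exists_matching_table (hp : ¬ Attached G.Adj x p) (hρ : IsMatching G.Adj x p ρ)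
    (h : Accepted G x) (hf : f.Valid (x p).1.1 (2 ^ (3 * (x p).1.2))) :
    ∃ R, h.forest.IsRoot R ∧ h.side R = 2 ^ (3 * (x p).1.2) ∧ ∀ X Y,
      BorderCode.OnBorder (2 ^ (3 * (x p).1.2)) (f, (X, Y)) →
        ρ (h.tableNode R X Y) (f, (X, Y)) := by
  obtain ⟨n, hn⟩ : ∃ n, n = 2 ^ (3 * (x p).1.2) := ⟨_, rfl⟩
  have hn0 : 0 < n := hn ▸ by positivity
  have hmem {X Y : ℕ} (hXY : BorderCode.OnBorder n (f, (X, Y))) :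
      (f, (X, Y)) ∈ borderList (x p).1 := mem_borderList.mpr ⟨hf, hn ▸ hXY⟩
  rw [← hn] at hf ⊢
  -- The top left position is on the border of every fragment, and the borders recorded in
  -- `MatchesNode` force its partner to be the corner of a table. From there the matching is
  -- followed along the border.
  obtain ⟨w, hw⟩ := hρ.total _ (hmem (X := 0) (Y := 0) ⟨hn0, hn0, .inl rfl⟩)
  obtain ⟨R, hR, X, hX, Y, hY, rfl⟩ :=
    exists_eq_tableNode (h := h) (h.foreign_base ((hρ.foreign _ _ hw).symm adj_symm))
  obtain rfl := (noNorth_iff hR hX hY).mp ((hρ.node _ _ hw).north.mpr rfl)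
  obtain rfl := (noWest_iff hR hX hY).mp ((hρ.node _ _ hw).west.mpr rfl)
  have top : ∀ X < n, X < h.side R ∧ ρ (h.tableNode R X 0) (f, (X, 0)) := by
    intro X
    induction X with
    | zero => exact fun _ => ⟨hX, hw⟩
    | succ X ih =>
      intro hX1
      obtain ⟨h1, h2⟩ := ih (by omega)
      exact matching_east hp hρ hR h1 hY h2 (hmem ⟨hX1, hn0, .inl rfl⟩)
  -- The partner of the last top position has no east neighbour, which fixes the side of the table.
  have hside : h.side R = n := by
    obtain ⟨h1, h2⟩ := top (n - 1) (by omega)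
    have h3 := (noEast_iff hR h1 hY).mp ((hρ.node _ _ h2).east.mpr
      (by rw [← hn]; exact Nat.sub_add_cancel hn0))
    omega
  have down {X : ℕ} (hX : X < n) (hb : ∀ Y < n, BorderCode.OnBorder n (f, (X, Y))) :
      ∀ Y < n, ρ (h.tableNode R X Y) (f, (X, Y)) := by
    intro Y
    induction Y with
    | zero => exact fun _ => (top X hX).2
    | succ Y ih =>
      intro hY1
      exact (matching_south hp hρ hR (hside ▸ hX) (by omega) (ih (by omega))
        (hmem (hb _ hY1))).2
  have left (hl : f.2.1 = true) := down hn0 fun Y hY => ⟨hn0, hY, .inr (.inl ⟨hl, rfl⟩)⟩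
  have right (hl : f.2.2.1 = true) := down (X := n - 1) (by omega) fun Y hY =>
    ⟨by simp only; omega, hY, .inr (.inr (.inl ⟨hl, Nat.sub_add_cancel hn0⟩))⟩
  refine ⟨R, hR, hside, ?_⟩
  rintro X Y ⟨hX1, hY1, hb⟩
  simp only at hX1 hY1 hb
  rcases hb with rfl | ⟨hl, rfl⟩ | ⟨hr, hXn⟩ | ⟨hb, hYn⟩
  · exact (top X hX1).2
  · exact left hl Y hY1
  · obtain rfl : X = n - 1 := by omega
    exact right hr Y hY1
  · have hbd {X : ℕ} (hX : X < n) : (f, (X, Y)) ∈ borderList (x p).1 :=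
      hmem ⟨hX, hY1, .inr (.inr (.inr ⟨hb, hYn⟩))⟩
    -- The bottom row is entered from whichever side is non-natural and followed eastwards or
    -- westwards.
    rcases hf.left_or_right hb with hl | hr
    · have : ∀ X < n, ρ (h.tableNode R X Y) (f, (X, Y)) := by
        intro X
        induction X with
        | zero => exact fun _ => left hl Y hY1
        | succ X ih =>
          intro hX1
          exact (matching_east hp hρ hR (by omega) (by omega) (ih (by omega)) (hbd hX1)).2
      exact this X hX1
    · have : ∀ k < n, ρ (h.tableNode R (n - 1 - k) Y) (f, (n - 1 - k, Y)) := by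
        intro k
        induction k with
        | zero => exact fun _ => right hr Y hY1
        | succ k ih =>
          intro hk
          have h1 := ih (by omega)
          rw [show n - 1 - k = n - 1 - (k + 1) + 1 by omega] at h1
          exact matching_west hp hρ hR (by omega) (by omega) h1 (hbd (by omega))
      have h1 := this (n - 1 - X) (by omega)
      rwa [show n - 1 - (n - 1 - X) = X by omega] at h1

end Matching

end Accepted

end LocalDecision

/-! ### Pivot table and fragment tables exhaust the graph -/

namespace LocalDecision

namespace QuadForest

variable {V : Type} [Finite V] {Q : QuadForest V}

/-- The node `v` belongs to the pyramid with the root `R`. -/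
def InPyramid (Q : QuadForest V) (R v : V) : Prop :=
  ∃ d ≤ Q.ht R, ∃ X < 2 ^ d, ∃ Y < 2 ^ d, v = Q.node R d X Y

theorem InPyramid.step {R u w : V} (hR : Q.IsRoot R) (hu : Q.InPyramid R u)
    (huw : Q.Par u w ∨ Q.Par w u ∨ Q.Lat u w) : Q.InPyramid R w := by
  obtain ⟨d, hd, X, hX, Y, hY, rfl⟩ := hu
  rcases huw with hp | hp | hl
  · rcases d with _ | d
    · exact absurd hp (hR w)
    · rw [pow_succ] at hX hY
      exact ⟨d, by omega, X / 2, by omega, Y / 2, by omega, Q.par_unique hp (par_node hd)⟩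
  · have hlt : d < Q.ht R := by
      have := ht_par hp
      rw [ht_node hd] at this
      omega
    obtain ⟨X', Y', rfl, rfl, rfl⟩ := eq_node_of_par hlt hp
    exact ⟨d + 1, hlt, X', by rw [pow_succ]; omega, Y', by rw [pow_succ]; omega, rfl⟩
  · obtain ⟨X', Y', hX', hY', rfl, _⟩ := lat_node hR hd hX hY hl
    exact ⟨d, hd, X', hX', Y', hY', rfl⟩

theorem InPyramid.eq {R R' v : V} (hR : Q.IsRoot R) (hR' : Q.IsRoot R') (h : Q.InPyramid R v)
    (h' : Q.InPyramid R' v) : R = R' := by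
  obtain ⟨d, hd, X, hX, Y, hY, rfl⟩ := h
  obtain ⟨d', hd', X', hX', Y', hY', he⟩ := h'
  exact (node_injective hR hR' hd hd' hX hY hX' hY' he).1

theorem inPyramid_self (R : V) : Q.InPyramid R R :=
  ⟨0, Nat.zero_le _, 0, by simp, 0, by simp, rfl⟩

end QuadForest

theorem BorderCode.onBorder_zero (n : ℕ) (hn : 0 < n) (f : FragmentCode) :
    BorderCode.OnBorder n (f, (0, 0)) := ⟨hn, hn, .inl rfl⟩

theorem connected_induction {V : Type} {G : SimpleGraph V} (hG : G.Connected) {P : V → Prop}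
    {u : V} (hu : P u) (hs : ∀ v w, G.Adj v w → P v → P w) (v : V) : P v := by
  obtain ⟨p⟩ := hG u v
  induction p with
  | nil => exact hu
  | cons hadj _ ih => exact ih (hs _ _ hadj hu)

namespace Accepted

variable {V : Type} {G : SimpleGraph V} {x : V → Label}

open Classical in
/-- A matching of the nodes that are attached to `p`. -/
noncomputable def matching (h : Accepted G x) (p : V) : V → BorderCode → Prop :=
  if hp : IsPivot G.Adj x p then ((h.check p).2 hp).choose else fun _ _ => False

theorem isMatching (h : Accepted G x) {p : V} (hp : IsPivot G.Adj x p) :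
    IsMatching G.Adj x p (h.matching p) := by
  rw [matching, dif_pos hp]
  exact ((h.check p).2 hp).choose_spec

variable [Finite V]

theorem inPyramid_tableNode {h : Accepted G x} {R : V} {X Y : ℕ} (hX : X < h.side R)
    (hY : Y < h.side R) : h.forest.InPyramid R (h.tableNode R X Y) :=
  ⟨_, le_rfl, X, hX, Y, hY, rfl⟩

/-- The table at the base of the pyramid with the root `R` is matched by the pivot `p` with the
fragment `f`. -/
structure IsFragmentTable (h : Accepted G x) (p R : V) (f : FragmentCode) : Prop where
  pivot : IsPivot G.Adj x p
  root : h.forest.IsRoot R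
  valid : f.Valid (x p).1.1 (2 ^ (3 * (x p).1.2))
  side_eq : h.side R = 2 ^ (3 * (x p).1.2)
  matching : ∀ X Y, BorderCode.OnBorder (2 ^ (3 * (x p).1.2)) (f, (X, Y)) →
    h.matching p (h.tableNode R X Y) (f, (X, Y))

variable {h : Accepted G x}

theorem exists_isFragmentTable {p : V} (hp : IsPivot G.Adj x p) {f : FragmentCode}
    (hf : f.Valid (x p).1.1 (2 ^ (3 * (x p).1.2))) : ∃ R, h.IsFragmentTable p R f := by
  obtain ⟨R, h1, h2, h3⟩ := exists_matching_table hp.2.1 (h.isMatching hp) h hf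
  exact ⟨R, hp, h1, hf, h2, h3⟩

/-- The foreign edge leads to a pivot, whose matching covers the node by some border position. As
the matching is one to one and the border of that fragment lies in a single table, this is the table
at hand. -/
theorem exists_of_attached {R : V} (hR : h.forest.IsRoot R) {X Y : ℕ} (hX : X < h.side R)
    (hY : Y < h.side R) (ha : Attached G.Adj x (h.tableNode R X Y)) :
    ∃ p f, h.IsFragmentTable p R f ∧ BorderCode.OnBorder (2 ^ (3 * (x p).1.2)) (f, (X, Y)) := by
  obtain ⟨p, _, hf, _⟩ := id ha
  have hp := h.isPivot_of_foreign (h.not_attached_of_foreign ha hf) (hf.symm adj_symm)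
  have hm := h.isMatching hp
  obtain ⟨⟨f, X', Y'⟩, hc⟩ := hm.cover _ (hf.symm adj_symm)
  obtain ⟨hv, hb⟩ := mem_borderList.mp (hm.mem _ _ hc)
  obtain ⟨R', hT⟩ := exists_isFragmentTable (h := h) hp hv
  have he := (hm.bij _ _ _ _ hc (hT.matching _ _ hb)).mpr rfl
  obtain ⟨rfl, rfl, rfl⟩ := tableNode_injective hR hT.root hX hY (hT.side_eq ▸ hb.1)
    (hT.side_eq ▸ hb.2.1) he
  exact ⟨p, f, hT, hb⟩

namespace IsFragmentTable

variable {p R : V} {f : FragmentCode}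

variable {X Y : ℕ}

theorem foreign (hT : h.IsFragmentTable p R f)
    (hb : BorderCode.OnBorder (2 ^ (3 * (x p).1.2)) (f, (X, Y))) :
    Foreign G.Adj x p (h.tableNode R X Y) :=
  (h.isMatching hT.pivot).foreign _ _ (hT.matching _ _ hb)

theorem attached (hT : h.IsFragmentTable p R f)
    (hb : BorderCode.OnBorder (2 ^ (3 * (x p).1.2)) (f, (X, Y))) :
    Attached G.Adj x (h.tableNode R X Y) :=
  h.attached_of_foreign hT.pivot.2.1 (hT.foreign hb)

/-- The corner lies on the border of every fragment and has only one foreign edge, so it determines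
the pivot, and then the matching determines the fragment. -/
theorem unique (hT : h.IsFragmentTable p R f) {p' : V} {f' : FragmentCode}
    (hT' : h.IsFragmentTable p' R f') : p = p' ∧ f = f' := by
  have hb := BorderCode.onBorder_zero (2 ^ (3 * (x p).1.2)) (by positivity) f
  have hb' := BorderCode.onBorder_zero (2 ^ (3 * (x p').1.2)) (by positivity) f'
  obtain rfl := foreign_unique (hT.attached hb) ((hT.foreign hb).symm adj_symm)
    ((hT'.foreign hb').symm adj_symm)
  exact ⟨rfl, (Prod.ext_iff.mp (((h.isMatching hT.pivot).bij _ _ _ _ (hT.matching _ _ hb)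
    (hT'.matching _ _ hb')).mp rfl)).1⟩

theorem root_unique (hT : h.IsFragmentTable p R f) {R' : V} (hT' : h.IsFragmentTable p R' f) :
    R = R' := by
  have hb := BorderCode.onBorder_zero (2 ^ (3 * (x p).1.2)) (by positivity) f
  have he := ((h.isMatching hT.pivot).bij _ _ _ _ (hT.matching _ _ hb)
    (hT'.matching _ _ hb)).mpr rfl
  exact (tableNode_injective hT.root hT'.root side_pos side_pos side_pos side_pos he).1

theorem onBorder (hT : h.IsFragmentTable p R f) (hX : X < h.side R) (hY : Y < h.side R)
    (ha : Attached G.Adj x (h.tableNode R X Y)) :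
    BorderCode.OnBorder (2 ^ (3 * (x p).1.2)) (f, (X, Y)) := by
  obtain ⟨p', f', hT', hb⟩ := exists_of_attached hT.root hX hY ha
  obtain ⟨rfl, rfl⟩ := hT.unique hT'
  exact hb

theorem label (hT : h.IsFragmentTable p R f)
    (hb : BorderCode.OnBorder (2 ^ (3 * (x p).1.2)) (f, (X, Y))) :
    cellOf (x (h.tableNode R X Y)) = f.cell X Y := by
  rw [cellOf, ((h.isMatching hT.pivot).node _ _ (hT.matching _ _ hb)).label]
  rfl

end IsFragmentTable

/-- One attached node would make the whole table a fragment table, whose corner is attached, unlike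
a pivot. -/
theorem not_attached_of_pivot {R : V} (hR : h.forest.IsRoot R)
    (hp : IsPivot G.Adj x (h.tableNode R 0 0)) {X Y : ℕ} (hX : X < h.side R) (hY : Y < h.side R) :
    ¬ Attached G.Adj x (h.tableNode R X Y) := by
  intro ha
  obtain ⟨p, f, hT, _⟩ := exists_of_attached hR hX hY ha
  exact hp.2.1 (hT.attached (BorderCode.onBorder_zero _ (by positivity) f))

/-- In an arbitrary pyramid the corner of the table is either a pivot itself or attached to one. -/
theorem exists_root_pivot (h : Accepted G x) :
    ∃ R, h.forest.IsRoot R ∧ IsPivot G.Adj x (h.tableNode R 0 0) := by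
  obtain ⟨v⟩ := h.connected.nonempty
  obtain ⟨R, hR, _⟩ := h.forest.exists_eq_node v
  by_cases ha : Attached G.Adj x (h.tableNode R 0 0)
  · obtain ⟨p, f, hT, _⟩ := exists_of_attached hR side_pos side_pos ha
    obtain ⟨R', hR', rfl⟩ := exists_eq_of_isPivot (h := h) hT.pivot
    exact ⟨R', hR', hT.pivot⟩
  · exact ⟨R, hR, isPivot_tableNode hR ha⟩

/-- All pyramids apart from the one of the pivot belong to fragments. -/
theorem eq_or_isFragmentTable {R : V} (hR : h.forest.IsRoot R)
    (hp : IsPivot G.Adj x (h.tableNode R 0 0)) {R' : V} (hR' : h.forest.IsRoot R') :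
    R' = R ∨ ∃ f, h.IsFragmentTable (h.tableNode R 0 0) R' f := by
  -- The claim is spread along the edges of the connected graph. Only a foreign edge can leave a
  -- pyramid; it goes from the pivot to one of its fragments or back.
  have key : ∀ v, ∃ R', h.forest.IsRoot R' ∧ h.forest.InPyramid R' v ∧
      (R' = R ∨ ∃ f, h.IsFragmentTable (h.tableNode R 0 0) R' f) := by
    refine connected_induction h.connected
      ⟨R, hR, QuadForest.inPyramid_self R, .inl rfl⟩ ?_
    rintro u w huw ⟨R', hR', hu, hG⟩
    rcases adj_cases (L := x) huw with hp' | hp' | hl | hf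
    · exact ⟨R', hR', hu.step hR' (.inl hp'), hG⟩
    · exact ⟨R', hR', hu.step hR' (.inr (.inl hp')), hG⟩
    · exact ⟨R', hR', hu.step hR' (.inr (.inr hl)), hG⟩
    obtain ⟨R1, hR1, X, hX, Y, hY, rfl⟩ := exists_eq_tableNode (h := h) (h.foreign_base hf)
    obtain rfl := (inPyramid_tableNode hX hY).eq hR1 hR' hu
    have hfs := hf.symm adj_symm
    obtain ⟨R2, hR2, X', hX', Y', hY', rfl⟩ := exists_eq_tableNode (h := h) (h.foreign_base hfs)
    rcases hG with rfl | ⟨f, hT⟩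
    · have hna := not_attached_of_pivot hR hp hX hY
      have hup := h.isPivot_of_foreign hna hf
      obtain rfl := (noNorth_iff hR1 hX hY).mp hup.2.2.1
      obtain rfl := (noWest_iff hR1 hX hY).mp hup.2.2.2
      have hwa := h.attached_of_foreign hna hf
      obtain ⟨p', f, hT, hb⟩ := exists_of_attached hR2 hX' hY' hwa
      obtain rfl := foreign_unique hwa ((hT.foreign hb).symm adj_symm) hfs
      exact ⟨R2, hR2, inPyramid_tableNode hX' hY', .inr ⟨f, hT⟩⟩
    · by_cases hua : Attached G.Adj x (h.tableNode R1 X Y)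
      · have hb := hT.onBorder hX hY hua
        have he := foreign_unique hua hf ((hT.foreign hb).symm adj_symm)
        obtain ⟨rfl, _⟩ := tableNode_injective hR2 hR hX' hY' side_pos side_pos he
        exact ⟨R2, hR2, inPyramid_tableNode hX' hY', .inl rfl⟩
      -- An unattached node with a foreign edge would be the corner of its table, but the corner of
      -- a fragment table is attached.
      · have hup := h.isPivot_of_foreign hua hf
        obtain rfl := (noNorth_iff hR1 hX hY).mp hup.2.2.1
        obtain rfl := (noWest_iff hR1 hX hY).mp hup.2.2.2
        exact absurd (hT.attached (BorderCode.onBorder_zero _ (by positivity) f)) hua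
  obtain ⟨R'', h1, h2, h3⟩ := key R'
  obtain rfl := h2.eq h1 hR' (QuadForest.inPyramid_self R')
  exact h3

end Accepted

end LocalDecision

namespace LocalDecision

/-! ## Contents of the tables -/

/-- The contents of the cell in column `X` in the configuration `C`. -/
def Config.cellContent (C : Config) (X : ℕ) : Content :=
  (C.tape X, if C.pos = X then some (C.state, C.arrived) else none)

theorem arrival_cellContent (C : Config) (X : ℕ) (m : Move) :
    arrival m (C.cellContent X) = if C.pos = X ∧ C.arrived = m then some C.state else none := by
  unfold arrival Config.cellContent
  by_cases h1 : C.pos = X <;> simp [h1]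

theorem action_cellContent {M : Machine} {C : Config} {a : ℕ × ℕ × Move}
    (ht : transition M C.state (C.tape C.pos) = some a) (X : ℕ) :
    action M (C.cellContent X) = if C.pos = X then some a else none := by
  unfold action Config.cellContent
  by_cases h1 : C.pos = X
  · subst h1; simp [ht]
  · simp [h1]

theorem emission_cellContent {M : Machine} {C : Config} {q b : ℕ} {m : Move}
    (ht : transition M C.state (C.tape C.pos) = some (q, b, m)) (X : ℕ) (m' : Move) :
    emission M m' (C.cellContent X) = if C.pos = X ∧ m = m' then some q else none := by
  rw [emission, action_cellContent ht]
  by_cases h1 : C.pos = X <;> simp [h1]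

theorem written_cellContent {M : Machine} {C : Config} {q b : ℕ} {m : Move}
    (ht : transition M C.state (C.tape C.pos) = some (q, b, m)) (X : ℕ) :
    written M (C.cellContent X) = Function.update C.tape C.pos b X := by
  rw [written, action_cellContent ht]
  by_cases h1 : C.pos = X
  · subst h1; simp
  · simp [h1, Function.update_of_ne (Ne.symm h1), Config.cellContent]

theorem isHalted_cellContent {M : Machine} {C : Config} {X : ℕ} :
    IsHalted M (C.cellContent X) ↔ C.pos = X ∧ transition M C.state (C.tape C.pos) = none := by
  unfold IsHalted action Config.cellContent
  by_cases h1 : C.pos = X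
  · subst h1; simp
  · simp [h1]

theorem tableCell_eq {M : Machine} {Y : ℕ} {C : Config} (hC : configAt M Y = some C) (X : ℕ) :
    tableCell M X Y = (mod3 X Y, C.cellContent X) := by
  unfold tableCell
  rw [hC]
  rfl

theorem mod3_add {a b a' b' : ℕ} (he : mod3 a b = mod3 a' b') (X Y : ℕ) :
    mod3 (a + X) (b + Y) = mod3 (a' + X) (b' + Y) := by
  have h1 := congrArg Fin.val (Prod.ext_iff.mp he).1
  have h2 := congrArg Fin.val (Prod.ext_iff.mp he).2
  simp only [mod3, Fin.ofNat] at h1 h2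
  refine Prod.ext (Fin.ext ?_) (Fin.ext ?_)
  · change (a + X) % 3 = (a' + X) % 3
    omega
  · change (b + Y) % 3 = (b' + Y) % 3
    omega

theorem label_eq_some {l : Label} (hl : l.2 ≠ none) : l.2 = some (coords l, content l) := by
  obtain ⟨a, _ | c⟩ := l
  · exact absurd rfl hl
  · rfl

theorem FragmentCode.Valid.natural_left {M : Machine} {n : ℕ} {f : FragmentCode}
    (hf : f.Valid M n) (hl : f.2.1 ≠ true) : (f.labelling n).Natural M .left := by
  have hl' : ¬ Border.left ∈ f.borders := hl
  obtain ⟨_, ⟨h, _⟩ | ⟨_, h, _⟩⟩ := borderChoice_iff.mp hf.borderChoice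
  · exact h
  · exact not_not.mp fun hn => hl' (h.mpr hn)

theorem FragmentCode.Valid.natural_right {M : Machine} {n : ℕ} {f : FragmentCode}
    (hf : f.Valid M n) (hr : f.2.2.1 ≠ true) : (f.labelling n).Natural M .right := by
  have hr' : ¬ Border.right ∈ f.borders := hr
  obtain ⟨_, ⟨_, h, _⟩ | ⟨_, _, h, _⟩⟩ := borderChoice_iff.mp hf.borderChoice
  · exact h
  · exact not_not.mp fun hn => hr' (h.mpr hn)

theorem FragmentCode.Valid.natural_bottom {M : Machine} {n : ℕ} {f : FragmentCode}
    (hf : f.Valid M n) (hb : f.2.2.2 ≠ true) : (f.labelling n).Natural M .bottom := by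
  have hb' : ¬ Border.bottom ∈ f.borders := hb
  obtain ⟨_, ⟨_, _, _, h, _⟩ | ⟨_, _, _, h⟩⟩ := borderChoice_iff.mp hf.borderChoice
  · exact absurd h hb'
  · exact not_not.mp fun hn => hb' (h.mpr hn)

namespace Accepted

variable {V : Type} [Finite V] {G : SimpleGraph V} {x : V → Label} {h : Accepted G x} {R : V}
  {X Y : ℕ}

/-- The contents of the cells in a row follow from those in the previous row. -/
theorem content_below {M : Machine} (hM : ∀ v, (x v).1.1 = M)
    (hX : X < h.side R) (hY : Y + 1 < h.side R) :
    ¬ IsHalted M (content (x (h.tableNode R X Y))) ∧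
    (content (x (h.tableNode R X (Y + 1)))).1 = written M (content (x (h.tableNode R X Y))) ∧
    arrival .stay (content (x (h.tableNode R X (Y + 1)))) =
      emission M .stay (content (x (h.tableNode R X Y))) ∧
    (∀ X', X = X' + 1 → arrival .right (content (x (h.tableNode R X (Y + 1)))) =
      emission M .right (content (x (h.tableNode R X' Y)))) ∧
    (X + 1 < h.side R → arrival .left (content (x (h.tableNode R X (Y + 1)))) =
      emission M .left (content (x (h.tableNode R (X + 1) Y)))) := by
  have hs := adj_tableNode_south (h := h) hX hY
  obtain ⟨⟨h1, h2, h3⟩, h4⟩ := h.locallyConsistent.below _ _ hs.1.1 hs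
  rw [hM] at h1 h2 h3
  refine ⟨h1, h2, h3, ?_, fun hX1 => ?_⟩
  · rintro X' rfl
    have he := adj_tableNode_east (h := h) (Y := Y) hX (by omega)
    have h5 := (h4 _ he.1.1.symm).1 he
    rw [LabelRel.FromLeft, hM] at h5
    exact h5
  · have he := adj_tableNode_east (h := h) (Y := Y) hX1 (by omega)
    have h5 := (h4 _ he.1.1).2 he
    rw [LabelRel.FromRight, hM] at h5
    exact h5

/-- Borders that are not attached to a pivot are natural. -/
theorem content_natural {M : Machine} (hM : ∀ v, (x v).1.1 = M) (hR : h.forest.IsRoot R)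
    (hX : X < h.side R) (hY : Y < h.side R) (hna : ¬ Attached G.Adj x (h.tableNode R X Y)) :
    (X = 0 → arrival .right (content (x (h.tableNode R X Y))) = none ∧
      emission M .left (content (x (h.tableNode R X Y))) = none) ∧
    (X + 1 = h.side R → arrival .left (content (x (h.tableNode R X Y))) = none ∧
      emission M .right (content (x (h.tableNode R X Y))) = none) ∧
    (Y + 1 = h.side R → (content (x (h.tableNode R X Y))).2 ≠ none →
      IsHalted M (content (x (h.tableNode R X Y)))) := by
  obtain ⟨h1, h2, h3⟩ := h.locallyConsistent.natural _ base_tableNode hna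
  rw [noWest_iff hR hX hY, LabelRel.NaturalLeft, hM] at h1
  rw [noEast_iff hR hX hY, LabelRel.NaturalRight, hM] at h2
  rw [noSouth_iff hR hX hY, LabelRel.NaturalBottom, hM] at h3
  exact ⟨h1, h2, h3⟩

theorem content_first_row (hR : h.forest.IsRoot R) (hp : IsPivot G.Adj x (h.tableNode R 0 0))
    (hX : X < h.side R) : content (x (h.tableNode R X 0)) = Config.init.cellContent X := by
  obtain ⟨h1, h2⟩ := h.locallyConsistent.top _ base_tableNode
    (not_attached_of_pivot hR hp hX side_pos) ((noNorth_iff hR hX side_pos).mpr rfl)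
  rw [noWest_iff hR hX side_pos] at h1 h2
  by_cases hX0 : X = 0
  · subst hX0
    rw [content, h1 rfl]
    rfl
  · exact (h2 hX0).2.trans (Prod.ext rfl (if_neg (Ne.symm hX0)).symm)

/-- The rows of the table of the pivot are the configurations of the machine. -/
theorem exists_config {M : Machine} (hM : ∀ v, (x v).1.1 = M) (hR : h.forest.IsRoot R)
    (hp : IsPivot G.Adj x (h.tableNode R 0 0)) (hY : Y < h.side R) :
    ∃ C, configAt M Y = some C ∧ C.pos < h.side R ∧
      ∀ X < h.side R, content (x (h.tableNode R X Y)) = C.cellContent X := by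
  induction Y with
  | zero => exact ⟨_, rfl, side_pos, fun X hX => content_first_row hR hp hX⟩
  | succ Y ih =>
    obtain ⟨C, hC, hpos, hrow⟩ := ih (by omega)
    have hbelow {X : ℕ} (hX : X < h.side R) := content_below hM hX hY
    have hnat {X Y : ℕ} (hX : X < h.side R) (hY : Y < h.side R) :=
      content_natural hM hR hX hY (not_attached_of_pivot hR hp hX hY)
    have hnh := (hbelow hpos).1
    rw [hrow _ hpos, isHalted_cellContent] at hnh
    obtain ⟨⟨q, b, m⟩, ht⟩ := Option.ne_none_iff_exists'.mp fun hn => hnh ⟨rfl, hn⟩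
    -- The three kinds of moves are treated together: any configuration with these data describes
    -- the next row, which is checked arrival by arrival.
    have hnext : ∀ C' : Config, C'.state = q → C'.tape = Function.update C.tape C.pos b →
        C'.arrived = m → ((m = .left ∧ C'.pos + 1 = C.pos) ∨ (m = .stay ∧ C'.pos = C.pos) ∨
          (m = .right ∧ C'.pos = C.pos + 1)) →
        ∀ X < h.side R, content (x (h.tableNode R X (Y + 1))) = C'.cellContent X := by
      rintro C' rfl h2 rfl h4 X hX
      obtain ⟨_, g1, g2, g3, g4⟩ := hbelow hX
      rw [hrow X hX] at g1 g2
      refine content_ext ?_ fun m' => ?_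
      · rw [g1, written_cellContent ht, Config.cellContent, h2]
      · rw [arrival_cellContent]
        cases m'
        · by_cases hX1 : X + 1 < h.side R
          · rw [g4 hX1, hrow _ hX1, emission_cellContent ht]
            refine if_congr ?_ rfl rfl
            refine and_congr_left fun hm => ?_
            rcases h4 with h4 | h4 | h4
            · omega
            · simp [h4.1] at hm
            · simp [h4.1] at hm
          -- In the last column there is no neighbour from which the head could come; naturality of
          -- the right border replaces the missing rule.
          · rw [((hnat hX hY).2.1 (by omega)).1, if_neg]
            rintro ⟨h5, h6⟩
            rcases h4 with h4 | h4 | h4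
            · omega
            · simp [h4.1] at h6
            · simp [h4.1] at h6
        · rw [g2, emission_cellContent ht]
          refine if_congr ?_ rfl rfl
          refine and_congr_left fun hm => ?_
          rcases h4 with h4 | h4 | h4
          · simp [h4.1] at hm
          · omega
          · simp [h4.1] at hm
        · rcases X with _ | X
          · rw [((hnat hX hY).1 rfl).1, if_neg]
            rintro ⟨h5, h6⟩
            rcases h4 with h4 | h4 | h4
            · simp [h4.1] at h6
            · simp [h4.1] at h6
            · omega
          · rw [g3 X rfl, hrow _ (by omega), emission_cellContent ht]
            refine if_congr ?_ rfl rfl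
            refine and_congr_left fun hm => ?_
            rcases h4 with h4 | h4 | h4
            · simp [h4.1] at hm
            · simp [h4.1] at hm
            · omega
    have hstep : configAt M (Y + 1) = C.step M := by rw [configAt, hC]; rfl
    rw [hstep, Config.step, ht]
    rcases m with _ | _ | _
    -- Naturality of the left border keeps the machine from getting stuck at the left end of the
    -- tape; below, that of the right border keeps the head inside the table.
    · have h0 : C.pos ≠ 0 := by
        intro h0
        have := ((hnat hpos (by omega : Y < _)).1 h0).2
        rw [hrow _ hpos, emission_cellContent ht, if_pos ⟨rfl, rfl⟩] at this
        cases this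
      simp only [if_neg h0]
      exact ⟨_, rfl, by simp only; omega,
        hnext _ rfl rfl rfl (.inl ⟨rfl, by simp only; omega⟩)⟩
    · exact ⟨_, rfl, hpos, hnext _ rfl rfl rfl (.inr (.inl ⟨rfl, rfl⟩))⟩
    · have h0 : C.pos + 1 ≠ h.side R := by
        intro h0
        have := ((hnat hpos (by omega : Y < _)).2.1 h0).2
        rw [hrow _ hpos, emission_cellContent ht, if_pos ⟨rfl, rfl⟩] at this
        cases this
      exact ⟨_, rfl, by simp only; omega, hnext _ rfl rfl rfl (.inr (.inr ⟨rfl, rfl⟩))⟩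

/-- The contents come from `exists_config`, and the corner rule fixes the offset of the coordinates
modulo 3 to zero. -/
theorem label_pivot_table {M : Machine} (hM : ∀ v, (x v).1.1 = M) (hR : h.forest.IsRoot R)
    (hp : IsPivot G.Adj x (h.tableNode R 0 0)) (hX : X < h.side R) (hY : Y < h.side R) :
    (x (h.tableNode R X Y)).2 = some (tableCell M X Y) := by
  obtain ⟨C, hC, _, hrow⟩ := exists_config hM hR hp hY
  rw [label_eq_some base_tableNode, tableCell_eq hC, hrow X hX]
  obtain ⟨a, b, hab⟩ := exists_coords_tableNode (h := h) R
  have h0 := (h.locallyConsistent.top _ base_tableNode hp.2.1 hp.2.2.1).1 hp.2.2.2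
  have h1 := hab 0 0 side_pos side_pos
  rw [coords, h0] at h1
  have h2 := mod3_add (a := 0) (b := 0) h1 X Y
  rw [hab X Y hX hY]
  simp only [zero_add, add_zero] at h2
  rw [h2]

/-- The head is inside the table in its last row, and the bottom border is natural, so the machine
has halted there. -/
theorem exists_haltsWithOutput {M : Machine} (hM : ∀ v, (x v).1.1 = M) (hR : h.forest.IsRoot R)
    (hp : IsPivot G.Adj x (h.tableNode R 0 0)) :
    ∃ s o, s + 1 = h.side R ∧ HaltsWithOutput M s o := by
  have hs : h.side R - 1 + 1 = h.side R := Nat.sub_add_cancel side_pos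
  obtain ⟨C, hC, hpos, hrow⟩ := exists_config hM hR hp (Y := h.side R - 1) (by omega)
  have hh := (content_natural hM hR hpos (by omega : h.side R - 1 < _)
    (not_attached_of_pivot hR hp hpos (by omega))).2.2 hs
  rw [hrow _ hpos, isHalted_cellContent] at hh
  exact ⟨_, _, hs, C, hC, (hh (by simp [Config.cellContent])).2, rfl⟩

/-- The table of a fragment has the labels of the fragment. -/
theorem IsFragmentTable.cellOf_eq {p : V} {f : FragmentCode} (hT : h.IsFragmentTable p R f)
    (hX : X < h.side R) (hY : Y < h.side R) : cellOf (x (h.tableNode R X Y)) = f.cell X Y := by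
  have hside := hT.side_eq
  obtain ⟨n, hn⟩ : ∃ n, n = 2 ^ (3 * (x p).1.2) := ⟨_, rfl⟩
  have hb {X Y : ℕ} (hb : BorderCode.OnBorder n (f, (X, Y))) :
      cellOf (x (h.tableNode R X Y)) = f.cell X Y := hT.label (hn ▸ hb)
  have hv := hT.valid
  have hna {X Y : ℕ} (hX : X < h.side R) (hY : Y < h.side R)
      (hnb : ¬ BorderCode.OnBorder n (f, (X, Y))) : ¬ Attached G.Adj x (h.tableNode R X Y) :=
    fun ha => hnb (hn ▸ hT.onBorder hX hY ha)
  rw [← hn] at hside hv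
  have hn0 : 0 < n := hside ▸ side_pos
  have hM (v : V) : (x v).1.1 = (x p).1.1 := congrArg Prod.fst (h.param_eq v p)
  refine Prod.ext ?_ ?_
  · obtain ⟨a, b, hab⟩ := exists_coords_tableNode (h := h) R
    obtain ⟨a', b', hab'⟩ := hv.exists_coords
    have h0 := congrArg Prod.fst (hb (BorderCode.onBorder_zero n hn0 f))
    rw [hab' 0 hn0 0 hn0] at h0
    rw [hab' X (hside ▸ hX) Y (hside ▸ hY)]
    refine (hab X Y hX hY).trans (mod3_add ?_ X Y)
    exact (hab 0 0 side_pos side_pos).symm.trans h0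
  -- Positions on non-natural borders carry the right label by the matching; every other cell is
  -- computed from the row above, in the graph by the rules and in the fragment by its windows.
  · induction Y generalizing X with
    | zero => exact congrArg Prod.snd (hb ⟨hside ▸ hX, hn0, .inl rfl⟩)
    | succ Y ih =>
      by_cases hbd : BorderCode.OnBorder n (f, (X, Y + 1))
      · exact congrArg Prod.snd (hb hbd)
      obtain ⟨_, g1, g2, g3, g4⟩ := content_below hM hX hY
      have hnat := content_natural hM hT.root hX hY (hna hX hY hbd)
      have hrow {X : ℕ} (hX : X < h.side R) : content (x (h.tableNode R X Y)) = (f.cell X Y).2 :=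
        ih hX (by omega)
      change content (x (h.tableNode R X (Y + 1))) = _
      rw [hrow hX] at g1 g2
      rw [hside] at hX hY hrow g4 hnat
      have hw {X : ℕ} (hX : X + 1 < n) := windowConsistent_iff.mp
        (hv.consistent.windows ⟨X, by omega⟩ ⟨Y, by omega⟩ ⟨X + 1, hX⟩ ⟨Y + 1, hY⟩ rfl rfl)
      simp only [FragmentCode.labelling] at hw
      -- If a position in column 0 is not matched, the left border of the fragment is natural and
      -- the node is unattached; then neither the fragment nor the graph has an arrival from the
      -- left.
      have hleft (hl : f.2.1 ≠ true) : arrival .right (f.cell 0 (Y + 1)).2 = none :=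
        (FragmentCode.natural_left_iff.mp (hv.natural_left hl) _ (List.mem_range.mpr hY)).1
      have hright (hr : f.2.2.1 ≠ true) : arrival .left (f.cell (n - 1) (Y + 1)).2 = none :=
        (FragmentCode.natural_right_iff.mp (hv.natural_right hr) _ (List.mem_range.mpr hY)).1
      refine content_ext ?_ fun m => ?_
      · rw [g1]
        rcases X with _ | X
        · exact (hw (by omega)).1.2.2.1.symm
        · exact (hw hX).1.2.2.2.symm
      · cases m
        · by_cases hX1 : X + 1 < n
          · rw [g4 hX1, hrow hX1]
            exact (hw hX1).2.1.2.1.symm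
          · obtain rfl : X = n - 1 := by omega
            rw [(hnat.2.1 (by omega)).1, hright]
            exact fun hr => hbd ⟨hX, hY, .inr (.inr (.inl ⟨hr, by simp only; omega⟩))⟩
        · rw [g2]
          rcases X with _ | X
          · exact (hw (by omega)).2.1.1.symm
          · exact (hw hX).2.1.2.2.2.symm
        · rcases X with _ | X
          · rw [(hnat.1 rfl).1, hleft]
            exact fun hl => hbd ⟨hX, hY, .inr (.inl ⟨hl, rfl⟩)⟩
          · rw [g3 X rfl, hrow (by omega)]
            exact (hw hX).2.1.2.2.1.symm

end Accepted

end LocalDecision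

namespace LocalDecision

/-! ## The structural check characterises the graphs `G(M, r)` -/

namespace Pyramid

variable {k : ℕ}

/-- The adjacency relation of a pyramid without the direction. -/
def Rel (p q : Pyramid k) : Prop :=
  (q.z = p.z ∧ q.x = p.x + 1 ∧ q.y = p.y) ∨ (q.z = p.z ∧ q.x = p.x ∧ q.y = p.y + 1) ∨
    (q.z = p.z + 1 ∧ q.x = p.x / 2 ∧ q.y = p.y / 2)

theorem adj_iff {p q : Pyramid k} : (pyramidGraph k).Adj p q ↔ Rel p q ∨ Rel q p := by
  rw [pyramidGraph, SimpleGraph.fromRel_adj]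
  refine and_iff_right_of_imp ?_
  rintro h rfl
  simp only at h
  omega

end Pyramid

section

variable {M : Machine} {r h : ℕ}

theorem instanceGraph_adj_inl_inl {p q : Pyramid h} :
    (instanceGraph M r h).Adj (.inl p) (.inl q) ↔ (pyramidGraph h).Adj p q := by
  rw [instanceGraph, SimpleGraph.fromRel_adj]
  constructor
  · rintro ⟨_, h | h⟩
    · exact h
    · exact h.symm
  · exact fun h => ⟨fun he => h.ne (Sum.inl.inj he), .inl h⟩

theorem instanceGraph_adj_inr_inr {F F' : Fragment M r} {p q : Pyramid (3 * r)} :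
    (instanceGraph M r h).Adj (.inr (F, p)) (.inr (F', q)) ↔
      F = F' ∧ (pyramidGraph (3 * r)).Adj p q := by
  rw [instanceGraph, SimpleGraph.fromRel_adj]
  constructor
  · rintro ⟨_, h | h⟩
    · exact h
    · exact ⟨h.1.symm, h.2.symm⟩
  · exact fun h => ⟨fun he => h.2.ne (Prod.ext_iff.mp (Sum.inr.inj he)).2, .inl h⟩

theorem instanceGraph_adj_inl_inr {F : Fragment M r} {p : Pyramid h} {q : Pyramid (3 * r)} :
    (instanceGraph M r h).Adj (.inl p) (.inr (F, q)) ↔ (p.x = 0 ∧ p.y = 0 ∧ p.z = 0) ∧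
        (q.z = 0 ∧ ∃ b ∈ F.nonNatural, Border.Contains (2 ^ (3 * r)) q.x q.y b) := by
  rw [instanceGraph, SimpleGraph.fromRel_adj]
  constructor
  · rintro ⟨_, h | h⟩
    · exact h
    · exact h.elim
  · exact fun h => ⟨Sum.inl_ne_inr, .inl h⟩

end

theorem onBorder_ofFragment {M : Machine} {r : ℕ} {F : Fragment M r} {X Y : ℕ} :
    BorderCode.OnBorder (2 ^ (3 * r)) (FragmentCode.ofFragment F, (X, Y)) ↔
      X < 2 ^ (3 * r) ∧ Y < 2 ^ (3 * r) ∧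
        ∃ b ∈ F.nonNatural, Border.Contains (2 ^ (3 * r)) X Y b := by
  refine and_congr_right fun _ => and_congr_right fun _ => ?_
  rw [← FragmentCode.borders_ofFragment]
  constructor
  · rintro (h | h | h | h)
    · exact ⟨.top, trivial, h⟩
    · exact ⟨.left, h⟩
    · exact ⟨.right, h⟩
    · exact ⟨.bottom, h⟩
  · rintro ⟨b, hb, h⟩
    cases b
    · exact .inl h
    · exact .inr (.inl ⟨hb, h⟩)
    · exact .inr (.inr (.inl ⟨hb, h⟩))
    · exact .inr (.inr (.inr ⟨hb, h⟩))

namespace Accepted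

variable {V : Type} [Finite V] {G : SimpleGraph V} {x : V → Label}

/-- The node of the pyramid with the root `R` in the given position. -/
noncomputable def pyramidNode (h : Accepted G x) (R : V) {k : ℕ} (q : Pyramid k) : V :=
  h.forest.node R (k - q.z) q.x q.y

variable {h : Accepted G x} {R R' : V} {k k' : ℕ}

theorem inPyramid_pyramidNode (hk : h.forest.ht R = k) (q : Pyramid k) :
    h.forest.InPyramid R (h.pyramidNode R q) :=
  ⟨k - q.z, by omega, q.x, q.x_lt, q.y, q.y_lt, rfl⟩

theorem exists_eq_pyramidNode (hk : h.forest.ht R = k) {v : V} (hv : h.forest.InPyramid R v) :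
    ∃ q : Pyramid k, v = h.pyramidNode R q := by
  obtain ⟨d, hd, X, hX, Y, hY, rfl⟩ := hv
  have h1 : k - (k - d) = d := by omega
  exact ⟨⟨X, Y, k - d, Nat.sub_le _ _, by rwa [h1], by rwa [h1]⟩, by
    simp only [pyramidNode, h1]⟩

theorem pyramidNode_eq_tableNode (hk : h.forest.ht R = k) {q : Pyramid k} (hz : q.z = 0) :
    h.pyramidNode R q = h.tableNode R q.x q.y := by
  rw [pyramidNode, tableNode, hz, hk, Nat.sub_zero]

theorem ht_pyramidNode (hk : h.forest.ht R = k) (q : Pyramid k) :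
    h.forest.ht (h.pyramidNode R q) = q.z := by
  have := q.z_le
  rw [pyramidNode, QuadForest.ht_node (by omega)]
  omega

theorem base_pyramidNode (hk : h.forest.ht R = k) {q : Pyramid k} :
    (x (h.pyramidNode R q)).2 ≠ none ↔ q.z = 0 := by
  rw [← ht_pyramidNode (h := h) hk]
  exact (QuadForest.ht_eq_zero (Q := h.forest)).symm

theorem pyramidNode_injective (hR : h.forest.IsRoot R) (hk : h.forest.ht R = k)
    {q q' : Pyramid k} (he : h.pyramidNode R q = h.pyramidNode R q') : q = q' := by
  have h1 := q.z_le
  have h2 := q'.z_le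
  obtain ⟨_, h3, h4, h5⟩ := QuadForest.node_injective hR hR (by omega) (by omega) q.x_lt q.y_lt
    q'.x_lt q'.y_lt he
  exact Pyramid.ext h4 h5 (by omega)

theorem isParent_pyramidNode (hR : h.forest.IsRoot R) (hk : h.forest.ht R = k) {q q' : Pyramid k} :
    IsParent G.Adj x (h.pyramidNode R q) (h.pyramidNode R q') ↔
      q'.z = q.z + 1 ∧ q'.x = q.x / 2 ∧ q'.y = q.y / 2 := by
  have hz := q.z_le
  have hz' := q'.z_le
  have hpar (hlt : q.z < k) : h.forest.Par (h.pyramidNode R q)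
      (h.forest.node R (k - (q.z + 1)) (q.x / 2) (q.y / 2)) := by
    have := QuadForest.par_node (Q := h.forest) (R := R) (d := k - (q.z + 1)) (X := q.x) (Y := q.y)
      (by omega)
    rwa [show k - (q.z + 1) + 1 = k - q.z by omega] at this
  constructor
  · intro hp
    have h1 := QuadForest.ht_par (Q := h.forest) hp
    rw [ht_pyramidNode hk, ht_pyramidNode hk] at h1
    have h2 := h.forest.par_unique hp (hpar (by omega))
    have hx := q.x_lt
    have hy := q.y_lt
    rw [show k - q.z = k - (q.z + 1) + 1 by omega, pow_succ] at hx hy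
    obtain ⟨_, _, h3, h4⟩ := QuadForest.node_injective hR hR (by omega) (by omega) q'.x_lt q'.y_lt
      (by omega) (by omega) h2
    exact ⟨h1, h3, h4⟩
  · rintro ⟨h1, h2, h3⟩
    have := hpar (by omega)
    rw [← h1, ← h2, ← h3] at this
    exact this

theorem lateral_pyramidNode (hR : h.forest.IsRoot R) (hk : h.forest.ht R = k) {q q' : Pyramid k} :
    Lateral G.Adj x (h.pyramidNode R q) (h.pyramidNode R q') ↔ q'.z = q.z ∧
      ((q'.x = q.x + 1 ∧ q'.y = q.y) ∨ (q'.x = q.x ∧ q'.y = q.y + 1) ∨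
        (q.x = q'.x + 1 ∧ q'.y = q.y) ∨ (q'.x = q.x ∧ q.y = q'.y + 1)) := by
  have hz := q.z_le
  have hz' := q'.z_le
  constructor
  · intro hl
    have h1 := QuadForest.ht_lat (Q := h.forest) hl
    rw [ht_pyramidNode hk, ht_pyramidNode hk] at h1
    obtain ⟨X, Y, hX, hY, he, hc⟩ := QuadForest.lat_node (Q := h.forest) hR (by omega) q.x_lt q.y_lt hl
    obtain ⟨_, _, h3, h4⟩ := QuadForest.node_injective hR hR (by omega) (by omega) q'.x_lt q'.y_lt
      hX hY he
    rw [h3, h4]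
    exact ⟨h1, hc⟩
  · have main {q q' : Pyramid k} (hzz : q'.z = q.z)
        (hc : (q'.x = q.x + 1 ∧ q'.y = q.y) ∨ (q'.x = q.x ∧ q'.y = q.y + 1)) :
        Lateral G.Adj x (h.pyramidNode R q) (h.pyramidNode R q') := by
      have := QuadForest.lat_node_of_adj (Q := h.forest) (R := R) (d := k - q.z) (by omega)
        (hzz ▸ q'.x_lt) (hzz ▸ q'.y_lt) hc
      rw [pyramidNode, pyramidNode, hzz]
      exact this
    rintro ⟨h1, h2 | h2 | h2 | h2⟩
    · exact main h1 (.inl h2)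
    · exact main h1 (.inr h2)
    · exact (main h1.symm (.inl ⟨h2.1, h2.2.symm⟩)).symm adj_symm
    · exact (main h1.symm (.inr ⟨h2.1.symm, h2.2⟩)).symm adj_symm

theorem adj_pyramidNode (hR : h.forest.IsRoot R) (hk : h.forest.ht R = k) {q q' : Pyramid k}
    (hf : ¬ Foreign G.Adj x (h.pyramidNode R q) (h.pyramidNode R q')) :
    G.Adj (h.pyramidNode R q) (h.pyramidNode R q') ↔ (pyramidGraph k).Adj q q' := by
  rw [Pyramid.adj_iff, Pyramid.Rel, Pyramid.Rel]
  constructor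
  · intro ha
    rcases adj_cases (L := x) ha with hc | hc | hc | hc
    · exact .inl (.inr (.inr ((isParent_pyramidNode hR hk).mp hc)))
    · exact .inr (.inr (.inr ((isParent_pyramidNode hR hk).mp hc)))
    · have := (lateral_pyramidNode hR hk).mp hc
      omega
    · exact absurd hc hf
  · rintro ((hc | hc | hc) | (hc | hc | hc))
    · exact ((lateral_pyramidNode hR hk).mpr (by omega)).1
    · exact ((lateral_pyramidNode hR hk).mpr (by omega)).1
    · exact ((isParent_pyramidNode hR hk).mpr hc).1.symm
    · exact ((lateral_pyramidNode hR hk).mpr (by omega)).1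
    · exact ((lateral_pyramidNode hR hk).mpr (by omega)).1
    · exact ((isParent_pyramidNode hR hk).mpr hc).1

/-- A pyramid is closed under parent, child and lateral edges, so an edge between different pyramids
must be foreign. -/
theorem foreign_of_adj (hR : h.forest.IsRoot R) (hR' : h.forest.IsRoot R') (hne : R ≠ R') {u w : V}
    (hu : h.forest.InPyramid R u) (hw : h.forest.InPyramid R' w) (ha : G.Adj u w) :
    Foreign G.Adj x u w := by
  rcases adj_cases (L := x) ha with hc | hc | hc | hc
  · exact absurd ((hu.step hR (.inl hc)).eq hR hR' hw) hne
  · exact absurd ((hu.step hR (.inr (.inl hc))).eq hR hR' hw) hne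
  · exact absurd ((hu.step hR (.inr (.inr hc))).eq hR hR' hw) hne
  · exact hc

theorem eq_of_isPivot_of_inPyramid (hR : h.forest.IsRoot R) {v : V} (hv : IsPivot G.Adj x v)
    (hin : h.forest.InPyramid R v) : v = h.tableNode R 0 0 := by
  obtain ⟨R', hR', rfl⟩ := exists_eq_of_isPivot (h := h) hv
  obtain rfl := hin.eq hR hR' (inPyramid_tableNode side_pos side_pos)
  rfl

theorem IsFragmentTable.not_isPivot {p : V} {f : FragmentCode} (hT : h.IsFragmentTable p R f)
    {v : V} (hin : h.forest.InPyramid R v) : ¬ IsPivot G.Adj x v := by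
  intro hv
  obtain rfl := eq_of_isPivot_of_inPyramid hT.root hv hin
  exact hv.2.1 (hT.attached (BorderCode.onBorder_zero _ (by positivity) f))

theorem IsFragmentTable.ht_eq {p : V} {f : FragmentCode} (hT : h.IsFragmentTable p R f) :
    h.forest.ht R = 3 * (x p).1.2 :=
  Nat.pow_right_injective le_rfl hT.side_eq

/-- Sending positions to nodes gives the inverse isomorphism: the execution pyramid goes to the
pyramid of a pivot, and each fragment pyramid to the one that is matched with it. -/
theorem exists_iso (h : Accepted G x) : ∃ (M : Machine) (r k s o : ℕ), s + 1 = 2 ^ k ∧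
    HaltsWithOutput M s o ∧ ∃ φ : G ≃g instanceGraph M r k,
      ∀ v, x v = instanceLabel M r k (φ v) := by
  obtain ⟨R, hR, hp⟩ := h.exists_root_pivot
  obtain ⟨k, hk⟩ : ∃ k, h.forest.ht R = k := ⟨_, rfl⟩
  obtain ⟨p, hpR⟩ : ∃ p, p = h.tableNode R 0 0 := ⟨_, rfl⟩
  obtain ⟨M, hM'⟩ : ∃ M, M = (x p).1.1 := ⟨_, rfl⟩
  obtain ⟨r, hr'⟩ : ∃ r, r = (x p).1.2 := ⟨_, rfl⟩
  have hparam (v : V) : (x v).1 = (M, r) := (h.param_eq v p).trans (by rw [hM', hr'])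
  have hM (v : V) : (x v).1.1 = M := congrArg Prod.fst (hparam v)
  obtain ⟨s, o, hs, ho⟩ := exists_haltsWithOutput hM hR hp
  refine ⟨M, r, k, s, o, by rw [hs, side, hk], ho, ?_⟩
  have hex (F : Fragment M r) : ∃ R', h.IsFragmentTable p R' (FragmentCode.ofFragment F) := by
    subst hM' hr'
    exact exists_isFragmentTable (hpR ▸ hp) (FragmentCode.valid_ofFragment F)
  choose RF hRF using hex
  have hkF (F : Fragment M r) : h.forest.ht (RF F) = 3 * r := hr' ▸ (hRF F).ht_eq
  have hne (F : Fragment M r) : RF F ≠ R := by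
    intro he
    refine (hRF F).not_isPivot ?_ hp
    rw [he]
    exact inPyramid_tableNode side_pos side_pos
  have hinj (F F' : Fragment M r) (he : RF F = RF F') : F = F' :=
    FragmentCode.ofFragment_injective ((hRF F).unique (he ▸ hRF F')).2
  let ψ : Node M r k → V := Sum.elim (fun q => h.pyramidNode R q)
    fun Fq => h.pyramidNode (RF Fq.1) Fq.2
  have hin (q : Pyramid k) : h.forest.InPyramid R (ψ (.inl q)) := inPyramid_pyramidNode hk q
  have hinF (F : Fragment M r) (q : Pyramid (3 * r)) :
      h.forest.InPyramid (RF F) (ψ (.inr (F, q))) := inPyramid_pyramidNode (hkF F) q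
  have hψ : Function.Bijective ψ := by
    constructor
    · rintro (q | ⟨F, q⟩) (q' | ⟨F', q'⟩) he
      · exact congrArg _ (pyramidNode_injective hR hk he)
      · exact absurd ((hin q).eq hR (hRF F').root (he ▸ hinF F' q')).symm (hne F')
      · exact absurd ((hinF F q).eq (hRF F).root hR (he ▸ hin q')) (hne F)
      · obtain rfl := hinj _ _ ((hinF F q).eq (hRF F).root (hRF F').root (he ▸ hinF F' q'))
        exact congrArg (fun q => Sum.inr (F, q)) (pyramidNode_injective (hRF F).root (hkF F) he)
    -- Every pyramid other than that of the pivot is matched with a valid code, which comes from a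
    -- fragment.
    · intro v
      obtain ⟨R', hR', hv⟩ := h.forest.exists_eq_node v
      change h.forest.InPyramid R' v at hv
      rcases eq_or_isFragmentTable hR hp hR' with rfl | ⟨f, hT⟩
      · obtain ⟨q, rfl⟩ := exists_eq_pyramidNode hk hv
        exact ⟨.inl q, rfl⟩
      · have hf : f.Valid M (2 ^ (3 * r)) := by rw [hM', hr', hpR]; exact hT.valid
        have he := hRF hf.toFragment
        rw [hf.ofFragment_toFragment, hpR] at he
        obtain rfl := he.root_unique hT
        obtain ⟨q, rfl⟩ := exists_eq_pyramidNode (hkF _) hv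
        exact ⟨.inr (_, q), rfl⟩
  -- Edges between the two kinds of pyramids are foreign, so one end is a pivot, necessarily the
  -- corner of the execution table, and the other end is attached, that is, on a non-natural border.
  have hcross (q : Pyramid k) (F : Fragment M r) (q' : Pyramid (3 * r)) :
      G.Adj (ψ (.inl q)) (ψ (.inr (F, q'))) ↔
        (instanceGraph M r k).Adj (.inl q) (.inr (F, q')) := by
    rw [instanceGraph_adj_inl_inr]
    have hsF : h.side (RF F) = 2 ^ (3 * r) := by rw [side, hkF]
    constructor
    · intro ha
      have hf := foreign_of_adj hR (hRF F).root (hne F).symm (hin q) (hinF F q') ha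
      have hz : q.z = 0 := (base_pyramidNode hk).mp (h.foreign_base hf)
      have hz' : q'.z = 0 := (base_pyramidNode (hkF F)).mp (h.foreign_base (hf.symm adj_symm))
      have hpq : IsPivot G.Adj x (ψ (.inl q)) :=
        (h.isPivot_or_isPivot hf).resolve_right ((hRF F).not_isPivot (hinF F q'))
      have hq := eq_of_isPivot_of_inPyramid hR hpq (hin q)
      have e1 : ψ (.inl q) = h.tableNode R q.x q.y := pyramidNode_eq_tableNode hk hz
      have e2 : ψ (.inr (F, q')) = h.tableNode (RF F) q'.x q'.y :=
        pyramidNode_eq_tableNode (hkF F) hz'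
      rw [e1] at hq
      obtain ⟨_, h1, h2⟩ := tableNode_injective hR hR (by rw [side, hk]; exact q.x_lt')
        (by rw [side, hk]; exact q.y_lt') side_pos side_pos hq
      have hat := h.attached_of_foreign hpq.2.1 hf
      rw [e2] at hat
      have hb := (hRF F).onBorder (hsF ▸ q'.x_lt') (hsF ▸ q'.y_lt') hat
      rw [← hr'] at hb
      exact ⟨⟨h1, h2, hz⟩, hz', (onBorder_ofFragment.mp hb).2.2⟩
    · rintro ⟨⟨h1, h2, hz⟩, hz', hb⟩
      have e1 : ψ (.inl q) = h.tableNode R q.x q.y := pyramidNode_eq_tableNode hk hz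
      have e2 : ψ (.inr (F, q')) = h.tableNode (RF F) q'.x q'.y :=
        pyramidNode_eq_tableNode (hkF F) hz'
      rw [e1, e2, h1, h2, ← hpR]
      refine ((hRF F).foreign ?_).1
      rw [← hr']
      exact onBorder_ofFragment.mpr ⟨q'.x_lt', q'.y_lt', hb⟩
  have hadj (a b : Node M r k) : G.Adj (ψ a) (ψ b) ↔ (instanceGraph M r k).Adj a b := by
    rcases a with q | ⟨F, q⟩ <;> rcases b with q' | ⟨F', q'⟩
    -- A foreign edge within the pyramid of the pivot would make one of its table nodes attached.
    · rw [instanceGraph_adj_inl_inl]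
      refine adj_pyramidNode hR hk fun hf => ?_
      have hz : q.z = 0 := (base_pyramidNode hk).mp (h.foreign_base hf)
      have hz' : q'.z = 0 := (base_pyramidNode hk).mp (h.foreign_base (hf.symm adj_symm))
      have hna {q : Pyramid k} (hz : q.z = 0) : ¬ Attached G.Adj x (h.pyramidNode R q) := by
        rw [pyramidNode_eq_tableNode hk hz]
        exact not_attached_of_pivot hR hp (by rw [side, hk]; exact q.x_lt')
          (by rw [side, hk]; exact q.y_lt')
      exact hna hz' (h.attached_of_foreign (hna hz) hf)
    · exact hcross q F' q'
    · rw [G.adj_comm, (instanceGraph M r k).adj_comm]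
      exact hcross q' F q
    · rw [instanceGraph_adj_inr_inr]
      have hnf : ¬ Foreign G.Adj x (ψ (.inr (F, q))) (ψ (.inr (F', q'))) := fun hf =>
        (h.isPivot_or_isPivot hf).elim ((hRF F).not_isPivot (hinF F q))
          ((hRF F').not_isPivot (hinF F' q'))
      by_cases hFF : F = F'
      · subst hFF
        rw [and_iff_right rfl]
        exact adj_pyramidNode (hRF F).root (hkF F) hnf
      · refine iff_of_false (fun ha => hnf ?_) fun hn => hFF hn.1
        exact foreign_of_adj (hRF F).root (hRF F').root (fun he => hFF (hinj _ _ he)) (hinF F q)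
          (hinF F' q') ha
  have hlab (u : Node M r k) : x (ψ u) = instanceLabel M r k u := by
    refine Prod.ext ((hparam _).trans ?_) ?_
    · rcases u with q | ⟨F, q⟩ <;> rfl
    rcases u with q | ⟨F, q⟩
    · by_cases hz : q.z = 0
      · have e1 : ψ (.inl q) = h.tableNode R q.x q.y := pyramidNode_eq_tableNode hk hz
        rw [e1, label_pivot_table hM hR hp (by rw [side, hk]; exact q.x_lt')
          (by rw [side, hk]; exact q.y_lt')]
        exact (if_pos hz).symm
      · exact (not_not.mp (mt (base_pyramidNode hk).mp hz)).trans (if_neg hz).symm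
    · by_cases hz : q.z = 0
      · have e1 : ψ (.inr (F, q)) = h.tableNode (RF F) q.x q.y :=
          pyramidNode_eq_tableNode (hkF F) hz
        have e2 := (hRF F).cellOf_eq (X := q.x) (Y := q.y) (by rw [side, hkF]; exact q.x_lt')
          (by rw [side, hkF]; exact q.y_lt')
        rw [e1, label_eq_some base_tableNode]
        refine Eq.trans ?_ (if_pos hz).symm
        exact congrArg some (e2.trans
          (FragmentCode.cell_ofFragment F ⟨q.x, q.x_lt'⟩ ⟨q.y, q.y_lt'⟩))
      · exact (not_not.mp (mt (base_pyramidNode (hkF F)).mp hz)).trans (if_neg hz).symm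
  refine ⟨RelIso.symm ⟨Equiv.ofBijective ψ hψ, hadj _ _⟩, fun v => ?_⟩
  rw [← hlab]
  exact congrArg x ((Equiv.ofBijective ψ hψ).apply_symm_apply v).symm

end Accepted

end LocalDecision

namespace LocalDecision

/-! ## The graphs `G(M, r)` pass the structural check -/

/-- Steps to the right, downwards, and to the parent in a pyramid. -/
def PyramidStep (a b z a' b' z' : ℕ) : Prop :=
  (z' = z ∧ a' = a + 1 ∧ b' = b) ∨ (z' = z ∧ a' = a ∧ b' = b + 1) ∨
    (z' = z + 1 ∧ a' = a / 2 ∧ b' = b / 2)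

/-- The height of a pyramid in `G(M, r)`. -/
def pyramidHeight {M : Machine} {r : ℕ} (h : ℕ) : Option (Fragment M r) → ℕ
  | none => h
  | some _ => 3 * r

/-- A description of a labelled graph that is isomorphic to `G(M, r)` by a pyramid (the fragment,
if it is the pyramid over a fragment) and three coordinates for each node. -/
structure InstanceLayout {V : Type} (A : V → V → Prop) (L : V → Label) (M : Machine)
    (r h : ℕ) where
  comp : V → Option (Fragment M r)
  X : V → ℕ
  Y : V → ℕ
  Z : V → ℕ
  ext : ∀ {u w}, comp u = comp w → X u = X w → Y u = Y w → Z u = Z w → u = w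
  exists_node : ∀ c a b z, z ≤ pyramidHeight h c → a < 2 ^ (pyramidHeight h c - z) →
    b < 2 ^ (pyramidHeight h c - z) → ∃ v, comp v = c ∧ X v = a ∧ Y v = b ∧ Z v = z
  Z_le : ∀ v, Z v ≤ pyramidHeight h (comp v)
  X_lt : ∀ v, X v < 2 ^ (pyramidHeight h (comp v) - Z v)
  Y_lt : ∀ v, Y v < 2 ^ (pyramidHeight h (comp v) - Z v)
  Cross : V → V → Prop
  cross_iff : ∀ {u w}, Cross u w ↔ (comp u = none ∧ X u = 0 ∧ Y u = 0 ∧ Z u = 0) ∧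
    ∃ F, comp w = some F ∧ Z w = 0 ∧
      BorderCode.OnBorder (2 ^ (3 * r)) (FragmentCode.ofFragment F, (X w, Y w))
  adj_iff : ∀ {u w}, A u w ↔ (comp u = comp w ∧ (PyramidStep (X u) (Y u) (Z u) (X w) (Y w) (Z w) ∨
    PyramidStep (X w) (Y w) (Z w) (X u) (Y u) (Z u))) ∨ Cross u w ∨ Cross w u
  param : ∀ v, (L v).1 = (M, r)
  label_up : ∀ {v}, Z v ≠ 0 → (L v).2 = none
  label_table : ∀ {v}, comp v = none → Z v = 0 → (L v).2 = some (tableCell M (X v) (Y v))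
  label_fragment : ∀ {v F}, comp v = some F → Z v = 0 →
    (L v).2 = some ((FragmentCode.ofFragment F).cell (X v) (Y v))

/-- The layout of `G(M, r)`. -/
def instanceLayout (M : Machine) (r h : ℕ) :
    InstanceLayout (instanceGraph M r h).Adj (instanceLabel M r h) M r h where
  comp := Sum.elim (fun _ => none) fun Fp => some Fp.1
  X := Sum.elim (fun p => p.x) fun Fp => Fp.2.x
  Y := Sum.elim (fun p => p.y) fun Fp => Fp.2.y
  Z := Sum.elim (fun p => p.z) fun Fp => Fp.2.z
  ext := by
    rintro (p | ⟨F, p⟩) (q | ⟨F', q⟩) h1 h2 h3 h4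
    · exact congrArg Sum.inl (Pyramid.ext h2 h3 h4)
    · cases h1
    · cases h1
    · obtain rfl := Option.some.inj h1
      exact congrArg (fun p => Sum.inr (F, p)) (Pyramid.ext h2 h3 h4)
  exists_node := by
    rintro (_ | F) a b z hz ha hb
    · exact ⟨.inl ⟨a, b, z, hz, ha, hb⟩, rfl, rfl, rfl, rfl⟩
    · exact ⟨.inr (F, ⟨a, b, z, hz, ha, hb⟩), rfl, rfl, rfl, rfl⟩
  Z_le := by rintro (p | ⟨F, p⟩) <;> exact p.z_le
  X_lt := by rintro (p | ⟨F, p⟩) <;> exact p.x_lt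
  Y_lt := by rintro (p | ⟨F, p⟩) <;> exact p.y_lt
  Cross u w := match u, w with
    | .inl p, .inr (F, q) => (instanceGraph M r h).Adj (.inl p) (.inr (F, q))
    | _, _ => False
  cross_iff := by
    rintro (p | ⟨F, p⟩) (q | ⟨F', q⟩)
    · simp
    · simp only [instanceGraph_adj_inl_inr, Sum.elim_inl, Sum.elim_inr, Option.some.injEq,
        exists_eq_left', true_and, onBorder_ofFragment, q.x_lt', q.y_lt']
    · simp
    · simp
  adj_iff := by
    rintro (p | ⟨F, p⟩) (q | ⟨F', q⟩)
    · simp only [instanceGraph_adj_inl_inl, Pyramid.adj_iff, or_false]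
      exact (and_iff_right rfl).symm
    · simp
    · simp [(instanceGraph M r h).adj_comm (Sum.inr (F, p))]
    · simp only [instanceGraph_adj_inr_inr, Pyramid.adj_iff, or_false]
      exact and_congr_left fun _ => Option.some_inj.symm
  param := by rintro (p | ⟨F, p⟩) <;> rfl
  label_up := by rintro (p | ⟨F, p⟩) hz <;> exact if_neg hz
  label_table := by
    rintro (p | ⟨F, p⟩) h1 hz
    · exact if_pos hz
    · cases h1
  label_fragment := by
    rintro (p | ⟨F, p⟩) F' h1 hz
    · cases h1
    · obtain rfl := Option.some.inj h1
      exact (if_pos hz).trans (congrArg some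
        (FragmentCode.cell_ofFragment F ⟨p.x, p.x_lt'⟩ ⟨p.y, p.y_lt'⟩).symm)

/-- Transfer of a layout along an isomorphism. -/
def InstanceLayout.comap {V W : Type} {A : V → V → Prop} {B : W → W → Prop} {L : V → Label}
    {L' : W → Label} {M : Machine} {r h : ℕ} (S : InstanceLayout B L' M r h) (φ : A ≃r B)
    (hL : ∀ v, L v = L' (φ v)) : InstanceLayout A L M r h where
  comp v := S.comp (φ v)
  X v := S.X (φ v)
  Y v := S.Y (φ v)
  Z v := S.Z (φ v)
  ext h1 h2 h3 h4 := φ.injective (S.ext h1 h2 h3 h4)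
  exists_node c a b z hz ha hb := by
    obtain ⟨w, hw⟩ := S.exists_node c a b z hz ha hb
    exact ⟨φ.symm w, by simpa using hw⟩
  Z_le v := S.Z_le _
  X_lt v := S.X_lt _
  Y_lt v := S.Y_lt _
  Cross u w := S.Cross (φ u) (φ w)
  cross_iff := S.cross_iff
  adj_iff := by
    intro u w
    rw [← S.adj_iff]
    exact φ.map_rel_iff.symm
  param v := by rw [hL]; exact S.param _
  label_up hz := by rw [hL]; exact S.label_up hz
  label_table h1 hz := by rw [hL]; exact S.label_table h1 hz
  label_fragment h1 hz := by rw [hL]; exact S.label_fragment h1 hz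

namespace InstanceLayout

variable {V : Type} {A : V → V → Prop} {L : V → Label} {M : Machine} {r h : ℕ}
  (S : InstanceLayout A L M r h)

/-! ### The local predicates -/

/-- Steps to the right or downwards, in either direction. -/
def GridAdj (a b a' b' : ℕ) : Prop :=
  (a' = a + 1 ∧ b' = b) ∨ (a' = a ∧ b' = b + 1) ∨ (a = a' + 1 ∧ b' = b) ∨ (a' = a ∧ b = b' + 1)

/-- `p` is the parent of `u` in a pyramid. -/
def Up (u p : V) : Prop :=
  S.comp p = S.comp u ∧ S.Z p = S.Z u + 1 ∧ S.X p = S.X u / 2 ∧ S.Y p = S.Y u / 2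

/-- `u` and `w` are neighbours in a layer of a pyramid. -/
def Side (u w : V) : Prop :=
  S.comp w = S.comp u ∧ S.Z w = S.Z u ∧ GridAdj (S.X u) (S.Y u) (S.X w) (S.Y w)

variable {S} {u w p q v : V}

theorem adj_cases_iff : A u w ↔ S.Up u w ∨ S.Up w u ∨ S.Side u w ∨ S.Cross u w ∨ S.Cross w u := by
  rw [S.adj_iff, eq_comm (a := S.comp u)]
  unfold PyramidStep Up Side GridAdj
  constructor
  · rintro (⟨h1, h2⟩ | h2)
    · rcases h2 with (h2 | h2 | h2) | (h2 | h2 | h2)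
      · exact .inr (.inr (.inl ⟨h1, by omega⟩))
      · exact .inr (.inr (.inl ⟨h1, by omega⟩))
      · exact .inl ⟨h1, h2⟩
      · exact .inr (.inr (.inl ⟨h1, by omega⟩))
      · exact .inr (.inr (.inl ⟨h1, by omega⟩))
      · exact .inr (.inl ⟨h1.symm, h2⟩)
    · exact .inr (.inr (.inr h2))
  · rintro (⟨h1, h2⟩ | ⟨h1, h2⟩ | ⟨h1, h2⟩ | h2)
    · exact .inl ⟨h1, by omega⟩
    · exact .inl ⟨h1.symm, by omega⟩
    · exact .inl ⟨h1, by omega⟩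
    · exact .inr h2

theorem label_eq_none : (L v).2 = none ↔ S.Z v ≠ 0 := by
  refine ⟨fun h hz => ?_, S.label_up⟩
  rcases hc : S.comp v with _ | F
  · rw [S.label_table hc hz] at h
    cases h
  · rw [S.label_fragment hc hz] at h
    cases h

theorem Cross.comp_ne (h : S.Cross u w) : S.comp u ≠ S.comp w := by
  obtain ⟨⟨h1, _⟩, F, h2, _⟩ := S.cross_iff.mp h
  rw [h1, h2]
  exact nofun

theorem Cross.left_base (h : S.Cross u w) : S.Z u = 0 := (S.cross_iff.mp h).1.2.2.2

theorem Cross.right_base (h : S.Cross u w) : S.Z w = 0 := (S.cross_iff.mp h).2.choose_spec.2.1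

theorem cases_of_comp_eq (h : A u w) (hc : S.comp u = S.comp w) :
    S.Up u w ∨ S.Up w u ∨ S.Side u w := by
  rcases adj_cases_iff.mp h with h | h | h | h | h
  · exact .inl h
  · exact .inr (.inl h)
  · exact .inr (.inr h)
  · exact absurd hc h.comp_ne
  · exact absurd hc.symm h.comp_ne

theorem cases_of_up (h : A u w) (hz : S.Z u ≠ 0) : S.Up u w ∨ S.Up w u ∨ S.Side u w := by
  rcases adj_cases_iff.mp h with h | h | h | h | h
  · exact .inl h
  · exact .inr (.inl h)
  · exact .inr (.inr h)
  · exact absurd h.left_base hz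
  · exact absurd h.right_base hz

theorem comp_eq_of_up (h : A u w) (hz : S.Z u ≠ 0) : S.comp w = S.comp u := by
  rcases cases_of_up h hz with h | h | h
  · exact h.1
  · exact h.1.symm
  · exact h.1

theorem Side.symm (h : S.Side u w) : S.Side w u := by
  obtain ⟨h1, h2, h3⟩ := h
  refine ⟨h1.symm, h2.symm, ?_⟩
  unfold GridAdj at *
  omega

theorem Up.unique (h : S.Up u p) (h' : S.Up u q) : p = q :=
  S.ext (h.1.trans h'.1.symm) (h.2.2.1.trans h'.2.2.1.symm) (h.2.2.2.trans h'.2.2.2.symm)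
    (h.2.1.trans h'.2.1.symm)

theorem not_up_self_side (h : S.Side u w) : ¬ S.Up u w := fun h' => by
  have h1 := h.2.1
  have h2 := h'.2.1
  omega

/-- The only common neighbour of two nodes that are neighbours in a layer is their parent. -/
theorem up_of_triangle (h1 : S.Side u w) (hu : S.Up u v ∨ S.Up v u ∨ S.Side u v)
    (hw : S.Up w v ∨ S.Up v w ∨ S.Side w v) : S.Up u v := by
  obtain ⟨_, h1, h2⟩ := h1
  rcases hu with hu | ⟨_, hu, hu'⟩ | ⟨_, hu, hu'⟩
  · exact hu
  · rcases hw with ⟨_, hw, _⟩ | ⟨_, hw, hw'⟩ | ⟨_, hw, _⟩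
    · omega
    · unfold GridAdj at h2
      omega
    · omega
  · rcases hw with ⟨_, hw, _⟩ | ⟨_, hw, hw'⟩ | ⟨_, hw, hw'⟩
    · omega
    · omega
    · unfold GridAdj at h2 hu' hw'
      omega

theorem exists_up (h : S.Z u < pyramidHeight h (S.comp u)) : ∃ p, S.Up u p := by
  have h1 := S.X_lt u
  have h2 := S.Y_lt u
  obtain ⟨k, hk⟩ : ∃ k, pyramidHeight _ (S.comp u) = S.Z u + 1 + k := ⟨_, (Nat.add_sub_of_le h).symm⟩
  rw [hk, show S.Z u + 1 + k - S.Z u = k + 1 by omega, pow_succ] at h1 h2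
  obtain ⟨p, h3, h4, h5, h6⟩ := S.exists_node (S.comp u) (S.X u / 2) (S.Y u / 2) (S.Z u + 1) h
    (by rw [hk, Nat.add_sub_cancel_left]; omega) (by rw [hk, Nat.add_sub_cancel_left]; omega)
  exact ⟨p, h3, h6, h4, h5⟩

theorem exists_child (hz : S.Z p ≠ 0) {a b : ℕ} (ha : a / 2 = S.X p) (hb : b / 2 = S.Y p) :
    ∃ u, S.Up u p ∧ S.X u = a ∧ S.Y u = b := by
  have h1 := S.X_lt p
  have h2 := S.Y_lt p
  have h3 := S.Z_le p
  have hk : pyramidHeight h (S.comp p) - (S.Z p - 1) = pyramidHeight h (S.comp p) - S.Z p + 1 := by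
    omega
  obtain ⟨u, h4, h5, h6, h7⟩ := S.exists_node (S.comp p) a b (S.Z p - 1) (by omega)
    (by rw [hk, pow_succ]; omega) (by rw [hk, pow_succ]; omega)
  exact ⟨u, ⟨h4.symm, by omega, by omega, by omega⟩, h5, h6⟩

/-- In the neighbourhood of an upper node, the children form a 4-cycle. A lateral neighbour shares
with the node at most the parent, so no lateral neighbour, and hence not the parent either, lies on
a 4-cycle there. -/
theorem isParent_iff : IsParent A L u p ↔ S.Up u p := by
  constructor
  · rintro ⟨h1, h2, a, ha, b, hb, d, hd, hua, hab, hbd, hdu, hub, had⟩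
    have hz := (label_eq_none (S := S)).mp h2
    have ca := comp_eq_of_up ha hz
    have cb := comp_eq_of_up hb hz
    have cd := comp_eq_of_up hd hz
    have cu := comp_eq_of_up h1 hz
    have hside {u a : V} (hu : S.Side p u) (ha : A p a) (hua : S.comp u = S.comp a → A u a)
        (cu : S.comp u = S.comp p) (ca : S.comp a = S.comp p) : S.Up p a :=
      up_of_triangle hu (cases_of_up ha hz) (cases_of_comp_eq (hua (cu.trans ca.symm))
        (cu.trans ca.symm))
    have hsymm {u w : V} (h : A u w) : A w u := by
      rw [S.adj_iff] at h ⊢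
      tauto
    rcases cases_of_up h1 hz with hu | hu | hu
    -- If `u` were above `p`, its cycle neighbour `a` would have to be lateral to `p`, and the next
    -- node `b` could only be the parent of `p`, which is `u` again.
    · exfalso
      have hpa : S.Side p a := by
        rcases cases_of_up ha hz with h3 | h3 | h3
        · have := hu.unique h3
          subst this
          rcases cases_of_comp_eq (S := S) hua rfl with h4 | h4 | h4
          · exact absurd h4.2.1 (by omega)
          · exact absurd h4.2.1 (by omega)
          · have := h4.2.2
            unfold GridAdj at this
            omega
        · have h5 := hu.2.1
          have h6 := h3.2.1
          rcases cases_of_comp_eq (S := S) hua (cu.trans ca.symm) with h4 | h4 | h4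
          · exact absurd h4.2.1 (by omega)
          · exact absurd h4.2.1 (by omega)
          · exact absurd h4.2.1 (by omega)
        · exact h3
      exact hub (hu.unique (hside hpa hb (fun _ => hab) ca cb))
    · exact hu
    -- If `u` were lateral to `p`, both of its cycle neighbours `a` and `d` would be the parent of
    -- `p`.
    · exact absurd ((hside hu ha (fun _ => hua) cu ca).unique
        (hside hu hd (fun _ => hsymm hdu) cu cd)) had
  · intro hu
    have hz : S.Z p ≠ 0 := by have := hu.2.1; omega
    have h1 := hu.2.2.1
    have h2 := hu.2.2.2
    -- The two columns of children are `2 * S.X p` and `2 * S.X p + 1`, with sum `4 * S.X p + 1`;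
    -- subtracting from this sum reflects `u` to the other column, and likewise for rows.
    obtain ⟨a, ha, ha1, ha2⟩ := exists_child hz (a := 4 * S.X p + 1 - S.X u) (b := S.Y u)
      (by omega) (by omega)
    obtain ⟨b, hb, hb1, hb2⟩ := exists_child hz (a := 4 * S.X p + 1 - S.X u)
      (b := 4 * S.Y p + 1 - S.Y u) (by omega) (by omega)
    obtain ⟨d, hd, hd1, hd2⟩ := exists_child hz (a := S.X u) (b := 4 * S.Y p + 1 - S.Y u)
      (by omega) (by omega)
    have hadj {c : V} (hc : S.Up c p) : A p c := adj_cases_iff.mpr (.inr (.inl hc))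
    have hlat {c c' : V} (hc : S.Up c p) (hc' : S.Up c' p)
        (hg : GridAdj (S.X c) (S.Y c) (S.X c') (S.Y c')) : A c c' :=
      adj_cases_iff.mpr (.inr (.inr (.inl ⟨hc'.1.symm.trans hc.1,
        by have := hc.2.1; have := hc'.2.1; omega, hg⟩)))
    refine ⟨hadj hu, (label_eq_none (S := S)).mpr hz, a, hadj ha, b, hadj hb, d, hadj hd,
      hlat hu ha ?_, hlat ha hb ?_, hlat hb hd ?_, hlat hd hu ?_, ?_, ?_⟩
    · unfold GridAdj; omega
    · unfold GridAdj; omega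
    · unfold GridAdj; omega
    · unfold GridAdj; omega
    · rintro rfl
      omega
    · rintro rfl
      omega

theorem Side.lt_height (hl : S.Side u w) : S.Z u < pyramidHeight h (S.comp u) := by
  refine lt_of_le_of_ne (S.Z_le u) fun he => ?_
  have h1 := S.X_lt u
  have h2 := S.Y_lt u
  have h3 := S.X_lt w
  have h4 := S.Y_lt w
  obtain ⟨h5, h6, h7⟩ := hl
  rw [h5, h6] at h3 h4
  rw [he, Nat.sub_self, pow_zero] at h1 h2 h3 h4
  unfold GridAdj at h7
  omega

theorem Side.parents (hl : S.Side u w) (hp : S.Up u p) (hq : S.Up w q) : p = q ∨ S.Side p q := by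
  by_cases he : S.X p = S.X q ∧ S.Y p = S.Y q
  · exact .inl (S.ext (hp.1.trans (hl.1.symm.trans hq.1.symm)) he.1 he.2
      (by have := hp.2.1; have := hq.2.1; have := hl.2.1; omega))
  · refine .inr ⟨hq.1.trans (hl.1.trans hp.1.symm), ?_, ?_⟩
    · have := hp.2.1; have := hq.2.1; have := hl.2.1; omega
    · obtain ⟨_, _, h1⟩ := hl
      obtain ⟨_, _, h2⟩ := hp
      obtain ⟨_, _, h3⟩ := hq
      unfold GridAdj at *
      omega

/-- Parents lie in upper layers, which no pivot edge meets; equal or adjacent parents therefore keep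
`u` and `w` in one pyramid. -/
theorem lateral_iff : Lateral A L u w ↔ S.Side u w := by
  unfold Lateral
  simp only [isParent_iff (S := S)]
  constructor
  · rintro ⟨h1, h2, h3, p, hp, q, hq, h4, h5, h6⟩
    have hc : S.comp u = S.comp w := by
      rw [← h4.1, ← h5.1]
      rcases h6 with rfl | h6
      · rfl
      · exact (comp_eq_of_up h6 (by have := h4.2.1; omega)).symm
    exact ((cases_of_comp_eq h1 hc).resolve_left h2).resolve_left h3
  · intro hl
    obtain ⟨p, hp⟩ := exists_up hl.lt_height
    obtain ⟨q, hq⟩ := exists_up hl.symm.lt_height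
    have hadj {u w : V} (hl : S.Side u w) : A u w := adj_cases_iff.mpr (.inr (.inr (.inl hl)))
    exact ⟨hadj hl, not_up_self_side hl, not_up_self_side hl.symm, p, adj_cases_iff.mpr (.inl hp),
      q, adj_cases_iff.mpr (.inl hq), hp, hq, (hl.parents hp hq).imp_right hadj⟩

theorem foreign_iff : Foreign A L u w ↔ S.Cross u w ∨ S.Cross w u := by
  unfold Foreign
  rw [isParent_iff (S := S), isParent_iff (S := S), lateral_iff (S := S)]
  constructor
  · rintro ⟨h1, h2, h3, h4⟩
    exact (((adj_cases_iff.mp h1).resolve_left h2).resolve_left h3).resolve_left h4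
  · intro hc
    have hne : S.comp u ≠ S.comp w := hc.elim (fun h => h.comp_ne) fun h => h.comp_ne.symm
    exact ⟨adj_cases_iff.mpr (.inr (.inr (.inr hc))), fun h => hne h.1.symm, fun h => hne h.1,
      fun h => hne h.1.symm⟩

end InstanceLayout

end LocalDecision

namespace LocalDecision

/-! ### Rows of execution tables -/

theorem step_eq_some {M : Machine} {C C' : Config} (hs : C.step M = some C') :
    ∃ b m, transition M C.state (C.tape C.pos) = some (C'.state, b, m) ∧
      C'.tape = Function.update C.tape C.pos b ∧ C'.arrived = m ∧
      ((m = .left ∧ C'.pos + 1 = C.pos) ∨ (m = .stay ∧ C'.pos = C.pos) ∨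
        (m = .right ∧ C'.pos = C.pos + 1)) := by
  unfold Config.step at hs
  rcases ht : transition M C.state (C.tape C.pos) with _ | ⟨q, b, _ | _ | _⟩ <;>
    simp only [ht] at hs
  · cases hs
  · split_ifs at hs with h0
    obtain rfl := Option.some.inj hs
    exact ⟨b, _, rfl, rfl, rfl, .inl ⟨rfl, Nat.sub_add_cancel (Nat.pos_of_ne_zero h0)⟩⟩
  · obtain rfl := Option.some.inj hs
    exact ⟨b, _, rfl, rfl, rfl, .inr (.inl ⟨rfl, rfl⟩)⟩
  · obtain rfl := Option.some.inj hs
    exact ⟨b, _, rfl, rfl, rfl, .inr (.inr ⟨rfl, rfl⟩)⟩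

section

variable {M : Machine} {C C' : Config}

theorem not_isHalted_of_step (hs : C.step M = some C') (X : ℕ) :
    ¬ IsHalted M (C.cellContent X) := by
  obtain ⟨b, m, ht, _⟩ := step_eq_some hs
  rw [isHalted_cellContent, ht]
  exact fun h => nomatch h.2

theorem symbol_step (hs : C.step M = some C') (X : ℕ) :
    (C'.cellContent X).1 = written M (C.cellContent X) := by
  obtain ⟨b, m, ht, h2, _⟩ := step_eq_some hs
  rw [written_cellContent ht, ← h2]
  rfl

theorem arrival_step (hs : C.step M = some C') (m : Move) {X X' : ℕ}
    (hX : (m = .left ∧ X + 1 = X') ∨ (m = .stay ∧ X = X') ∨ (m = .right ∧ X = X' + 1)) :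
    arrival m (C'.cellContent X) = emission M m (C.cellContent X') := by
  obtain ⟨b, m', ht, _, rfl, h4⟩ := step_eq_some hs
  rw [emission_cellContent ht, arrival_cellContent]
  refine if_congr (and_congr_left fun hm => ?_) rfl rfl
  rw [hm] at h4
  rcases hX with ⟨rfl, hX⟩ | ⟨rfl, hX⟩ | ⟨rfl, hX⟩
  · simp only [true_and, reduceCtorEq, false_and, or_false] at h4
    omega
  · simp only [true_and, reduceCtorEq, false_and, or_false, false_or] at h4
    omega
  · simp only [true_and, reduceCtorEq, false_and, false_or] at h4
    omega

theorem arrival_right_step (hs : C.step M = some C') : arrival .right (C'.cellContent 0) = none := by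
  obtain ⟨b, m', ht, _, h3, h4⟩ := step_eq_some hs
  rw [arrival_cellContent, if_neg]
  rintro ⟨h5, h6⟩
  rw [← h3, h6] at h4
  simp only [true_and, reduceCtorEq, false_and, false_or] at h4
  omega

theorem emission_left_step (hs : C.step M = some C') : emission M .left (C.cellContent 0) = none := by
  obtain ⟨b, m', ht, _, h3, h4⟩ := step_eq_some hs
  rw [emission_cellContent ht, if_neg]
  rintro ⟨h5, h6⟩
  rw [h6] at h4
  simp only [true_and, reduceCtorEq, false_and, or_false] at h4
  omega

theorem pos_step (hs : C.step M = some C') : C'.pos ≤ C.pos + 1 := by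
  obtain ⟨b, m', ht, _, h3, h4⟩ := step_eq_some hs
  omega

theorem emission_eq_none_of_halted (ht : transition M C.state (C.tape C.pos) = none) (m : Move)
    (X : ℕ) : emission M m (C.cellContent X) = none := by
  unfold emission action Config.cellContent
  by_cases h1 : C.pos = X
  · subst h1; simp [ht]
  · simp [h1]

theorem configAt_succ {y : ℕ} : configAt M (y + 1) = some C' ↔
    ∃ C, configAt M y = some C ∧ C.step M = some C' := by
  rw [configAt, Option.bind_eq_some_iff]

theorem exists_configAt {s y : ℕ} (h : configAt M s = some C') (hy : y ≤ s) :
    ∃ C, configAt M y = some C := by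
  induction s generalizing C' with
  | zero => exact ⟨C', by rwa [Nat.le_zero.mp hy]⟩
  | succ s ih =>
    rcases Nat.lt_or_eq_of_le hy with hlt | rfl
    · obtain ⟨C, hC, _⟩ := configAt_succ.mp h
      exact ih hC (by omega)
    · exact ⟨_, h⟩

/-- The head advances by at most one cell per step. Thus `s + 1` columns suffice for `s` steps. -/
theorem pos_configAt {y : ℕ} (h : configAt M y = some C') : C'.pos ≤ y := by
  induction y generalizing C' with
  | zero =>
    obtain rfl := Option.some.inj h
    exact le_rfl
  | succ y ih =>
    obtain ⟨C, hC, hs⟩ := configAt_succ.mp h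
    exact (pos_step hs).trans (Nat.succ_le_succ (ih hC))

end

/-! ### Blank fragments -/

theorem not_isHalted_none {M : Machine} {a : ℕ} : ¬ IsHalted M (a, none) :=
  fun h => Bool.false_ne_true h.1

/-- The fragment without heads and with blank symbols only. -/
def blankFragment (M : Machine) (r a : ℕ) : Fragment M r where
  labelling x y := (mod3 (a + x) (0 + y), (0, none))
  consistent := {
    symbols_mem := fun _ _ => List.mem_cons_self
    states_mem := fun _ _ _ _ h => nomatch h
    orientation := ⟨a, 0, fun _ _ => rfl⟩
    windows := fun x y x' y' _ _ => windowConsistent_iff.mpr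
      ⟨⟨not_isHalted_none, not_isHalted_none, rfl, rfl⟩, ⟨rfl, rfl, rfl, rfl⟩,
        ⟨(0, none), rfl⟩, (0, none), rfl⟩ }
  nonNatural := {.top}
  borderChoice := by
    have hl : Labelling.Natural M (fun x y : Fin (2 ^ (3 * r)) =>
        (mod3 (a + x) (0 + y), (0, none))) .left :=
      fun x y _ => ⟨fun q => nofun, fun q => nofun⟩
    have hr : Labelling.Natural M (fun x y : Fin (2 ^ (3 * r)) =>
        (mod3 (a + x) (0 + y), (0, none))) .right :=
      fun x y _ => ⟨fun q => nofun, fun q => nofun⟩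
    have hb : Labelling.Natural M (fun x y : Fin (2 ^ (3 * r)) =>
        (mod3 (a + x) (0 + y), (0, none))) .bottom :=
      fun x y _ h => nomatch h
    refine borderChoice_iff.mpr ⟨rfl, .inr ⟨fun h => h.2.2 hb, ?_, ?_, ?_⟩⟩
    · exact iff_of_false nofun (fun h => h hl)
    · exact iff_of_false nofun (fun h => h hr)
    · exact iff_of_false nofun (fun h => h hb)

/-- Two shifts of the coordinates of the blank fragment differ even for side 1. Consequently the
pivot has at least two foreign edges and does not look attached. -/
theorem exists_fragment_ne (M : Machine) (r : ℕ) : ∃ F F' : Fragment M r, F ≠ F' := by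
  refine ⟨blankFragment M r 0, blankFragment M r 1, fun h => ?_⟩
  have h1 := congrArg Fragment.labelling h
  have h2 := congrFun (congrFun h1 ⟨0, by positivity⟩) ⟨0, by positivity⟩
  have h3 := congrArg Fin.val (congrArg (fun c : Cell => c.1.1) h2)
  simp [blankFragment, mod3, Fin.ofNat] at h3

theorem mod3_eq_iff {a b c d : ℕ} : mod3 a b = mod3 c d ↔ a % 3 = c % 3 ∧ b % 3 = d % 3 := by
  simp [mod3, Fin.ofNat]

namespace InstanceLayout

variable {V : Type} {A : V → V → Prop} {L : V → Label} {M : Machine} {r h : ℕ}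
  {S : InstanceLayout A L M r h} {u w v : V}

/-! ### Attached nodes and borders -/

theorem exists_base (c : Option (Fragment M r)) {a b : ℕ} (ha : a < 2 ^ pyramidHeight h c)
    (hb : b < 2 ^ pyramidHeight h c) :
    ∃ v, S.comp v = c ∧ S.X v = a ∧ S.Y v = b ∧ S.Z v = 0 :=
  S.exists_node c a b 0 (Nat.zero_le _) ha hb

theorem X_lt_of_base (hz : S.Z v = 0) : S.X v < 2 ^ pyramidHeight h (S.comp v) := by
  have := S.X_lt v
  rwa [hz, Nat.sub_zero] at this

theorem Y_lt_of_base (hz : S.Z v = 0) : S.Y v < 2 ^ pyramidHeight h (S.comp v) := by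
  have := S.Y_lt v
  rwa [hz, Nat.sub_zero] at this

theorem adj_of_cross (h : S.Cross u w) : A u w := adj_cases_iff.mpr (.inr (.inr (.inr (.inl h))))

theorem adj_symm (S : InstanceLayout A L M r h) (ha : A u w) : A w u := by
  rw [S.adj_iff] at ha ⊢
  tauto

/-- The pivot is excluded because it is joined to the corners of two different fragments; a border
node has no other foreign edge than the one to the pivot. -/
theorem attached_iff : Attached A L v ↔ ∃ F, S.comp v = some F ∧ S.Z v = 0 ∧
    BorderCode.OnBorder (2 ^ (3 * r)) (FragmentCode.ofFragment F, (S.X v, S.Y v)) := by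
  unfold Attached
  simp only [foreign_iff (S := S)]
  constructor
  · rintro ⟨p, _, hp | hp, hall⟩
    · exfalso
      obtain ⟨F, F', hne⟩ := exists_fragment_ne M r
      have hcr (F : Fragment M r) : ∃ w, S.comp w = some F ∧ S.Cross v w := by
        obtain ⟨w, h1, h2, h3, h4⟩ := S.exists_base (some F) (a := 0) (b := 0)
          (by positivity) (by positivity)
        exact ⟨w, h1, S.cross_iff.mpr ⟨(S.cross_iff.mp hp).1, F, h1, h4,
          by rw [h2, h3]; exact BorderCode.onBorder_zero _ (by positivity) _⟩⟩
      obtain ⟨w, h1, h2⟩ := hcr F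
      obtain ⟨w', h1', h2'⟩ := hcr F'
      have e1 := hall w (adj_of_cross h2) (.inl h2)
      have e2 := hall w' (adj_of_cross h2') (.inl h2')
      rw [e1] at h1
      rw [e2, h1] at h1'
      exact hne (Option.some.inj h1')
    · exact (S.cross_iff.mp hp).2
  · intro hF
    obtain ⟨p, h1, h2, h3, h4⟩ := S.exists_base none (a := 0) (b := 0)
      (by positivity) (by positivity)
    have hp : S.Cross p v := S.cross_iff.mpr ⟨⟨h1, h2, h3, h4⟩, hF⟩
    refine ⟨p, S.adj_symm (adj_of_cross hp) , .inr hp, ?_⟩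
    rintro q _ (hq | hq)
    · obtain ⟨F, hF, _⟩ := hF
      rw [(S.cross_iff.mp hq).1.1] at hF
      cases hF
    · obtain ⟨h5, h6, h7, h8⟩ := (S.cross_iff.mp hq).1
      exact S.ext (h5.trans h1.symm) (h6.trans h2.symm) (h7.trans h3.symm) (h8.trans h4.symm)

theorem content_fragment {F : Fragment M r} (hc : S.comp v = some F) (hz : S.Z v = 0) :
    cellOf (L v) = (FragmentCode.ofFragment F).cell (S.X v) (S.Y v) := by
  rw [cellOf, S.label_fragment hc hz]
  rfl

theorem content_table {C : Config} (hc : S.comp v = none) (hz : S.Z v = 0)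
    (hC : configAt M (S.Y v) = some C) : content (L v) = C.cellContent (S.X v) := by
  rw [content, cellOf, S.label_table hc hz, tableCell_eq hC]
  rfl

theorem exists_coords (S : InstanceLayout A L M r h) (c : Option (Fragment M r)) :
    ∃ a b, ∀ v, S.comp v = c → S.Z v = 0 → coords (L v) = mod3 (a + S.X v) (b + S.Y v) := by
  rcases c with _ | F
  · refine ⟨0, 0, fun v hc hz => ?_⟩
    rw [coords, cellOf, S.label_table hc hz, zero_add, zero_add]
    rfl
  · obtain ⟨a, b, hab⟩ := (FragmentCode.valid_ofFragment F).exists_coords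
    refine ⟨a, b, fun v hc hz => ?_⟩
    have hX := X_lt_of_base hz
    have hY := Y_lt_of_base hz
    rw [hc] at hX hY
    rw [coords, content_fragment hc hz, hab _ hX _ hY]

theorem coords_up (hz : S.Z v ≠ 0) : coords (L v) = (0, 0) := by
  rw [coords, cellOf, S.label_up hz]
  rfl

theorem east_iff : East A L u w ↔ (S.comp w = S.comp u ∧ S.Z u = 0 ∧ S.Z w = 0) ∧
    S.X w = S.X u + 1 ∧ S.Y w = S.Y u := by
  rw [East, lateral_iff (S := S), LabelRel.EastOf]
  obtain ⟨a, b, hab⟩ := S.exists_coords (S.comp u)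
  constructor
  · rintro ⟨⟨h1, h2, h3⟩, h4⟩
    -- Nodes of upper layers all have the default coordinates, and these are not east of themselves.
    have hz : S.Z u = 0 := by
      by_contra hz
      rw [coords_up hz, coords_up (h2 ▸ hz)] at h4
      revert h4
      decide
    have hz' := h2.trans hz
    rw [hab u rfl hz, hab w h1 hz', ← Accepted.eastOf_mod3, mod3_eq_iff] at h4
    unfold GridAdj at h3
    exact ⟨⟨h1, hz, hz'⟩, by omega⟩
  · rintro ⟨⟨h1, hz, hz'⟩, h2, h3⟩
    refine ⟨⟨h1, hz'.trans hz.symm, .inl ⟨h2, h3⟩⟩, ?_⟩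
    rw [hab u rfl hz, hab w h1 hz', ← Accepted.eastOf_mod3, h2, h3, add_assoc]

theorem south_iff : South A L u w ↔ (S.comp w = S.comp u ∧ S.Z u = 0 ∧ S.Z w = 0) ∧
    S.X w = S.X u ∧ S.Y w = S.Y u + 1 := by
  rw [South, lateral_iff (S := S), LabelRel.SouthOf]
  obtain ⟨a, b, hab⟩ := S.exists_coords (S.comp u)
  constructor
  · rintro ⟨⟨h1, h2, h3⟩, h4⟩
    have hz : S.Z u = 0 := by
      by_contra hz
      rw [coords_up hz, coords_up (h2 ▸ hz)] at h4
      revert h4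
      decide
    have hz' := h2.trans hz
    rw [hab u rfl hz, hab w h1 hz', ← Accepted.southOf_mod3, mod3_eq_iff] at h4
    unfold GridAdj at h3
    exact ⟨⟨h1, hz, hz'⟩, by omega⟩
  · rintro ⟨⟨h1, hz, hz'⟩, h2, h3⟩
    refine ⟨⟨h1, hz'.trans hz.symm, .inr (.inl ⟨h2, h3⟩)⟩, ?_⟩
    rw [hab u rfl hz, hab w h1 hz', ← Accepted.southOf_mod3, h2, h3, add_assoc]

theorem noEast_iff (hz : S.Z v = 0) :
    NoEast A L v ↔ S.X v + 1 = 2 ^ pyramidHeight h (S.comp v) := by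
  have hX := X_lt_of_base hz
  constructor
  · intro h1
    by_contra hne
    obtain ⟨w, h2, h3, h4, h5⟩ := S.exists_base (S.comp v) (a := S.X v + 1) (b := S.Y v)
      (by omega) (Y_lt_of_base hz)
    have he : East A L v w := S.east_iff.mpr ⟨⟨h2, hz, h5⟩, h3, h4⟩
    exact h1 w he.1.1 he
  · rintro h1 w _ hw
    obtain ⟨⟨h2, _, h3⟩, h4, _⟩ := S.east_iff.mp hw
    have := X_lt_of_base h3
    rw [h2] at this
    omega

theorem noSouth_iff (hz : S.Z v = 0) :
    NoSouth A L v ↔ S.Y v + 1 = 2 ^ pyramidHeight h (S.comp v) := by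
  have hY := Y_lt_of_base hz
  constructor
  · intro h1
    by_contra hne
    obtain ⟨w, h2, h3, h4, h5⟩ := S.exists_base (S.comp v) (a := S.X v) (b := S.Y v + 1)
      (X_lt_of_base hz) (by omega)
    have he : South A L v w := S.south_iff.mpr ⟨⟨h2, hz, h5⟩, h3, h4⟩
    exact h1 w he.1.1 he
  · rintro h1 w _ hw
    obtain ⟨⟨h2, _, h3⟩, _, h4⟩ := S.south_iff.mp hw
    have := Y_lt_of_base h3
    rw [h2] at this
    omega

theorem noWest_iff (hz : S.Z v = 0) : NoWest A L v ↔ S.X v = 0 := by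
  have hX := X_lt_of_base hz
  constructor
  · intro h1
    by_contra hne
    obtain ⟨w, h2, h3, h4, h5⟩ := S.exists_base (S.comp v) (a := S.X v - 1) (b := S.Y v)
      (by omega) (Y_lt_of_base hz)
    have he : East A L w v := S.east_iff.mpr ⟨⟨h2.symm, h5, hz⟩, by omega, h4.symm⟩
    exact h1 w (S.adj_symm he.1.1) he
  · rintro h1 w _ hw
    obtain ⟨_, h4, _⟩ := S.east_iff.mp hw
    omega

theorem noNorth_iff (hz : S.Z v = 0) : NoNorth A L v ↔ S.Y v = 0 := by
  have hY := Y_lt_of_base hz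
  constructor
  · intro h1
    by_contra hne
    obtain ⟨w, h2, h3, h4, h5⟩ := S.exists_base (S.comp v) (a := S.X v) (b := S.Y v - 1)
      (X_lt_of_base hz) (by omega)
    have he : South A L w v := S.south_iff.mpr ⟨⟨h2.symm, h5, hz⟩, h3.symm, by omega⟩
    exact h1 w (S.adj_symm he.1.1) he
  · rintro h1 w _ hw
    obtain ⟨_, _, h4⟩ := S.south_iff.mp hw
    omega

end InstanceLayout

end LocalDecision

namespace LocalDecision

namespace InstanceLayout

variable {V : Type} {A : V → V → Prop} {L : V → Label} {M : Machine} {r h s : ℕ}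
  {S : InstanceLayout A L M r h} {u w v p : V}

/-! ### The rules for pyramids -/

theorem adj_symm_of_up (hp : S.Up u p) : A p u := adj_cases_iff.mpr (.inr (.inl hp))

theorem side_of_up {u' p' : V} (hu : S.Up u p) (hu' : S.Up u' p') (hc : S.comp p' = S.comp p)
    (hz : S.Z p' = S.Z p) (hg : GridAdj (S.X u) (S.Y u) (S.X u') (S.Y u')) : S.Side u u' :=
  ⟨hu'.1.symm.trans (hc.trans hu.1), by have := hu.2.1; have := hu'.2.1; omega, hg⟩

theorem children_rule (S : InstanceLayout A L M r h) (hv : (L v).2 = none) :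
    ∃ a, A v a ∧ ∃ b, A v b ∧ ∃ c, A v c ∧ ∃ d, A v d ∧
    (IsParent A L a v ∧ IsParent A L b v ∧ IsParent A L c v ∧ IsParent A L d v ∧
      Lateral A L a b ∧ Lateral A L b c ∧ Lateral A L c d ∧ Lateral A L d a ∧
      ¬ a = c ∧ ¬ b = d ∧ ∀ e, A v e → IsParent A L e v → e = a ∨ e = b ∨ e = c ∨ e = d) := by
  have hz := (label_eq_none (S := S)).mp hv
  simp only [isParent_iff (S := S), lateral_iff (S := S)]
  obtain ⟨a, ha, ha1, ha2⟩ := exists_child hz (a := 2 * S.X v) (b := 2 * S.Y v)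
    (by omega) (by omega)
  obtain ⟨b, hb, hb1, hb2⟩ := exists_child hz (a := 2 * S.X v + 1) (b := 2 * S.Y v)
    (by omega) (by omega)
  obtain ⟨c, hc, hc1, hc2⟩ := exists_child hz (a := 2 * S.X v + 1) (b := 2 * S.Y v + 1)
    (by omega) (by omega)
  obtain ⟨d, hd, hd1, hd2⟩ := exists_child hz (a := 2 * S.X v) (b := 2 * S.Y v + 1)
    (by omega) (by omega)
  refine ⟨a, adj_symm_of_up ha, b, adj_symm_of_up hb, c, adj_symm_of_up hc, d, adj_symm_of_up hd, ha, hb, hc, hd,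
    side_of_up ha hb rfl rfl ?_, side_of_up hb hc rfl rfl ?_, side_of_up hc hd rfl rfl ?_,
    side_of_up hd ha rfl rfl ?_, ?_, ?_, fun e _ he => ?_⟩
  · unfold GridAdj; omega
  · unfold GridAdj; omega
  · unfold GridAdj; omega
  · unfold GridAdj; omega
  · rintro rfl
    omega
  · rintro rfl
    omega
  · have hext {a : V} (ha : S.Up a v) (h1 : S.X e = S.X a) (h2 : S.Y e = S.Y a) : e = a :=
      S.ext (he.1.symm.trans ha.1) h1 h2 (by have := he.2.1; have := ha.2.1; omega)
    obtain ⟨_, _, h1, h2⟩ := id he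
    have h3 : S.X e = 2 * S.X v ∨ S.X e = 2 * S.X v + 1 := by omega
    have h4 : S.Y e = 2 * S.Y v ∨ S.Y e = 2 * S.Y v + 1 := by omega
    rcases h3 with h3 | h3 <;> rcases h4 with h4 | h4
    · exact .inl (hext ha (by omega) (by omega))
    · exact .inr (.inr (.inr (hext hd (by omega) (by omega))))
    · exact .inr (.inl (hext hb (by omega) (by omega)))
    · exact .inr (.inr (.inl (hext hc (by omega) (by omega))))

theorem lateral_children_rule (hl : S.Side v u) (hv : (L v).2 = none) :
    ∃ a, A v a ∧ ∃ b, A u b ∧ ∃ a', A v a' ∧ ∃ b', A u b' ∧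
      (IsParent A L a v ∧ IsParent A L b u ∧ IsParent A L a' v ∧ IsParent A L b' u ∧
        Lateral A L a b ∧ Lateral A L a' b' ∧ Lateral A L a a' ∧ Lateral A L b b') := by
  have hz := (label_eq_none (S := S)).mp hv
  simp only [isParent_iff (S := S), lateral_iff (S := S)]
  obtain ⟨h1, h2, h3⟩ := hl
  -- It suffices to name positions of four children; each of the four directions has its own pair of
  -- facing sides.
  have key : ∀ a1 a2 b1 b2 a1' a2' b1' b2' : ℕ,
      (a1 / 2 = S.X v ∧ a2 / 2 = S.Y v ∧ b1 / 2 = S.X u ∧ b2 / 2 = S.Y u) →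
      (a1' / 2 = S.X v ∧ a2' / 2 = S.Y v ∧ b1' / 2 = S.X u ∧ b2' / 2 = S.Y u) →
      (GridAdj a1 a2 b1 b2 ∧ GridAdj a1' a2' b1' b2' ∧ GridAdj a1 a2 a1' a2' ∧
        GridAdj b1 b2 b1' b2') →
      ∃ a, A v a ∧ ∃ b, A u b ∧ ∃ a', A v a' ∧ ∃ b', A u b' ∧
      (S.Up a v ∧ S.Up b u ∧ S.Up a' v ∧ S.Up b' u ∧
        S.Side a b ∧ S.Side a' b' ∧ S.Side a a' ∧ S.Side b b') := by
    rintro a1 a2 b1 b2 a1' a2' b1' b2' ⟨e1, e2, e3, e4⟩ ⟨e5, e6, e7, e8⟩ ⟨g1, g2, g3, g4⟩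
    obtain ⟨a, ha, rfl, rfl⟩ := exists_child hz e1 e2
    obtain ⟨b, hb, rfl, rfl⟩ := exists_child (h2 ▸ hz) e3 e4
    obtain ⟨a', ha', rfl, rfl⟩ := exists_child hz e5 e6
    obtain ⟨b', hb', rfl, rfl⟩ := exists_child (h2 ▸ hz) e7 e8
    exact ⟨a, adj_symm_of_up ha, b, adj_symm_of_up hb, a', adj_symm_of_up ha', b', adj_symm_of_up hb',
      ha, hb, ha', hb', side_of_up ha hb h1 h2 g1, side_of_up ha' hb' h1 h2 g2,
      side_of_up ha ha' rfl rfl g3, side_of_up hb hb' rfl rfl g4⟩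
  unfold GridAdj at *
  rcases h3 with ⟨h3, h4⟩ | ⟨h3, h4⟩ | ⟨h3, h4⟩ | ⟨h3, h4⟩
  · refine key (2 * S.X v + 1) (2 * S.Y v) (2 * S.X v + 2) (2 * S.Y v)
      (2 * S.X v + 1) (2 * S.Y v + 1) (2 * S.X v + 2) (2 * S.Y v + 1) ?_ ?_ ?_ <;> omega
  · refine key (2 * S.X v) (2 * S.Y v + 1) (2 * S.X v) (2 * S.Y v + 2)
      (2 * S.X v + 1) (2 * S.Y v + 1) (2 * S.X v + 1) (2 * S.Y v + 2) ?_ ?_ ?_ <;> omega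
  · refine key (2 * S.X v) (2 * S.Y v) (2 * S.X u + 1) (2 * S.Y v)
      (2 * S.X v) (2 * S.Y v + 1) (2 * S.X u + 1) (2 * S.Y v + 1) ?_ ?_ ?_ <;> omega
  · refine key (2 * S.X v) (2 * S.Y v) (2 * S.X v) (2 * S.Y u + 1)
      (2 * S.X v + 1) (2 * S.Y v) (2 * S.X v + 1) (2 * S.Y u + 1) ?_ ?_ ?_ <;> omega

theorem lateral_coords_rule (hl : S.Side v u) (hz : S.Z v = 0) :
    LabelRel.Neighbours (L v) (L u) ∧ ∀ w, S.Side v w → coords (L u) = coords (L w) → u = w := by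
  obtain ⟨h1, h2, h3⟩ := hl
  obtain ⟨a, b, hab⟩ := S.exists_coords (S.comp v)
  have hz' := h2.trans hz
  constructor
  · unfold LabelRel.Neighbours LabelRel.EastOf LabelRel.SouthOf
    rw [hab v rfl hz, hab u h1 hz', ← Accepted.eastOf_mod3, ← Accepted.southOf_mod3,
      ← Accepted.eastOf_mod3, ← Accepted.southOf_mod3]
    simp only [mod3_eq_iff]
    unfold GridAdj at h3
    omega
  · rintro w ⟨h4, h5, h6⟩ he
    rw [hab u h1 hz', hab w h4 (h5.trans hz), mod3_eq_iff] at he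
    unfold GridAdj at h3 h6
    exact S.ext (h1.trans h4.symm) (by omega) (by omega) (h2.trans h5.symm)

/-! ### The rules for tables -/

/-- The top row of every fragment is attached to the pivot, so an unattached top row belongs to the
execution table. -/
theorem comp_eq_none (hz : S.Z v = 0) (ha : ¬ Attached A L v) (hn : S.Y v = 0) :
    S.comp v = none := by
  rcases hc : S.comp v with _ | F
  · rfl
  · refine absurd (S.attached_iff.mpr ⟨F, hc, hz, ?_⟩) ha
    have hX := X_lt_of_base hz
    have hY := Y_lt_of_base hz
    rw [hc] at hX hY
    exact ⟨hX, hY, .inl hn⟩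

theorem top_rule (hz : S.Z v = 0) (ha : ¬ Attached A L v) (hn : S.Y v = 0) :
    (S.X v = 0 → LabelRel.Corner (L v) (L v)) ∧ (¬ S.X v = 0 → LabelRel.BlankTop (L v) (L v)) := by
  have hc := comp_eq_none hz ha hn
  have hl : cellOf (L v) = tableCell M (S.X v) 0 := by
    rw [cellOf, S.label_table hc hz, hn]
    rfl
  constructor
  · intro hX
    rw [LabelRel.Corner, hl, hX]
    rfl
  · intro hX
    rw [LabelRel.BlankTop, coords, content, hl]
    exact ⟨rfl, Prod.ext rfl (if_neg (Ne.symm hX))⟩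

theorem window_fragment (F : Fragment M r) {X Y : ℕ} (hX : X + 1 < 2 ^ (3 * r))
    (hY : Y + 1 < 2 ^ (3 * r)) :
    WindowConsistent M ((FragmentCode.ofFragment F).cell X Y).2
      ((FragmentCode.ofFragment F).cell (X + 1) Y).2
      ((FragmentCode.ofFragment F).cell X (Y + 1)).2
      ((FragmentCode.ofFragment F).cell (X + 1) (Y + 1)).2 :=
  (FragmentCode.valid_ofFragment F).consistent.windows ⟨X, by omega⟩ ⟨Y, by omega⟩ ⟨X + 1, hX⟩
    ⟨Y + 1, hY⟩ rfl rfl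

theorem below_rule (hs : s + 1 = 2 ^ h) {o : ℕ} (ho : HaltsWithOutput M s o)
    (hsouth : S.comp u = S.comp v ∧ S.Z v = 0 ∧ S.Z u = 0) (hX : S.X u = S.X v)
    (hY : S.Y u = S.Y v + 1) :
    LabelRel.Below (L v) (L u) ∧ ∀ w, S.comp w = S.comp v → S.Z w = 0 → S.Y w = S.Y v →
      (S.X v = S.X w + 1 → LabelRel.FromLeft (L w) (L u)) ∧
      (S.X w = S.X v + 1 → LabelRel.FromRight (L w) (L u)) := by
  have hM (v : V) : (L v).1.1 = M := congrArg Prod.fst (S.param v)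
  obtain ⟨hcu, hz, hzu⟩ := hsouth
  have hYlt := Y_lt_of_base hzu
  have hXlt := X_lt_of_base hz
  unfold LabelRel.Below LabelRel.FromLeft LabelRel.FromRight
  simp only [hM]
  rcases hc : S.comp v with _ | F
  · rw [hc] at hcu
    rw [hcu, hY] at hYlt
    change _ < 2 ^ h at hYlt
    obtain ⟨Cs, hCs, _⟩ := ho
    obtain ⟨C', hC'⟩ := exists_configAt hCs (y := S.Y v + 1) (by omega)
    obtain ⟨C, hC, hst⟩ := configAt_succ.mp hC'
    rw [content_table hc hz hC, content_table hcu hzu (hY.symm ▸ hC'), hX]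
    refine ⟨⟨not_isHalted_of_step hst _, symbol_step hst _,
      arrival_step hst _ (.inr (.inl ⟨rfl, rfl⟩))⟩, fun w hcw hzw hYw => ?_⟩
    rw [content_table hcw hzw (hYw.symm ▸ hC)]
    exact ⟨fun h1 => arrival_step hst _ (.inr (.inr ⟨rfl, h1⟩)),
      fun h1 => arrival_step hst _ (.inl ⟨rfl, h1.symm⟩)⟩
  · have hcu' := hcu.trans hc
    rw [hcu', hY] at hYlt
    rw [hc] at hXlt
    change _ < 2 ^ (3 * r) at hYlt hXlt
    have hw {X : ℕ} (hX : X + 1 < 2 ^ (3 * r)) :=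
      windowConsistent_iff.mp (window_fragment F hX hYlt)
    unfold content
    rw [content_fragment hc hz, content_fragment hcu' hzu, hX, hY]
    refine ⟨?_, fun w hcw hzw hYw => ?_⟩
    · rcases hX0 : S.X v with _ | X
      -- The row below exists, so the side is at least two and column 0 is the left half of a
      -- window; every other column is the right half of one.
      · have := hw (X := 0) (by omega)
        exact ⟨this.1.1, this.1.2.2.1, this.2.1.1⟩
      · have := hw (X := X) (by omega)
        exact ⟨this.1.2.1, this.1.2.2.2, this.2.1.2.2.2⟩
    · have hXw := X_lt_of_base hzw
      rw [hcw] at hXw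
      change _ < 2 ^ (3 * r) at hXw
      rw [content_fragment hcw hzw, hYw]
      constructor
      · intro h1
        rw [h1] at hXlt ⊢
        exact (hw hXlt).2.1.2.2.1
      · intro h1
        rw [h1] at hXw ⊢
        exact (hw hXw).2.1.2.1

theorem natural_rule (hs : s + 1 = 2 ^ h) {o : ℕ} (ho : HaltsWithOutput M s o) (hz : S.Z v = 0)
    (ha : ¬ Attached A L v) :
    (S.X v = 0 → LabelRel.NaturalLeft (L v) (L v)) ∧
    (S.X v + 1 = 2 ^ pyramidHeight h (S.comp v) → LabelRel.NaturalRight (L v) (L v)) ∧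
    (S.Y v + 1 = 2 ^ pyramidHeight h (S.comp v) → LabelRel.NaturalBottom (L v) (L v)) := by
  have hM (v : V) : (L v).1.1 = M := congrArg Prod.fst (S.param v)
  have hYlt := Y_lt_of_base hz
  have hXlt := X_lt_of_base hz
  unfold LabelRel.NaturalLeft LabelRel.NaturalRight LabelRel.NaturalBottom
  simp only [hM]
  rcases hc : S.comp v with _ | F
  · rw [hc] at hYlt
    change _ < 2 ^ h at hYlt
    obtain ⟨Cs, hCs, hhalt, _⟩ := ho
    obtain ⟨C, hC⟩ := exists_configAt hCs (y := S.Y v) (by omega)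
    rw [content_table hc hz hC]
    -- In the first row the head has arrived by `stay`, so only rows that result from a step need an
    -- argument.
    have hprev (m : Move) (hm : m ≠ .stay) {X : ℕ} (hX : ∀ y C0, S.Y v = y + 1 →
        configAt M y = some C0 → C0.step M = some C → arrival m (C.cellContent X) = none) :
        arrival m (C.cellContent X) = none := by
      rcases hy : S.Y v with _ | y
      · rw [hy] at hC
        obtain rfl := Option.some.inj hC
        rw [arrival_cellContent, if_neg]
        exact fun h => hm h.2.symm
      · rw [hy] at hC
        obtain ⟨C0, hC0, hst⟩ := configAt_succ.mp hC
        exact hX y C0 hy hC0 hst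
    -- In the last row the machine has halted and emits nothing.
    have hnext (m : Move) {X : ℕ} (hX : ∀ C1, S.Y v < s → C.step M = some C1 →
        emission M m (C.cellContent X) = none) : emission M m (C.cellContent X) = none := by
      rcases Nat.lt_or_ge (S.Y v) s with hlt | hge
      · obtain ⟨C1, hC1⟩ := exists_configAt hCs (y := S.Y v + 1) (by omega)
        obtain ⟨C', hC', hst⟩ := configAt_succ.mp hC1
        obtain rfl := Option.some.inj (hC.symm.trans hC')
        exact hX C1 hlt hst
      · rw [show S.Y v = s by omega, hCs] at hC
        obtain rfl := Option.some.inj hC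
        exact emission_eq_none_of_halted hhalt _ _
    have hpos := pos_configAt hC
    refine ⟨fun h1 => ?_, fun h1 => ?_, fun h1 => ?_⟩
    · rw [h1]
      exact ⟨hprev .right nofun fun y C0 _ _ hst => arrival_right_step hst,
        hnext _ fun C1 _ hst => emission_left_step hst⟩
    · change _ = 2 ^ h at h1
      -- The head is at most at position `y` at time `y`, so it is not in column `s` before the last
      -- row and never beyond that column.
      refine ⟨hprev .left nofun fun y C0 hy hC0 hst => ?_, hnext _ fun C1 hlt hst => ?_⟩
      · have := pos_configAt hC0
        rw [arrival_step hst _ (.inl ⟨rfl, rfl⟩)]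
        obtain ⟨b, m, ht, _⟩ := step_eq_some hst
        rw [emission_cellContent ht, if_neg]
        omega
      · obtain ⟨b, m, ht, _⟩ := step_eq_some hst
        rw [emission_cellContent ht, if_neg]
        omega
    · change _ = 2 ^ h at h1
      intro h2
      rw [show S.Y v = s by omega, hCs] at hC
      obtain rfl := Option.some.inj hC
      refine isHalted_cellContent.mpr ⟨?_, hhalt⟩
      by_contra hne
      exact h2 (if_neg hne)
  · rw [hc] at hXlt hYlt
    change _ < 2 ^ (3 * r) at hXlt hYlt
    unfold content
    rw [content_fragment hc hz]
    have hv := FragmentCode.valid_ofFragment F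
    have hnb : ¬ BorderCode.OnBorder (2 ^ (3 * r)) (FragmentCode.ofFragment F, (S.X v, S.Y v)) :=
      fun hb => ha (S.attached_iff.mpr ⟨F, hc, hz, hb⟩)
    refine ⟨fun h1 => ?_, fun h1 => ?_, fun h1 => ?_⟩
    · have := FragmentCode.natural_left_iff.mp (hv.natural_left fun hl =>
        hnb ⟨hXlt, hYlt, .inr (.inl ⟨hl, h1⟩)⟩) _ (List.mem_range.mpr hYlt)
      rwa [h1]
    · have := FragmentCode.natural_right_iff.mp (hv.natural_right fun hl =>
        hnb ⟨hXlt, hYlt, .inr (.inr (.inl ⟨hl, h1⟩))⟩) _ (List.mem_range.mpr hYlt)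
      rwa [show S.X v = 2 ^ (3 * r) - 1 from Nat.eq_sub_of_add_eq h1]
    · have := FragmentCode.natural_bottom_iff.mp (hv.natural_bottom fun hl =>
        hnb ⟨hXlt, hYlt, .inr (.inr (.inr ⟨hl, h1⟩))⟩) _ (List.mem_range.mpr hXlt)
      rw [show S.Y v = 2 ^ (3 * r) - 1 from Nat.eq_sub_of_add_eq h1]
      exact fun h2 => this (Option.isSome_iff_ne_none.mpr h2)

/-! ### The complete check -/

theorem locallyConsistent (S : InstanceLayout A L M r h) (hs : s + 1 = 2 ^ h) {o : ℕ}
    (ho : HaltsWithOutput M s o) : LocallyConsistent A L := by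
  have hbase {v : V} (hv : ¬ LabelRel.Up (L v) (L v)) : S.Z v = 0 :=
    not_not.mp (mt label_eq_none.mpr hv)
  refine ⟨?_, ?_, ?_, ?_, ?_, ?_, ?_, ?_, ?_, ?_, ?_, ?_, ?_⟩
  · exact fun v u _ => (S.param v).trans (S.param u).symm
  · exact fun v hv => S.children_rule hv
  · intro v p _ q _ hp hq
    exact (isParent_iff.mp hp).unique (S.isParent_iff.mp hq)
  · intro v u _ hl hv
    obtain ⟨_, h2, _⟩ := S.lateral_iff.mp hl
    exact S.label_up (h2 ▸ label_eq_none.mp hv)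
  · intro v u _ p _ q _ hl hp hq
    rw [lateral_iff (S := S)] at hl ⊢
    exact hl.parents (isParent_iff.mp hp) (isParent_iff.mp hq)
  · exact fun v u _ hl hv => S.lateral_children_rule (lateral_iff.mp hl) hv
  · intro v u _ hf hv
    rcases S.foreign_iff.mp hf with hc | hc
    · exact label_eq_none.mp hv hc.left_base
    · exact label_eq_none.mp hv hc.right_base
  · intro v u _ hl hv
    obtain ⟨h1, h2⟩ := S.lateral_coords_rule (lateral_iff.mp hl) (hbase hv)
    exact ⟨h1, fun w _ hw => h2 w (lateral_iff.mp hw)⟩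
  · intro v u _ hf
    rw [attached_iff (S := S), attached_iff (S := S)]
    rcases S.foreign_iff.mp hf with hc | hc
    · obtain ⟨h1, h2⟩ := S.cross_iff.mp hc
      have h3 : ¬ ∃ F, S.comp v = some F ∧ S.Z v = 0 ∧ BorderCode.OnBorder (2 ^ (3 * r))
          (FragmentCode.ofFragment F, (S.X v, S.Y v)) := by
        rintro ⟨F, h3, _⟩
        rw [h1.1] at h3
        cases h3
      exact ⟨fun h4 => absurd h4 h3, fun h4 => absurd h2 h4⟩
    · obtain ⟨h1, h2⟩ := S.cross_iff.mp hc
      have h3 : ¬ ∃ F, S.comp u = some F ∧ S.Z u = 0 ∧ BorderCode.OnBorder (2 ^ (3 * r))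
          (FragmentCode.ofFragment F, (S.X u, S.Y u)) := by
        rintro ⟨F, h3, _⟩
        rw [h1.1] at h3
        cases h3
      exact ⟨fun _ => h3, fun _ => h2⟩
  · intro v hv ha hn
    have hz := hbase hv
    rw [noWest_iff hz]
    exact top_rule hz ha ((noNorth_iff hz).mp hn)
  · intro v u _ ha hf
    rcases S.foreign_iff.mp hf with hc | hc
    · obtain ⟨⟨_, h1, h2, hz⟩, _⟩ := S.cross_iff.mp hc
      exact ⟨(noNorth_iff hz).mpr h2, (noWest_iff hz).mpr h1⟩
    · exact absurd (S.attached_iff.mpr (S.cross_iff.mp hc).2) ha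
  · intro v u _ hsouth
    obtain ⟨h1, h2, h3⟩ := S.south_iff.mp hsouth
    obtain ⟨h4, h5⟩ := below_rule hs ho h1 h2 h3
    refine ⟨h4, fun w _ => ⟨fun he => ?_, fun he => ?_⟩⟩
    · obtain ⟨⟨g1, g2, g3⟩, g4, g5⟩ := S.east_iff.mp he
      exact (h5 w g1.symm g2 g5.symm).1 g4
    · obtain ⟨⟨g1, g2, g3⟩, g4, g5⟩ := S.east_iff.mp he
      exact (h5 w g1 g3 g5).2 g4
  · intro v hv ha
    have hz := hbase hv
    rw [noWest_iff hz, noEast_iff hz, noSouth_iff hz]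
    exact natural_rule hs ho hz ha

/-- Each border node is matched with the code of its fragment and its own position; codes determine
fragments and layout coordinates determine nodes. -/
theorem exists_isMatching (S : InstanceLayout A L M r h) (hp : IsPivot A L p) :
    ∃ ρ, IsMatching A L p ρ := by
  obtain ⟨h1, h2, h3, h4⟩ := hp
  have hz : S.Z p = 0 := not_not.mp (mt label_eq_none.mpr h1)
  rw [noNorth_iff hz] at h3
  rw [noWest_iff hz] at h4
  have hc := comp_eq_none hz h2 h3
  have hfor {w : V} : Foreign A L p w ↔ ∃ F, S.comp w = some F ∧ S.Z w = 0 ∧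
      BorderCode.OnBorder (2 ^ (3 * r)) (FragmentCode.ofFragment F, (S.X w, S.Y w)) := by
    rw [foreign_iff (S := S)]
    constructor
    · rintro (hcr | hcr)
      · exact (S.cross_iff.mp hcr).2
      · exact absurd (S.attached_iff.mpr (S.cross_iff.mp hcr).2) h2
    · exact fun hw => .inl (S.cross_iff.mpr ⟨⟨hc, h4, h3, hz⟩, hw⟩)
  refine ⟨fun w c => ∃ F, S.comp w = some F ∧ S.Z w = 0 ∧
    BorderCode.OnBorder (2 ^ (3 * r)) c ∧ c = (FragmentCode.ofFragment F, (S.X w, S.Y w)), ?_⟩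
  refine ⟨?_, ?_, ?_, ?_, ?_, ?_, ?_⟩
  · rintro ⟨f, X, Y⟩ hcm
    rw [S.param, mem_borderList] at hcm
    obtain ⟨hf, hb⟩ := hcm
    simp only at hf hb
    obtain ⟨w, g1, g2, g3, g4⟩ := S.exists_base (some hf.toFragment) hb.1 hb.2.1
    exact ⟨w, hf.toFragment, g1, g4, hb, by rw [hf.ofFragment_toFragment, g2, g3]⟩
  · rintro w c ⟨F, _, _, hb, rfl⟩
    rw [S.param, mem_borderList]
    exact ⟨FragmentCode.valid_ofFragment F, hb⟩
  · rintro w c w' c' ⟨F, g1, g2, _, rfl⟩ ⟨F', g1', g2', _, rfl⟩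
    constructor
    · rintro rfl
      obtain rfl := Option.some.inj (g1.symm.trans g1')
      rfl
    · intro he
      obtain ⟨e1, e2⟩ := Prod.mk.inj he
      obtain ⟨e3, e4⟩ := Prod.mk.inj e2
      obtain rfl := FragmentCode.ofFragment_injective e1
      exact S.ext (g1.trans g1'.symm) e3 e4 (g2.trans g2'.symm)
  · intro w hw
    obtain ⟨F, g1, g2, g3⟩ := hfor.mp hw
    exact ⟨_, F, g1, g2, g3, rfl⟩
  · rintro w c ⟨F, g1, g2, g3, rfl⟩
    exact hfor.mpr ⟨F, g1, g2, g3⟩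
  · rintro w c ⟨F, g1, g2, g3, rfl⟩
    rw [S.param]
    have hside : 2 ^ pyramidHeight h (S.comp w) = 2 ^ (3 * r) := by rw [g1]; rfl
    exact ⟨S.label_fragment g1 g2, noWest_iff g2, (noEast_iff g2).trans (by rw [hside]),
      noNorth_iff g2, (noSouth_iff g2).trans (by rw [hside])⟩
  · rintro w c w' c' ⟨F, g1, g2, _, rfl⟩ ⟨F', g1', g2', _, rfl⟩ ⟨e1, e2⟩
    obtain rfl := FragmentCode.ofFragment_injective e1
    refine S.adj_cases_iff.mpr (.inr (.inr (.inl ⟨g1'.trans g1.symm, g2'.trans g2.symm, ?_⟩)))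
    unfold GridAdj
    simp only at e2
    omega

theorem structureCheck (S : InstanceLayout A L M r h) (hs : s + 1 = 2 ^ h) {o : ℕ}
    (ho : HaltsWithOutput M s o) (v : V) : StructureCheck A L v :=
  ⟨(LocalFormula.forall_holds_rules A L).mpr (S.locallyConsistent hs ho) v,
    fun hv => S.exists_isMatching hv⟩

end InstanceLayout

end LocalDecision

namespace LocalDecision

open MeasureTheory

/-! ## The decider -/

/-- The machine is deterministic and a halted configuration has no successor, so even the running
time is unique. -/
theorem HaltsWithOutput.unique {M : Machine} {s s' o o' : ℕ} (h : HaltsWithOutput M s o)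
    (h' : HaltsWithOutput M s' o') : o = o' := by
  have main {s s' o o' : ℕ} (h : HaltsWithOutput M s o) (h' : HaltsWithOutput M s' o') :
      ¬ s < s' := by
    intro hlt
    obtain ⟨C, hC, ht, _⟩ := h
    obtain ⟨D, hD, _⟩ := h'
    obtain ⟨C', hC'⟩ := exists_configAt hD hlt
    obtain ⟨C₀, hC₀, hst⟩ := configAt_succ.mp hC'
    obtain rfl := Option.some.inj (hC.symm.trans hC₀)
    obtain ⟨b, m, ht', _⟩ := step_eq_some hst
    rw [ht] at ht'
    cases ht'
  obtain rfl : s = s' := le_antisymm (not_lt.mp (main h' h)) (not_lt.mp (main h h'))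
  obtain ⟨C, hC, _, rfl⟩ := h
  obtain ⟨D, hD, _, rfl⟩ := h'
  obtain rfl := Option.some.inj (hC.symm.trans hD)
  rfl

/-- The bottom layer over the execution table already has this many nodes. -/
theorem four_pow_le_card {V : Type} [Fintype V] {M : Machine} {r h : ℕ} (e : V ≃ Node M r h) :
    4 ^ h ≤ Fintype.card V := by
  let f : Fin (2 ^ h) × Fin (2 ^ h) → V := fun p =>
    e.symm (.inl ⟨p.1, p.2, 0, Nat.zero_le _, p.1.2, p.2.2⟩)
  have hf : Function.Injective f := by
    intro p q hpq
    have := Sum.inl.inj (e.symm.injective hpq)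
    exact Prod.ext (Fin.ext (congrArg Pyramid.x this)) (Fin.ext (congrArg Pyramid.y this))
  have := Fintype.card_le_of_injective f hf
  rwa [Fintype.card_prod, Fintype.card_fin, ← mul_pow] at this

theorem decider_halts {V : Type} [Finite V] (G : SimpleGraph V) (x : V → Label) (ident : V → ℕ) :
    ∀ᵐ ω ∂(coinMeasure V), ∀ v, ∃ b, decider.Outputs G x ident ω v b := by
  filter_upwards [ae_exists_firstHead] with ω hω v
  simp only [decider_outputs_iff]
  by_cases hv : StructureCheck G.Adj x v
  · obtain ⟨k, hk⟩ := hω v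
    by_cases hr : RejectsWithin (x v).1.1 (2 ^ k)
    · exact ⟨false, k, .inr ⟨hv, hk, by simpa using hr⟩⟩
    · exact ⟨true, k, .inr ⟨hv, hk, by simpa using hr⟩⟩
  · exact ⟨false, 0, .inl ⟨hv, rfl⟩⟩

theorem decider_accepts {V : Type} [Finite V] {G : SimpleGraph V} {x : V → Label}
    (hP : propertyP.holds G x) (ident : V → ℕ) :
    ∀ᵐ ω ∂(coinMeasure V), ∀ v, decider.Outputs G x ident ω v true := by
  obtain ⟨M, r, h, s, hs, hM, φ, hφ⟩ := hP
  have hcheck : ∀ v, StructureCheck G.Adj x v :=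
    ((instanceLayout M r h).comap φ hφ).structureCheck hs hM
  filter_upwards [ae_exists_firstHead] with ω hω v
  obtain ⟨k, hk⟩ := hω v
  refine decider_outputs_iff.mpr ⟨k, .inr ⟨hcheck v, hk, iff_of_true rfl ?_⟩⟩
  rw [rejectsWithin_iff]
  rintro ⟨s', _, o, ho, hM'⟩
  rw [hφ, show (instanceLabel M r h (φ v)).1.1 = M from
    congrArg Prod.fst ((instanceLayout M r h).param _)] at hM'
  exact ho (hM.unique hM').symm

/-- Either some node fails the structural check and says no regardless of its coins, or the graph is
a `G(M, r)` whose machine has a nonzero output, and a single node with `h` initial tails discovers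
it. -/
theorem decider_rejects {V : Type} [Fintype V] {G : SimpleGraph V} {x : V → Label}
    (hG : G.Connected) (hP : ¬ propertyP.holds G x) (ident : V → ℕ) :
    1 - (1 - 1 / Real.sqrt (Fintype.card V : ℝ)) ^ Fintype.card V ≤
      (coinMeasure V).real {ω | ∃ v, decider.Outputs G x ident ω v false} := by
  have hV := hG.nonempty
  by_cases hcheck : ∀ v, StructureCheck G.Adj x v
  · obtain ⟨M, r, h, s, o, hs, hM, φ, hφ⟩ := Accepted.exists_iso ⟨hG, hcheck⟩
    have ho : o ≠ 0 := by
      rintro rfl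
      exact hP ⟨M, r, h, s, hs, hM, φ, hφ⟩
    refine le_coinMeasure_exists_firstHead (four_pow_le_card φ.toEquiv) ?_
    rintro ω ⟨v, k, hk, hv⟩
    refine ⟨v, decider_outputs_iff.mpr ⟨k, .inr ⟨hcheck v, hv, iff_of_false nofun ?_⟩⟩⟩
    rw [not_not, rejectsWithin_iff, hφ, show (instanceLabel M r h (φ v)).1.1 = M from
      congrArg Prod.fst ((instanceLayout M r h).param _)]
    -- At least `2 ^ h = s + 1` steps are simulated, which exceeds the running time `s`.
    have := Nat.pow_le_pow_right (n := 2) (by norm_num) hk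
    exact ⟨s, by omega, o, ho, hM⟩
  · obtain ⟨v, hv⟩ := not_forall.mp hcheck
    have huniv : {ω | ∃ v, decider.Outputs G x ident ω v false} = Set.univ :=
      Set.eq_univ_of_forall fun ω => ⟨v, decider_outputs_iff.mpr ⟨0, .inl ⟨hv, rfl⟩⟩⟩
    rw [huniv, probReal_univ, sub_le_self_iff]
    have hcard : (1 : ℝ) ≤ Fintype.card V := by exact_mod_cast Fintype.card_pos
    refine pow_nonneg (sub_nonneg.mpr ?_) _
    rw [div_le_one (Real.sqrt_pos.mpr (by linarith))]
    exact Real.one_le_sqrt.mpr hcard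

theorem decider_isDecider : decider.IsDecider propertyP 1
    (fun n : ℕ => 1 - (1 - 1 / Real.sqrt (n : ℝ)) ^ n) where
  halts G x ident _ _ := decider_halts G x ident
  accepts {V} _ G x ident _ _ hP := by
    rw [measureReal_def, measure_congr (ae_eq_univ.mpr (decider_accepts hP ident)), measure_univ,
      ENNReal.toReal_one]
  rejects G x ident hG _ hP := decider_rejects hG hP ident

end LocalDecision

theorem corollary1 :
    (∃ A : LocalDecision.RandomisedLocalAlgorithm LocalDecision.Label,
      A.IdOblivious ∧
      A.IsDecider LocalDecision.propertyP 1
        (fun n : ℕ => 1 - (1 - 1 / Real.sqrt (n : ℝ)) ^ n)) ∧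
    Filter.Tendsto (fun n : ℕ => 1 - (1 - 1 / Real.sqrt (n : ℝ)) ^ n)
      Filter.atTop (nhds (1 : ℝ)) :=
  ⟨⟨LocalDecision.decider, LocalDecision.decider_idOblivious, LocalDecision.decider_isDecider⟩,
    LocalDecision.tendsto_bound⟩
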